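/- Fix $0<p<\frac12$, let $q=1-p$, let $m_p=\lfloor 1/\log_2(1/q)\rfloor$, and let $t$ be a fixed integer with $1\le t\le m_p$. Let $Q_p^d$ be the random subgraph of the $d$-dimensional hypercube $Q^d$ (vertex set $\{0,1\}^d$, two vertices adjacent when they differ in exactly one coordinate) that keeps all vertices and in which each edge of $Q^d$ is present independently with probability $p$. Let $X_t=X_t(d)$ be the number of connected components of $Q_p^d$ with exactly $t$ vertices, and let $\mu_t=\mu_t(d)=\mathbb{E}[X_t]$. Then the following hold as $d\to\infty$ (with $p$ and $t$ fixed). (a) $\mu_t=(1+O(\tfrac1d))\,\frac{t^{t-2}}{t!}\left(\frac{p}{q^2}\right)^{t-1}d^{\,t-1}(2q^t)^d$, and $\operatorname{Var}(X_t)=(1+O(d^t q^{td}))\,\mu_t$. (b) For each $\varepsilon>0$, with probability $1-e^{-\Omega(d)}$ we have $|X_t-\mu_t|<\varepsilon\sqrt{d\mu_t}$; and, for each $\varepsilon>0$, with probability $1-e^{-\Omega(d)}$ we have $|X_t-\mu_t|<\varepsilon\mu_t$. (c) $d_{TV}(X_t,\mathrm{Po}(\mu_t))=O(d^tq^{td})$,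 where $\mathrm{Po}(\mu)$ is the Poisson distribution with mean $\mu$ and $d_{TV}(Y,Y')=\frac12\sum_k|\mathbb{P}(Y=k)-\mathbb{P}(Y'=k)|$; and $X_t^*=(X_t-\mu_t)/\sqrt{\operatorname{Var}(X_t)}$ converges in distribution to a standard normal random variable. -/

import Mathlib

open MeasureTheory ProbabilityTheory Filter Asymptotics
open scoped Topology

namespace RandomCube

/-- The hypercube `Q^d`: the graph on `{0,1}^d` in which two vertices are adjacent when they differ
in exactly one coordinate. -/
def cube (d : ℕ) : SimpleGraph (Fin d → Bool) where
  Adj x y := ∃! i, x i ≠ y i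
  symm := ⟨fun x y h => by simpa only [ne_comm] using h⟩
  loopless := ⟨fun x h => by simp [ExistsUnique] at h⟩

/-- The law of the random subgraph `Q_p^d`: the vertex set is that of `Q^d`, and each edge of `Q^d`
is present independently with probability `p`. -/
noncomputable def law (p : unitInterval) (d : ℕ) : Measure (SimpleGraph (Fin d → Bool)) :=
  (setBernoulli (cube d).edgeSet p).map SimpleGraph.fromEdgeSet

instance (p : unitInterval) (d : ℕ) : IsProbabilityMeasure (law p d) :=
  Measure.isProbabilityMeasure_map SimpleGraph.measurable_fromEdgeSet.aemeasurable

/-- The number `X_t` of (connected) components of a graph that have exactly `t` vertices. -/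
noncomputable def numComp {V : Type*} (t : ℕ) (G : SimpleGraph V) : ℕ :=
  {c : G.ConnectedComponent | c.supp.ncard = t}.ncard

/-- The mean `μ_t = E[X_t]` in `Q_p^d`. -/
noncomputable def mean (p : unitInterval) (t d : ℕ) : ℝ :=
  ∫ G, (numComp t G : ℝ) ∂(law p d)

/-- The variance `Var(X_t)` in `Q_p^d`. -/
noncomputable def var (p : unitInterval) (t d : ℕ) : ℝ :=
  variance (fun G => (numComp t G : ℝ)) (law p d)

/-- `m_p = ⌊1 / log₂ (1 / q)⌋`, where `q = 1 - p`. -/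
noncomputable def maxSize (p : unitInterval) : ℕ :=
  ⌊1 / Real.logb 2 (1 / (1 - (p : ℝ)))⌋₊

/-- The property `E` holds with very high probability in `Q_p^d`, that is, with probability
`1 - e^{-Ω(d)}` as `d → ∞`. -/
def Wvhp (p : unitInterval) (E : ∀ d : ℕ, SimpleGraph (Fin d → Bool) → Prop) : Prop :=
  ∃ c : ℝ, 0 < c ∧ ∀ᶠ d : ℕ in atTop, 1 - Real.exp (-(c * d)) ≤ (law p d).real {G | E d G}

/-- Total variation distance between two distributions on the nonnegative integers. -/
noncomputable def tvDist (μ ν : Measure ℕ) : ℝ :=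
  (1 / 2) * ∑' k : ℕ, |μ.real {k} - ν.real {k}|

end RandomCube

/-! Write X_t as the sum, over the connected t-sets S of the cube, of the indicators that S is a
component. Two facts drive everything: most such sets are trees using t-1 different directions, and
the indicators are only locally dependent.

Mean. Seen from one of its vertices y, S is a family of sets of directions. Growing it one vertex at
a time shows that it uses at most t-1 directions (`ConnFrom.card_support`). If it uses exactly t-1,
each direction occurs on exactly one edge, so S induces a tree and is a component with probability
exactly p^(t-1) q^(td-2(t-1)). Cutting the edge in one direction gives a recursion which Abel's
identity solves: each set of t-1 directions carries t^(t-2) such trees (`card_rootedTrees`). The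
remaining sets through y number O(d^(t-2)), none if t = 1, and each has probability O(q^(td)); this
is the relative error O(1/d) in `mean_bound`.

Dependence. Whether S is a component depends only on the edges meeting S, so sets that neither meet
nor are adjacent have independent indicators. Each S has O(d^t) near sets S', each a component with
probability O(q^(td)), also in the presence of S. Hence the sum in `dependence_bound` is O(d^t
q^(td)) times the mean. It bounds Var(X_t) minus the mean directly, and the distance to the Poisson
law through `stein_chen`, whose factor 1/mean cancels the mean.

Limits. The condition t ≤ m_p says 2q^t ≥ 1, so the mean grows at least linearly (for t = 1 because
p < 1/2), while d^t q^(td) is exponentially small. Chernoff bounds for the Poisson law therefore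
transfer to X_t. The characteristic functions of the normalised X_t differ from those of a
normalised Poisson variable by a vanishing amount, and the latter tend to the Gaussian one since
Var(X_t)/mean tends to 1. -/

namespace RandomCube

/-! ### Connectivity inside a finite set -/

/-- Every element of `S` can be reached from `r` by `R`-steps inside `S`. -/
def ConnFrom {β : Type*} (R : β → β → Prop) (S : Finset β) (r : β) : Prop :=
  ∀ x ∈ S, Relation.ReflTransGen (fun a b => a ∈ S ∧ b ∈ S ∧ R a b) r x

section ConnFrom

variable {β γ : Type*} {R : β → β → Prop} {S : Finset β} {r : β}

theorem ConnFrom.exists_crossing (h : ConnFrom R S r) (Q : β → Prop) (hr : Q r) {x : β}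
    (hx : x ∈ S) (hQx : ¬ Q x) : ∃ a b, a ∈ S ∧ b ∈ S ∧ R a b ∧ Q a ∧ ¬ Q b := by
  by_contra! hcon
  have key : ∀ y, Relation.ReflTransGen (fun a b => a ∈ S ∧ b ∈ S ∧ R a b) r y → Q y := by
    intro y hy
    induction hy with
    | refl => exact hr
    | tail _ hab ih => exact hcon _ _ hab.1 hab.2.1 hab.2.2 ih
  exact hQx (key x (h x hx))

/-- Induction along a growing connected set: a largest `G` with `P G` must be all of `S`, since
otherwise some step of `R` leaves it. -/
theorem ConnFrom.grow [DecidableEq β] (h : ConnFrom R S r) (hr : r ∈ S) (P : Finset β → Prop)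
    (h0 : P {r}) (hstep : ∀ G ⊆ S, r ∈ G → P G → ∀ x ∈ G, ∀ y ∈ S, y ∉ G → R x y →
      P (insert y G)) : P S := by
  classical
  have hne : (S.powerset.filter fun G => r ∈ G ∧ P G).Nonempty :=
    ⟨{r}, by simp [hr, h0]⟩
  obtain ⟨G, hG, hmax⟩ := Finset.exists_max_image _ Finset.card hne
  simp only [Finset.mem_filter, Finset.mem_powerset] at hG hmax
  obtain ⟨hGS, hrG, hPG⟩ := hG
  by_cases hEq : G = S
  · exact hEq ▸ hPG
  obtain ⟨z, hzS, hzG⟩ : ∃ z ∈ S, z ∉ G := by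
    by_contra! hc
    exact hEq (Finset.Subset.antisymm hGS hc)
  obtain ⟨a, b, haS, hbS, hab, haG, hbG⟩ := h.exists_crossing (· ∈ G) hrG hzS hzG
  have := hmax (insert b G) ⟨Finset.insert_subset hbS hGS, Finset.mem_insert_of_mem hrG,
    hstep G hGS hrG hPG a haG b hbS hbG hab⟩
  rw [Finset.card_insert_of_notMem hbG] at this
  omega

theorem ConnFrom.mono_rel {R' : β → β → Prop} (h : ConnFrom R S r)
    (hR : ∀ a ∈ S, ∀ b ∈ S, R a b → R' a b) : ConnFrom R' S r := fun x hx =>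
  Relation.ReflTransGen.mono (fun a b hab => ⟨hab.1, hab.2.1, hR a hab.1 b hab.2.1 hab.2.2⟩) _ _ (h x hx)

theorem ConnFrom.image [DecidableEq γ] {R' : γ → γ → Prop} (h : ConnFrom R S r) (f : β → γ)
    (hf : ∀ a ∈ S, ∀ b ∈ S, R a b → f a = f b ∨ R' (f a) (f b)) :
    ConnFrom R' (S.image f) (f r) := by
  intro y hy
  obtain ⟨x, hx, rfl⟩ := Finset.mem_image.1 hy
  have key : ∀ z, Relation.ReflTransGen (fun a b => a ∈ S ∧ b ∈ S ∧ R a b) r z →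
      Relation.ReflTransGen (fun a b => a ∈ S.image f ∧ b ∈ S.image f ∧ R' a b) (f r) (f z) := by
    intro z hz
    induction hz with
    | refl => exact .refl
    | @tail b c _ hab ih =>
      rcases hf _ hab.1 _ hab.2.1 hab.2.2 with he | hR
      · exact he ▸ ih
      · exact ih.tail ⟨Finset.mem_image_of_mem f hab.1, Finset.mem_image_of_mem f hab.2.1, hR⟩
  exact key x (h x hx)

end ConnFrom

/-! ### Tree-like families of finite sets -/

section Families

variable {α : Type*} [DecidableEq α]

/-- Two finite sets differ in exactly one element. -/
def Flip (A B : Finset α) : Prop := ∃ a, symmDiff A B = {a}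

theorem Flip.symm {A B : Finset α} (h : Flip A B) : Flip B A := by
  obtain ⟨a, ha⟩ := h
  exact ⟨a, by rwa [symmDiff_comm]⟩

theorem flip_insert {A : Finset α} {a : α} (h : a ∉ A) : Flip A (insert a A) := by
  refine ⟨a, ?_⟩
  ext x
  simp only [Finset.mem_symmDiff, Finset.mem_insert, Finset.mem_singleton]
  grind

theorem Flip.mem_iff_of_ne {A B : Finset α} {a i : α} (h : symmDiff A B = {a}) (hi : i ≠ a) :
    i ∈ A ↔ i ∈ B := by
  have := Finset.ext_iff.1 h i
  simp only [Finset.mem_symmDiff, Finset.mem_singleton, hi, iff_false] at this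
  tauto

theorem Flip.eq_insert {A B : Finset α} {a : α} (h : Flip A B) (hA : a ∉ A) (hB : a ∈ B) :
    B = insert a A := by
  obtain ⟨c, hc⟩ := h
  have hca : c = a := by
    by_contra hne
    exact hA ((Flip.mem_iff_of_ne hc (Ne.symm hne)).2 hB)
  subst hca
  ext i
  by_cases hi : i = c
  · simp [hi, hB]
  · simp [hi, Flip.mem_iff_of_ne hc hi]

/-- Each vertex added along an edge brings in at most one new direction. -/
theorem ConnFrom.card_support {F : Finset (Finset α)} {r : Finset α} (h : ConnFrom Flip F r)
    (hr : r ∈ F) : (F.sup fun x => symmDiff x r).card + 1 ≤ F.card := by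
  refine h.grow hr (fun G => (G.sup fun x => symmDiff x r).card + 1 ≤ G.card) (by simp) ?_
  rintro G - hrG hG x hx y - hy ⟨a, ha⟩
  rw [Finset.card_insert_of_notMem hy, Finset.sup_insert]
  have hsub : symmDiff y r ⊔ (G.sup fun x => symmDiff x r) ⊆
      insert a (G.sup fun x => symmDiff x r) := by
    intro i hi
    by_cases hia : i = a
    · simp [hia]
    rw [Finset.mem_insert]
    right
    rw [Finset.sup_eq_union, Finset.mem_union] at hi
    rcases hi with hi | hi
    · refine Finset.mem_sup.2 ⟨x, hx, ?_⟩
      have := Flip.mem_iff_of_ne ha hia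
      simp only [Finset.mem_symmDiff] at hi ⊢
      tauto
    · exact hi
  have := (Finset.card_le_card hsub).trans (Finset.card_insert_le _ _)
  omega

theorem ConnFrom.card_sup {F : Finset (Finset α)} (h : ConnFrom Flip F ∅)
    (hr : ∅ ∈ F) : (F.sup id).card + 1 ≤ F.card := by
  have := h.card_support hr
  simp only [← Finset.bot_eq_empty, symmDiff_bot] at this
  exact this

open scoped Classical in
/-- The connected families of `|D| + 1` subsets of `D` that contain `∅` and cover `D`. -/
noncomputable def rootedTrees (D : Finset α) : Finset (Finset (Finset α)) :=
  D.powerset.powerset.filter fun F =>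
    ∅ ∈ F ∧ F.card = D.card + 1 ∧ F.sup id = D ∧ ConnFrom Flip F ∅

theorem mem_rootedTrees {D : Finset α} {F : Finset (Finset α)} :
    F ∈ rootedTrees D ↔ ∅ ∈ F ∧ F.card = D.card + 1 ∧ F.sup id = D ∧ ConnFrom Flip F ∅ := by
  simp only [rootedTrees, Finset.mem_filter, Finset.mem_powerset, and_iff_right_iff_imp]
  rintro ⟨-, -, h, -⟩ x hx
  rw [Finset.mem_powerset, ← h]
  exact Finset.le_sup (f := id) hx

theorem subset_of_mem_rootedTrees {D A : Finset α} {F : Finset (Finset α)}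
    (h : F ∈ rootedTrees D) (hA : A ∈ F) : A ⊆ D := by
  rw [← (mem_rootedTrees.1 h).2.2.1]
  exact Finset.le_sup (f := id) hA

/-- A path from `∅` to a member containing `a` has to cross the direction `a`. -/
theorem exists_edge_of_mem_rootedTrees {D : Finset α} {F : Finset (Finset α)} {a : α}
    (hF : F ∈ rootedTrees D) (ha : a ∈ D) : ∃ A ∈ F, a ∉ A ∧ insert a A ∈ F := by
  obtain ⟨h0, hc, hs, hconn⟩ := mem_rootedTrees.1 hF
  rw [← hs] at ha
  obtain ⟨x, hx, hax⟩ := Finset.mem_sup.1 ha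
  obtain ⟨A, B, hA, hB, hAB, hA', hB'⟩ :=
    hconn.exists_crossing (fun z => a ∉ z) (by simp) hx (by simpa using hax)
  have := hAB.eq_insert hA' (not_not.1 hB')
  exact ⟨A, hA, hA', this ▸ hB⟩

/-- Contract the direction `a`. Two different edges in that direction would merge two pairs of
vertices, leaving a connected family of at most `D.card - 1` vertices that still uses the `D.card -
1` other directions, one vertex too few for `ConnFrom.card_sup`. -/
theorem edge_unique_of_mem_rootedTrees {D : Finset α} {F : Finset (Finset α)} {a : α}
    (hF : F ∈ rootedTrees D) (ha : a ∈ D) {A B : Finset α} (hA : A ∈ F) (haA : a ∉ A)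
    (hA' : insert a A ∈ F) (hB : B ∈ F) (haB : a ∉ B) (hB' : insert a B ∈ F) : A = B := by
  obtain ⟨h0, hc, hs, hconn⟩ := mem_rootedTrees.1 hF
  by_contra hne
  have hne' : insert a A ≠ insert a B := fun h => hne <| by
    rw [← Finset.erase_insert haA, ← Finset.erase_insert haB, h]
  -- The upper ends of the two edges may be dropped: their lower ends have the same image.
  have himg : (F.image fun x => x.erase a) =
      ((F.erase (insert a A)).erase (insert a B)).image fun x => x.erase a := by
    apply Finset.Subset.antisymm
    · intro y hy
      obtain ⟨x, hx, rfl⟩ := Finset.mem_image.1 hy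
      rw [Finset.mem_image]
      by_cases h1 : x = insert a A
      · refine ⟨A, ?_, ?_⟩
        · simp only [Finset.mem_erase, ne_eq, hA, and_true]
          constructor
          · rintro rfl; simp at haA
          · intro h; rw [h] at haA; simp at haA
        · rw [h1, Finset.erase_insert haA, Finset.erase_eq_of_notMem haA]
      by_cases h2 : x = insert a B
      · refine ⟨B, ?_, ?_⟩
        · simp only [Finset.mem_erase, ne_eq, hB, and_true]
          constructor
          · intro h; rw [h] at haB; simp at haB
          · rintro rfl; simp at haB
        · rw [h2, Finset.erase_insert haB, Finset.erase_eq_of_notMem haB]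
      exact ⟨x, by simp [h1, h2, hx], rfl⟩
    · exact Finset.image_subset_image
        ((Finset.erase_subset _ _).trans (Finset.erase_subset _ _))
  have hconn' : ConnFrom Flip (F.image fun x => x.erase a) ∅ := by
    have := hconn.image (R' := Flip) (fun x => x.erase a) ?_
    · simpa using this
    · rintro x - y - ⟨c, hc⟩
      by_cases hca : c = a
      · left
        ext i
        by_cases hi : i = a
        · simp [hi]
        · simp [hi, Flip.mem_iff_of_ne hc (hca ▸ hi)]
      · right
        refine ⟨c, ?_⟩
        ext i
        have := Finset.ext_iff.1 hc i
        simp only [Finset.mem_symmDiff, Finset.mem_singleton, Finset.mem_erase] at this ⊢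
        grind
  have h1 := hconn'.card_sup (Finset.mem_image.2 ⟨∅, h0, by simp⟩)
  have h2 : (F.image fun x => x.erase a).card ≤ F.card - 2 := by
    rw [himg]
    refine Finset.card_image_le.trans ?_
    rw [Finset.card_erase_of_mem (Finset.mem_erase.2 ⟨hne'.symm, hB'⟩),
      Finset.card_erase_of_mem hA']
    omega
  have h3 : D.erase a ⊆ (F.image fun x => x.erase a).sup id := by
    intro i hi
    obtain ⟨hia, hiD⟩ := Finset.mem_erase.1 hi
    rw [← hs] at hiD
    obtain ⟨x, hx, hix⟩ := Finset.mem_sup.1 hiD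
    refine Finset.mem_sup.2 ⟨x.erase a, Finset.mem_image_of_mem _ hx, ?_⟩
    exact Finset.mem_erase.2 ⟨hia, hix⟩
  have h4 := Finset.card_le_card h3
  rw [Finset.card_erase_of_mem ha] at h4
  omega

/-- Join `F₀` to a copy of `F₁` by an edge in direction `a` at the vertex `A` of `F₀`. -/
def glue (a : α) (F₀ : Finset (Finset α)) (A : Finset α) (F₁ : Finset (Finset α)) :
    Finset (Finset α) :=
  F₀ ∪ F₁.image fun B => insert a (A ∪ B)

theorem insert_union_injOn {a : α} {D₀ D₁ A : Finset α} (ha : a ∉ D₁) (hA : A ⊆ D₀)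
    (hd : Disjoint D₀ D₁) :
    Set.InjOn (fun B => insert a (A ∪ B)) {B : Finset α | B ⊆ D₁} := by
  intro B hB B' hB' h
  ext i
  have hi := Finset.ext_iff.1 h i
  have h1 : i ∈ B → i ∈ D₁ := fun h => hB h
  have h2 : i ∈ B' → i ∈ D₁ := fun h => hB' h
  have h3 : i ∈ A → i ∈ D₀ := fun h => hA h
  have h4 : i ∈ D₀ → i ∉ D₁ := fun h => Finset.disjoint_left.1 hd h
  simp only [Finset.mem_insert, Finset.mem_union] at hi
  grind

theorem glue_mem_rootedTrees {a : α} {D₀ D₁ A : Finset α} {F₀ F₁ : Finset (Finset α)}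
    (ha₀ : a ∉ D₀) (ha₁ : a ∉ D₁) (hd : Disjoint D₀ D₁) (hF₀ : F₀ ∈ rootedTrees D₀)
    (hA : A ∈ F₀) (hF₁ : F₁ ∈ rootedTrees D₁) :
    glue a F₀ A F₁ ∈ rootedTrees (insert a (D₀ ∪ D₁)) := by
  have hAD := subset_of_mem_rootedTrees hF₀ hA
  obtain ⟨h0, hc, hs, hconn⟩ := mem_rootedTrees.1 hF₀
  obtain ⟨h0', hc', hs', hconn'⟩ := mem_rootedTrees.1 hF₁
  refine mem_rootedTrees.2 ⟨Finset.mem_union_left _ h0, ?_, ?_, ?_⟩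
  · rw [glue, Finset.card_union_of_disjoint, Finset.card_image_of_injOn,
      Finset.card_insert_of_notMem, Finset.card_union_of_disjoint hd]
    · omega
    · simp [ha₀, ha₁]
    · exact (insert_union_injOn ha₁ hAD hd).mono fun B hB => subset_of_mem_rootedTrees hF₁ hB
    · rw [Finset.disjoint_left]
      intro x hx hx'
      obtain ⟨B, -, rfl⟩ := Finset.mem_image.1 hx'
      exact ha₀ (subset_of_mem_rootedTrees hF₀ hx (Finset.mem_insert_self _ _))
  · rw [glue, Finset.sup_union, hs, Finset.sup_image]
    ext i
    rw [Finset.sup_eq_union, Finset.mem_union, Finset.mem_sup, Finset.mem_insert, Finset.mem_union]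
    simp only [Function.comp, id, Finset.mem_insert, Finset.mem_union]
    constructor
    · rintro (h | ⟨B, hB, h | h | h⟩)
      · tauto
      · tauto
      · exact .inr (.inl (hAD h))
      · exact .inr (.inr (subset_of_mem_rootedTrees hF₁ hB h))
    · rintro (h | h | h)
      · exact .inr ⟨∅, h0', .inl h⟩
      · exact .inl h
      · rw [← hs'] at h
        obtain ⟨B, hB, hi⟩ := Finset.mem_sup.1 h
        exact .inr ⟨B, hB, .inr (.inr hi)⟩
  · have hmem₀ : ∀ x ∈ F₀, x ∈ glue a F₀ A F₁ := fun x hx => Finset.mem_union_left _ hx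
    have hmem₁ : ∀ x ∈ F₁.image (fun B => insert a (A ∪ B)), x ∈ glue a F₀ A F₁ :=
      fun x hx => Finset.mem_union_right _ hx
    intro x hx
    rcases Finset.mem_union.1 hx with hx | hx
    · exact Relation.ReflTransGen.mono (fun u v huv => ⟨hmem₀ u huv.1, hmem₀ v huv.2.1, huv.2.2⟩)
        _ _ (hconn x hx)
    · have haA : a ∉ A := fun h => ha₀ (hAD h)
      have hroot : insert a A ∈ F₁.image (fun B => insert a (A ∪ B)) :=
        Finset.mem_image.2 ⟨∅, h0', by simp⟩
      have hl : ConnFrom Flip (F₁.image fun B => insert a (A ∪ B)) (insert a (A ∪ ∅)) := by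
        refine hconn'.image _ ?_
        rintro u hu v hv ⟨c, hcuv⟩
        right
        refine ⟨c, ?_⟩
        have hu' := subset_of_mem_rootedTrees hF₁ hu
        have hv' := subset_of_mem_rootedTrees hF₁ hv
        ext i
        have hi := Finset.ext_iff.1 hcuv i
        have h1 : i ∈ u → i ∈ D₁ := fun h => hu' h
        have h2 : i ∈ v → i ∈ D₁ := fun h => hv' h
        have h3 : i ∈ A → i ∈ D₀ := fun h => hAD h
        have h4 : i ∈ D₀ → i ∉ D₁ := fun h => Finset.disjoint_left.1 hd h
        simp only [Finset.mem_symmDiff, Finset.mem_insert, Finset.mem_union,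
          Finset.mem_singleton] at hi ⊢
        grind
      rw [Finset.union_empty] at hl
      refine Relation.ReflTransGen.trans ?_
        (Relation.ReflTransGen.mono (fun u v huv => ⟨hmem₁ u huv.1, hmem₁ v huv.2.1, huv.2.2⟩)
          _ _ (hl x hx))
      refine Relation.ReflTransGen.tail
        (Relation.ReflTransGen.mono (fun u v huv => ⟨hmem₀ u huv.1, hmem₀ v huv.2.1, huv.2.2⟩)
          _ _ (hconn A hA)) ?_
      exact ⟨hmem₀ A hA, hmem₁ _ hroot, flip_insert haA⟩

/-- Cut the unique edge in direction `a`. The part with `a` is translated back to the root by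
removing `insert a A`; counting vertices against directions shows that both halves are again
extremal, on complementary sets of directions. -/
theorem exists_glue_eq {a : α} {D : Finset α} (ha : a ∉ D) {F : Finset (Finset α)}
    (hF : F ∈ rootedTrees (insert a D)) :
    ∃ D₀ ⊆ D, ∃ F₀ ∈ rootedTrees D₀, ∃ A ∈ F₀, ∃ F₁ ∈ rootedTrees (D \ D₀),
      glue a F₀ A F₁ = F := by
  obtain ⟨A, hA, haA, hA'⟩ := exists_edge_of_mem_rootedTrees hF (Finset.mem_insert_self a D)
  have huniq : ∀ B ∈ F, a ∉ B → insert a B ∈ F → B = A := fun B hB haB hB' =>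
    edge_unique_of_mem_rootedTrees hF (Finset.mem_insert_self a D) hB haB hB' hA haA hA'
  obtain ⟨h0, hc, hs, hconn⟩ := mem_rootedTrees.1 hF
  set F₀ := F.filter fun x => a ∉ x with hF₀
  set G := F.filter fun x => a ∈ x with hG
  have hAF₀ : A ∈ F₀ := Finset.mem_filter.2 ⟨hA, haA⟩
  have hAG : insert a A ∈ G := Finset.mem_filter.2 ⟨hA', Finset.mem_insert_self _ _⟩
  -- A walk changes sides only through the edge from `A` to `insert a A`, so an excursion to the
  -- other side returns to the point where it began and can be cut out.
  have key : ∀ x, Relation.ReflTransGen (fun u v => u ∈ F ∧ v ∈ F ∧ Flip u v) ∅ x →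
      (a ∉ x → Relation.ReflTransGen (fun u v => u ∈ F₀ ∧ v ∈ F₀ ∧ Flip u v) ∅ x) ∧
      (a ∈ x → Relation.ReflTransGen (fun u v => u ∈ F₀ ∧ v ∈ F₀ ∧ Flip u v) ∅ A ∧
        Relation.ReflTransGen (fun u v => u ∈ G ∧ v ∈ G ∧ Flip u v) (insert a A) x) := by
    intro x hx
    induction hx with
    | refl => exact ⟨fun _ => .refl, by simp⟩
    | @tail u v _ huv ih =>
      obtain ⟨hu, hv, hfl⟩ := huv
      by_cases hau : a ∈ u <;> by_cases hav : a ∈ v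
      · exact ⟨fun h => absurd hav h, fun _ => ⟨(ih.2 hau).1, (ih.2 hau).2.tail
          ⟨Finset.mem_filter.2 ⟨hu, hau⟩, Finset.mem_filter.2 ⟨hv, hav⟩, hfl⟩⟩⟩
      · have he := hfl.symm.eq_insert hav hau
        have hvA := huniq v hv hav (he ▸ hu)
        exact ⟨fun _ => hvA ▸ (ih.2 hau).1, fun h => absurd h hav⟩
      · have he := hfl.eq_insert hau hav
        have huA := huniq u hu hau (he ▸ hv)
        subst huA
        exact ⟨fun h => absurd hav h, fun _ => ⟨ih.1 hau, he ▸ .refl⟩⟩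
      · exact ⟨fun _ => (ih.1 hau).tail
          ⟨Finset.mem_filter.2 ⟨hu, hau⟩, Finset.mem_filter.2 ⟨hv, hav⟩, hfl⟩,
          fun h => absurd h hav⟩
  have hconn₀ : ConnFrom Flip F₀ ∅ := fun x hx =>
    (key x (hconn x (Finset.mem_filter.1 hx).1)).1 (Finset.mem_filter.1 hx).2
  have hconnG : ConnFrom Flip G (insert a A) := fun x hx =>
    ((key x (hconn x (Finset.mem_filter.1 hx).1)).2 (Finset.mem_filter.1 hx).2).2
  have h0' : ∅ ∈ F₀ := Finset.mem_filter.2 ⟨h0, by simp⟩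
  set D₀ := F₀.sup id with hD₀
  set D₁ := G.sup (fun x => symmDiff x (insert a A)) with hD₁
  have hc₀ : D₀.card + 1 ≤ F₀.card := hconn₀.card_sup h0'
  have hc₁ : D₁.card + 1 ≤ G.card := hconnG.card_support hAG
  have hcF : F₀.card + G.card = F.card := by
    rw [add_comm]; exact Finset.card_filter_add_card_filter_not (s := F) (fun x => a ∈ x)
  have hAD₀ : A ⊆ D₀ := Finset.le_sup (f := id) hAF₀
  have haD₀ : a ∉ D₀ := by
    intro h
    obtain ⟨x, hx, hax⟩ := Finset.mem_sup.1 h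
    exact (Finset.mem_filter.1 hx).2 hax
  have haD₁ : a ∉ D₁ := by
    intro h
    obtain ⟨x, hx, hax⟩ := Finset.mem_sup.1 h
    have := (Finset.mem_filter.1 hx).2
    simp [Finset.mem_symmDiff, this] at hax
  have hcover : D ⊆ D₀ ∪ D₁ := by
    intro i hi
    have hia : i ≠ a := fun h => ha (h ▸ hi)
    have hi' : i ∈ F.sup id := by rw [hs]; exact Finset.mem_insert_of_mem hi
    obtain ⟨x, hx, hix⟩ := Finset.mem_sup.1 hi'
    rw [Finset.mem_union]
    by_cases hax : a ∈ x
    · by_cases hiA : i ∈ A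
      · exact .inl (hAD₀ hiA)
      · right
        refine Finset.mem_sup.2 ⟨x, Finset.mem_filter.2 ⟨hx, hax⟩, ?_⟩
        have : i ∈ x := hix
        simp [Finset.mem_symmDiff, this, hia, hiA]
    · left
      exact Finset.mem_sup.2 ⟨x, Finset.mem_filter.2 ⟨hx, hax⟩, hix⟩
  have hcov' : D₀ ∪ D₁ ⊆ D := by
    intro i hi
    have hia : i ≠ a := by
      rintro rfl
      rcases Finset.mem_union.1 hi with h | h
      · exact haD₀ h
      · exact haD₁ h
    have hsub : ∀ x ∈ F, x ⊆ insert a D := fun x hx => subset_of_mem_rootedTrees hF hx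
    have : i ∈ insert a D := by
      rcases Finset.mem_union.1 hi with h | h
      · obtain ⟨x, hx, hix⟩ := Finset.mem_sup.1 h
        exact hsub x (Finset.mem_filter.1 hx).1 hix
      · obtain ⟨x, hx, hix⟩ := Finset.mem_sup.1 h
        rcases Finset.mem_symmDiff.1 hix with h | h
        · exact hsub x (Finset.mem_filter.1 hx).1 h.1
        · exact hsub _ hA' h.1
    exact Finset.mem_of_mem_insert_of_ne this hia
  have hDeq : D = D₀ ∪ D₁ := Finset.Subset.antisymm hcover hcov'
  rw [Finset.card_insert_of_notMem ha] at hc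
  have hle : D.card ≤ D₀.card + D₁.card := hDeq ▸ Finset.card_union_le _ _
  -- The halves have at least `D₀.card + 1` and `D₁.card + 1` vertices, and `D.card + 2` in total,
  -- so the union bound for `D = D₀ ∪ D₁` is an equality.
  have hdisj : Disjoint D₀ D₁ := by
    rw [← Finset.card_union_eq_card_add_card, ← hDeq]
    omega
  have hDsd : D \ D₀ = D₁ := by
    rw [hDeq, Finset.union_sdiff_left, hdisj.symm.sdiff_eq_left]
  -- An element of `A` missing from `x` would be a direction used in both halves.
  have hsubG : ∀ x ∈ G, insert a A ⊆ x := by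
    intro x hx i hi
    rcases Finset.mem_insert.1 hi with rfl | hiA
    · exact (Finset.mem_filter.1 hx).2
    · by_contra hix
      have : i ∈ D₁ := Finset.mem_sup.2 ⟨x, hx, by
        rw [Finset.mem_symmDiff]; exact .inr ⟨hi, hix⟩⟩
      exact Finset.disjoint_left.1 hdisj (hAD₀ hiA) this
  have hback : ∀ x ∈ G, insert a (A ∪ (x \ insert a A)) = x := by
    intro x hx
    rw [← Finset.insert_union, Finset.union_sdiff_of_subset (hsubG x hx)]
  refine ⟨D₀, hDeq ▸ Finset.subset_union_left, F₀,
    mem_rootedTrees.2 ⟨h0', by omega, rfl, hconn₀⟩, A, hAF₀,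
    G.image fun x => x \ insert a A, ?_, ?_⟩
  · rw [hDsd]
    refine mem_rootedTrees.2 ⟨Finset.mem_image.2 ⟨_, hAG, by simp⟩, ?_, ?_, ?_⟩
    · rw [Finset.card_image_of_injOn]
      · omega
      · intro x hx y hy hxy
        rw [← hback x hx, ← hback y hy]
        simp only at hxy
        rw [hxy]
    · rw [Finset.sup_image, hD₁]
      refine Finset.sup_congr rfl fun x hx => ?_
      simp only [Function.comp, id]
      rw [symmDiff_of_ge (hsubG x hx)]
    · have := hconnG.image (R' := Flip) (fun x => x \ insert a A) ?_
      · simpa using this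
      · rintro u hu v hv ⟨c, hcuv⟩
        right
        refine ⟨c, ?_⟩
        ext i
        have hi := Finset.ext_iff.1 hcuv i
        have h1 := @hsubG u hu i
        have h2 := @hsubG v hv i
        simp only [Finset.mem_symmDiff, Finset.mem_sdiff, Finset.mem_singleton] at hi ⊢
        grind
  · rw [glue, Finset.image_image]
    have : (G.image ((fun B => insert a (A ∪ B)) ∘ fun x => x \ insert a A)) = G := by
      conv_rhs => rw [← Finset.image_id (s := G)]
      exact Finset.image_congr fun x hx => hback x hx
    rw [this, Finset.union_comm]
    exact Finset.filter_union_filter_not_eq (fun x => a ∈ x) F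

/-- The members without `a` give back `F₀`, whose union is `D₀`. Among the members with `a` there is
a least one, namely `insert a A`, which gives back `A` and then `F₁`. -/
theorem glue_injective {a : α} {D : Finset α} (ha : a ∉ D) {D₀ D₀' A A' : Finset α}
    {F₀ F₀' F₁ F₁' : Finset (Finset α)} (hD₀ : D₀ ⊆ D) (hD₀' : D₀' ⊆ D)
    (hF₀ : F₀ ∈ rootedTrees D₀) (hF₀' : F₀' ∈ rootedTrees D₀') (hA : A ∈ F₀) (hA' : A' ∈ F₀')
    (hF₁ : F₁ ∈ rootedTrees (D \ D₀)) (hF₁' : F₁' ∈ rootedTrees (D \ D₀'))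
    (h : glue a F₀ A F₁ = glue a F₀' A' F₁') :
    D₀ = D₀' ∧ F₀ = F₀' ∧ A = A' ∧ F₁ = F₁' := by
  have hfilt : ∀ {D₀ A : Finset α} {F₀ F₁ : Finset (Finset α)}, D₀ ⊆ D → F₀ ∈ rootedTrees D₀ →
      (glue a F₀ A F₁).filter (fun x => a ∉ x) = F₀ ∧
      (glue a F₀ A F₁).filter (fun x => a ∈ x) = F₁.image fun B => insert a (A ∪ B) := by
    intro D₀ A F₀ F₁ hD hF
    have h1 : ∀ x ∈ F₀, a ∉ x := fun x hx hax => ha (hD (subset_of_mem_rootedTrees hF hx hax))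
    constructor
    · ext x
      simp only [glue, Finset.mem_filter, Finset.mem_union, Finset.mem_image]
      constructor
      · rintro ⟨h | ⟨B, -, rfl⟩, h'⟩
        · exact h
        · simp at h'
      · exact fun h => ⟨.inl h, h1 x h⟩
    · ext x
      simp only [glue, Finset.mem_filter, Finset.mem_union, Finset.mem_image]
      constructor
      · rintro ⟨h | h, h'⟩
        · exact absurd h' (h1 x h)
        · exact h
      · rintro ⟨B, hB, rfl⟩
        exact ⟨.inr ⟨B, hB, rfl⟩, by simp⟩
  have e0 : F₀ = F₀' := by
    rw [← (hfilt (A := A) (F₁ := F₁) hD₀ hF₀).1, h, (hfilt hD₀' hF₀').1]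
  subst e0
  have eD : D₀ = D₀' := by
    rw [← (mem_rootedTrees.1 hF₀).2.2.1, (mem_rootedTrees.1 hF₀').2.2.1]
  subst eD
  have himg : (F₁.image fun B => insert a (A ∪ B)) = F₁'.image fun B => insert a (A' ∪ B) := by
    rw [← (hfilt (A := A) (F₁ := F₁) hD₀ hF₀).2, h, (hfilt hD₀' hF₀').2]
  have hd : Disjoint D₀ (D \ D₀) := Finset.disjoint_sdiff
  have hsub : ∀ {A A' : Finset α} {F₁ F₁' : Finset (Finset α)}, A ∈ F₀ → A' ∈ F₀ →
      F₁ ∈ rootedTrees (D \ D₀) → F₁' ∈ rootedTrees (D \ D₀) →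
      ((F₁.image fun B => insert a (A ∪ B)) = F₁'.image fun B => insert a (A' ∪ B)) → A ⊆ A' := by
    intro A A' F₁ F₁' hA hA' hF₁ hF₁' himg i hi
    have : insert a (A' ∪ ∅) ∈ F₁.image fun B => insert a (A ∪ B) := by
      rw [himg]
      exact Finset.mem_image_of_mem (fun B => insert a (A' ∪ B)) (mem_rootedTrees.1 hF₁').1
    obtain ⟨B, hB, hBe⟩ := Finset.mem_image.1 this
    have hia : i ≠ a := fun h => ha (hD₀ (subset_of_mem_rootedTrees hF₀ hA (h ▸ hi)))
    have := (Finset.ext_iff.1 hBe i).1 (by simp [hi])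
    simpa [hia] using this
  have eA : A = A' := Finset.Subset.antisymm (hsub hA hA' hF₁ hF₁' himg)
    (hsub hA' hA hF₁' hF₁ himg.symm)
  subst eA
  refine ⟨rfl, rfl, rfl, ?_⟩
  have hinj := insert_union_injOn (a := a) (A := A) (fun h => ha (Finset.mem_sdiff.1 h).1)
    (subset_of_mem_rootedTrees hF₀ hA) hd
  have hs1 : ∀ B ∈ F₁, B ∈ {B : Finset α | B ⊆ D \ D₀} := fun B hB =>
    subset_of_mem_rootedTrees hF₁ hB
  have hs2 : ∀ B ∈ F₁', B ∈ {B : Finset α | B ⊆ D \ D₀} := fun B hB =>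
    subset_of_mem_rootedTrees hF₁' hB
  ext B
  constructor
  · intro hB
    have := himg ▸ Finset.mem_image_of_mem (fun B => insert a (A ∪ B)) hB
    obtain ⟨B', hB', he⟩ := Finset.mem_image.1 this
    exact hinj (hs2 B' hB') (hs1 B hB) he ▸ hB'
  · intro hB
    have := himg.symm ▸ Finset.mem_image_of_mem (fun B => insert a (A ∪ B)) hB
    obtain ⟨B', hB', he⟩ := Finset.mem_image.1 this
    exact hinj (hs1 B' hB') (hs2 B hB) he ▸ hB'

/-- `D₀` is the set of directions on the root's side of the edge in direction `a`; the factor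
`D₀.card + 1` counts the vertices at which that edge can be attached. -/
theorem card_rootedTrees_insert {a : α} {D : Finset α} (ha : a ∉ D) :
    (rootedTrees (insert a D)).card = ∑ D₀ ∈ D.powerset,
      (rootedTrees D₀).card * (D₀.card + 1) * (rootedTrees (D \ D₀)).card := by
  have hcard : (D.powerset.sigma fun D₀ =>
      ((rootedTrees D₀).sigma fun F₀ => F₀) ×ˢ rootedTrees (D \ D₀)).card =
      ∑ D₀ ∈ D.powerset,
        (rootedTrees D₀).card * (D₀.card + 1) * (rootedTrees (D \ D₀)).card := by
    rw [Finset.card_sigma]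
    refine Finset.sum_congr rfl fun D₀ _ => ?_
    rw [Finset.card_product, Finset.card_sigma,
      Finset.sum_congr rfl fun F hF => (mem_rootedTrees.1 hF).2.1, Finset.sum_const, smul_eq_mul]
  rw [← hcard]
  symm
  refine Finset.card_bij (fun x _ => glue a x.2.1.1 x.2.1.2 x.2.2) ?_ ?_ ?_
  · rintro ⟨D₀, ⟨F₀, A⟩, F₁⟩ h
    simp only [Finset.mem_sigma, Finset.mem_powerset, Finset.mem_product] at h
    obtain ⟨hD, ⟨hF₀, hA⟩, hF₁⟩ := h
    have := glue_mem_rootedTrees (fun h => ha (hD h)) (fun h => ha (Finset.mem_sdiff.1 h).1)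
      Finset.disjoint_sdiff hF₀ hA hF₁
    rwa [Finset.union_sdiff_of_subset hD] at this
  · rintro ⟨D₀, ⟨F₀, A⟩, F₁⟩ h ⟨D₀', ⟨F₀', A'⟩, F₁'⟩ h' he
    simp only [Finset.mem_sigma, Finset.mem_powerset, Finset.mem_product] at h h'
    obtain ⟨hD, ⟨hF₀, hA⟩, hF₁⟩ := h
    obtain ⟨hD', ⟨hF₀', hA'⟩, hF₁'⟩ := h'
    obtain ⟨rfl, rfl, rfl, rfl⟩ := glue_injective ha hD hD' hF₀ hF₀' hA hA' hF₁ hF₁' he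
    rfl
  · intro F hF
    obtain ⟨D₀, hD, F₀, hF₀, A, hA, F₁, hF₁, he⟩ := exists_glue_eq ha hF
    exact ⟨⟨D₀, ⟨F₀, A⟩, F₁⟩, by simp [Finset.mem_sigma, hD, hF₀, hA, hF₁], he⟩

end Families

/-! ### Abel's binomial identity, which solves the recursion for rooted trees. -/

section Abel

open Polynomial

/-- The polynomial form of Abel's binomial identity. -/
theorem abel_identity_polynomial (m : ℕ) :
    ∑ j ∈ Finset.range (m + 1), C ((m.choose j : ℚ) * ((j : ℚ) + 1) ^ (j - 1)) *
      (X + C ((m : ℚ) - j)) ^ (m - j) = (X + C ((m : ℚ) + 1)) ^ m := by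
  induction m with
  | zero => simp
  | succ n ih =>
    set P : ℚ[X] := ∑ j ∈ Finset.range (n + 1 + 1), C (((n + 1).choose j : ℚ) *
      ((j : ℚ) + 1) ^ (j - 1)) * (X + C (((n + 1 : ℕ) : ℚ) - j)) ^ (n + 1 - j) with hP
    -- Differentiation turns both sides into `n + 1` times the previous case, translated by 1, so
    -- they differ by a constant.
    have hder : derivative P = derivative ((X + C (((n + 1 : ℕ) : ℚ) + 1)) ^ (n + 1)) := by
      have h1 := congrArg (fun Q : ℚ[X] => C ((n : ℚ) + 1) * Q.comp (X + C 1)) ih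
      simp only [Polynomial.sum_comp, mul_comp, pow_comp, add_comp, X_comp, C_comp,
        Finset.mul_sum] at h1
      rw [hP, derivative_sum, Finset.sum_range_succ]
      have hlast : derivative (C ((((n + 1).choose (n + 1) : ℕ) : ℚ) *
          (((n + 1 : ℕ) : ℚ) + 1) ^ (n + 1 - 1)) *
          (X + C (((n + 1 : ℕ) : ℚ) - ((n + 1 : ℕ) : ℚ))) ^ (n + 1 - (n + 1))) = 0 := by
        rw [Nat.sub_self, pow_zero, mul_one, derivative_C]
      rw [hlast, add_zero]
      have hR : derivative ((X + C (((n + 1 : ℕ) : ℚ) + 1)) ^ (n + 1)) =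
          C ((n : ℚ) + 1) * (X + C 1 + C ((n : ℚ) + 1)) ^ n := by
        rw [derivative_X_add_C_pow]
        simp only [Nat.add_sub_cancel, Nat.cast_add, Nat.cast_one, map_add, map_one]
        ring
      rw [hR, ← h1]
      refine Finset.sum_congr rfl fun j hj => ?_
      have hj' : j ≤ n := Nat.lt_succ_iff.1 (Finset.mem_range.1 hj)
      rw [derivative_C_mul, derivative_X_add_C_pow]
      have e1 : n + 1 - j - 1 = n - j := by omega
      have e2 : (((n + 1).choose j : ℕ) : ℚ) * ((n + 1 - j : ℕ) : ℚ) =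
          ((n : ℚ) + 1) * (n.choose j : ℚ) := by
        have := Nat.choose_mul_succ_eq n j
        have h2 : ((n.choose j * (n + 1) : ℕ) : ℚ) = (((n + 1).choose j * (n + 1 - j) : ℕ) : ℚ) := by
          exact_mod_cast this
        push_cast at h2 ⊢
        linarith
      rw [e1]
      have e3 : (X + C (((n + 1 : ℕ) : ℚ) - j) : ℚ[X]) = X + C 1 + C ((n : ℚ) - j) := by
        rw [add_assoc, ← C_add]; push_cast; ring_nf
      rw [e3]
      rw [← mul_assoc, ← mul_assoc, ← C_mul, ← C_mul]
      congr 2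
      linear_combination ((j : ℚ) + 1) ^ (j - 1) * e2
    -- The constant is found at the zero of the right side. There `P` becomes the (n+1)-st finite
    -- difference of x^n at 1, which vanishes.
    have hev : eval (-((n : ℚ) + 2)) P = 0 := by
      have hz := congrFun (fwdDiff_iter_pow_eq_zero_of_lt (R := ℚ) (Nat.lt_succ_self n)) 1
      rw [fwdDiff_iter_eq_sum_shift] at hz
      rw [hP, eval_finsetSum]
      simp only [Pi.zero_apply] at hz
      rw [← hz]
      refine Finset.sum_congr rfl fun j hj => ?_
      have hj' : j ≤ n + 1 := Nat.lt_succ_iff.1 (Finset.mem_range.1 hj)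
      simp only [eval_mul, eval_C, eval_pow, eval_add, eval_X, Nat.succ_eq_add_one, zsmul_eq_mul,
        nsmul_eq_mul, mul_one]
      have e1 : -((n : ℚ) + 2) + (((n + 1 : ℕ) : ℚ) - j) = -1 * ((j : ℚ) + 1) := by
        push_cast; ring
      rw [e1, mul_pow]
      have e2 : ((j : ℚ) + 1) ^ (j - 1) * ((j : ℚ) + 1) ^ (n + 1 - j) = (1 + (j : ℚ)) ^ n := by
        rcases Nat.eq_zero_or_pos j with rfl | hjp
        · simp
        · rw [← pow_add, add_comm (1 : ℚ)]; congr 1; omega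
      push_cast
      linear_combination (((n + 1).choose j : ℚ) * (-1) ^ (n + 1 - j)) * e2
    have hconst : derivative (P - (X + C (((n + 1 : ℕ) : ℚ) + 1)) ^ (n + 1)) = 0 := by
      rw [derivative_sub, hder, sub_self]
    have hdeg := Polynomial.derivative_eq_zero.1 hconst
    obtain ⟨c, hc⟩ := natDegree_eq_zero.1 hdeg
    have hc0 : c = 0 := by
      have := congrArg (eval (-((n : ℚ) + 2))) hc
      rw [eval_C, eval_sub, hev] at this
      rw [this]
      simp only [eval_pow, eval_add, eval_X, eval_C]
      push_cast
      ring
    rw [hc0, map_zero] at hc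
    exact sub_eq_zero.1 hc.symm

/-- The polynomial identity at `X = 1`, with the summation index reversed. -/
theorem abel_identity (m : ℕ) :
    ∑ k ∈ Finset.range (m + 1), m.choose k *
      ((k + 1) ^ (k - 1) * (k + 1) * (m - k + 1) ^ (m - k - 1)) = (m + 2) ^ m := by
  have h := congrArg (eval (1 : ℚ)) (abel_identity_polynomial m)
  rw [eval_finsetSum] at h
  simp only [eval_mul, eval_C, eval_pow, eval_add, eval_X] at h
  rw [← Finset.sum_range_reflect] at h
  have : ((∑ k ∈ Finset.range (m + 1), m.choose k *
      ((k + 1) ^ (k - 1) * (k + 1) * (m - k + 1) ^ (m - k - 1)) : ℕ) : ℚ) =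
      (((m + 2) ^ m : ℕ) : ℚ) := by
    push_cast
    rw [show (m : ℚ) + 2 = 1 + (m + 1) by ring, ← h]
    refine Finset.sum_congr rfl fun k hk => ?_
    have hk' : k ≤ m := Nat.lt_succ_iff.1 (Finset.mem_range.1 hk)
    have e1 : m + 1 - 1 - k = m - k := by omega
    have e2 : m - (m - k) = k := by omega
    rw [e1, e2, Nat.choose_symm hk']
    have e3 : (1 : ℚ) + (m - ((m - k : ℕ) : ℚ)) = k + 1 := by
      rw [Nat.cast_sub hk']; ring
    rw [e3]
    -- The truncated exponent at `k = 0` is harmless because the base is then 1.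
    have e4 : ((k : ℚ) + 1) ^ (k - 1) * (k + 1) = ((k : ℚ) + 1) ^ k := by
      rcases Nat.eq_zero_or_pos k with rfl | hkp
      · simp
      · rw [← pow_succ]; congr 1; omega
    rw [e4]
    ring
  exact_mod_cast this

end Abel

/-- With r(k) the count for k directions, splitting at one direction gives r(m+1) = Σ C(m,k) r(k)
(k+1) r(m-k). The solution is Cayley's number of trees on `D.card + 1` labelled vertices. -/
theorem card_rootedTrees {α : Type*} [DecidableEq α] (D : Finset α) :
    (rootedTrees D).card = (D.card + 1) ^ (D.card - 1) := by
  induction hn : D.card using Nat.strong_induction_on generalizing D with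
  | _ n ih =>
    subst hn
    rcases D.eq_empty_or_nonempty with rfl | ⟨a, ha⟩
    · have : rootedTrees (∅ : Finset α) = {{∅}} := by
        ext F
        rw [mem_rootedTrees, Finset.mem_singleton]
        constructor
        · rintro ⟨h0, hc, -, -⟩
          rw [Finset.card_empty, zero_add, Finset.card_eq_one] at hc
          obtain ⟨x, rfl⟩ := hc
          rw [Finset.mem_singleton.1 h0]
        · rintro rfl
          exact ⟨by simp, by simp, by simp, fun x hx => by
            rw [Finset.mem_singleton.1 hx]⟩
      simp [this]
    · obtain ⟨D', ha', rfl⟩ : ∃ D', a ∉ D' ∧ insert a D' = D :=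
        ⟨D.erase a, Finset.notMem_erase a D, Finset.insert_erase ha⟩
      rw [card_rootedTrees_insert ha']
      rw [Finset.card_insert_of_notMem ha'] at ih ⊢
      have : ∀ D₀ ∈ D'.powerset, (rootedTrees D₀).card * (D₀.card + 1) *
          (rootedTrees (D' \ D₀)).card = (fun k => (k + 1) ^ (k - 1) * (k + 1) *
            (D'.card - k + 1) ^ (D'.card - k - 1)) D₀.card := by
        intro D₀ hD₀
        rw [Finset.mem_powerset] at hD₀
        have hle := Finset.card_le_card hD₀
        rw [ih D₀.card (by omega) D₀ rfl, ih (D' \ D₀).card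
          (Nat.lt_succ_of_le (Finset.card_le_card Finset.sdiff_subset)) _ rfl,
          Finset.card_sdiff_of_subset hD₀]
      rw [Finset.sum_congr rfl this, Finset.sum_powerset_apply_card (fun k => (k + 1) ^ (k - 1) * (k + 1) *
        (D'.card - k + 1) ^ (D'.card - k - 1))]
      simp only [smul_eq_mul]
      rw [abel_identity, Nat.add_sub_cancel]

/-! ### The Stein–Chen method -/

section SteinEquation

variable {w f : ℕ → ℝ} {lam : ℝ}

/-- The ratio `w (k + 1) / w k = lam / (k + 1)` decreases with `k`. -/
theorem poisson_weights_logConcave (hlam : 0 < lam) (hpos : ∀ k, 0 < w k)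
    (hrec : ∀ k : ℕ, ((k : ℝ) + 1) * w (k + 1) = lam * w k) {i k : ℕ} (hik : i ≤ k) :
    w i * w (k + 1) ≤ w (i + 1) * w k := by
  have h1 : w (k + 1) = lam * w k / (k + 1) := by rw [← hrec k]; field_simp
  have h2 : w (i + 1) = lam * w i / (i + 1) := by rw [← hrec i]; field_simp
  rw [h1, h2]
  have h3 : (i : ℝ) + 1 ≤ k + 1 := by exact_mod_cast Nat.succ_le_succ hik
  have h4 := hpos i
  have h5 := hpos k
  calc w i * (lam * w k / (k + 1)) = (lam * w i * w k) / (k + 1) := by ring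
    _ ≤ (lam * w i * w k) / (i + 1) := by
        apply div_le_div_of_nonneg_left _ (by positivity) h3
        positivity
    _ = lam * w i / (i + 1) * w k := by ring

/-- Here `x`, `y` are the weights at k and k+1, `U` and `T` the masses of [0,k] and of [k+2,∞), `c`
and `c'` those masses weighted by the test function, and `g` its value at k+1. The expression is
affine, decreasing in `c` and `c'` and increasing in `g`, so its extreme values are ±(T + yU/x), and
yU/x ≤ U + y. -/
theorem stein_increment_bound {x y U T c c' g : ℝ} (hx : 0 < x) (hy : 0 < y)
    (h1 : U + y + T = 1) (hT : T * x ≤ (T + y) * y) (hU : U * y ≤ (U + y) * x) (hc : 0 ≤ c)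
    (hcU : c ≤ U) (hc' : 0 ≤ c') (hcT : c' ≤ T) (hg : 0 ≤ g) (hg1 : g ≤ 1) :
    |((c + g * y) * T - c' * (U + y)) / y - (c * (T + y) - (c' + g * y) * U) / x| ≤ 1 := by
  have hB : T / y - (T + y) / x ≤ 0 := by
    rw [sub_nonpos, div_le_div_iff₀ hy hx]; exact hT
  have hA : 0 ≤ (U + y) / y - U / x := by
    rw [sub_nonneg, div_le_div_iff₀ hx hy]; exact hU
  have hK : y * U / x ≤ U + y := by
    rw [div_le_iff₀ hx]; linarith
  have hU0 : 0 ≤ U := hc.trans hcU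
  have hT0 : 0 ≤ T := hc'.trans hcT
  have hK0 : 0 ≤ y * U / x := by positivity
  have hdec : ((c + g * y) * T - c' * (U + y)) / y - (c * (T + y) - (c' + g * y) * U) / x =
      c * (T / y - (T + y) / x) + g * (T + y * U / x) - c' * ((U + y) / y - U / x) := by
    field_simp
    ring
  have hlow : U * (T / y - (T + y) / x) - T * ((U + y) / y - U / x) = -(y * U / x) - T := by
    field_simp
    ring
  rw [hdec, abs_le]
  constructor
  · have e1 : U * (T / y - (T + y) / x) ≤ c * (T / y - (T + y) / x) :=
      mul_le_mul_of_nonpos_right hcU hB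
    have e2 : c' * ((U + y) / y - U / x) ≤ T * ((U + y) / y - U / x) :=
      mul_le_mul_of_nonneg_right hcT hA
    have e3 : 0 ≤ g * (T + y * U / x) := by positivity
    linarith
  · have e1 : c * (T / y - (T + y) / x) ≤ 0 := mul_nonpos_of_nonneg_of_nonpos hc hB
    have e2 : 0 ≤ c' * ((U + y) / y - U / x) := mul_nonneg hc' hA
    have e3 : g * (T + y * U / x) ≤ 1 * (T + y * U / x) := by gcongr
    linarith

/-- The solution of the Stein equation for the Poisson weights `w` and the test function `f`,
shifted by one. -/
noncomputable def steinSol (w f : ℕ → ℝ) (lam : ℝ) (k : ℕ) : ℝ :=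
  ((∑ i ∈ Finset.range (k + 1), f i * w i) -
    (∑' i, f i * w i) * ∑ i ∈ Finset.range (k + 1), w i) / (lam * w k)

theorem steinSol_eq (hlam : 0 < lam) (hpos : ∀ k, 0 < w k)
    (hrec : ∀ k : ℕ, ((k : ℝ) + 1) * w (k + 1) = lam * w k) (k : ℕ) :
    lam * steinSol w f lam k - k * steinSol w f lam (k - 1) = f k - ∑' i, f i * w i := by
  unfold steinSol
  have h0 := (hpos k).ne'
  -- At `k = 0` the factor `k` vanishes, so the truncated index `k - 1` plays no role.
  rcases k with _ | k
  · have : w 0 ≠ 0 := h0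
    simp only [zero_add, Finset.range_one, Finset.sum_singleton, Nat.cast_zero, zero_mul, sub_zero]
    field_simp
  · rw [Nat.add_sub_cancel, ← hrec k, Finset.sum_range_succ _ (k + 1), Finset.sum_range_succ _
      (k + 1)]
    push_cast
    have : (k : ℝ) + 1 ≠ 0 := by positivity
    field_simp
    ring

/-- The two ratio inequalities needed by `stein_increment_bound` are log-concavity summed over the
upper tail and over the initial segment. -/
theorem abs_steinSol_succ_sub_le (hlam : 0 < lam) (hpos : ∀ k, 0 < w k) (hsum : HasSum w 1)
    (hrec : ∀ k : ℕ, ((k : ℝ) + 1) * w (k + 1) = lam * w k) (hf0 : ∀ k, 0 ≤ f k)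
    (hf1 : ∀ k, f k ≤ 1) (k : ℕ) :
    |steinSol w f lam (k + 1) - steinSol w f lam k| ≤ 1 / lam := by
  have hfw : ∀ i, f i * w i ≤ w i := fun i => mul_le_of_le_one_left (hpos i).le (hf1 i)
  have hfw0 : ∀ i, 0 ≤ f i * w i := fun i => mul_nonneg (hf0 i) (hpos i).le
  have hsf : Summable fun i => f i * w i := Summable.of_nonneg_of_le hfw0 hfw hsum.summable
  set P := ∑' i, f i * w i with hP
  set U := ∑ i ∈ Finset.range (k + 1), w i with hU
  set c := ∑ i ∈ Finset.range (k + 1), f i * w i with hc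
  have hUs : ∑ i ∈ Finset.range (k + 1 + 1), w i = U + w (k + 1) := Finset.sum_range_succ _ _
  have hcs : ∑ i ∈ Finset.range (k + 1 + 1), f i * w i = c + f (k + 1) * w (k + 1) :=
    Finset.sum_range_succ _ _
  have htail := hsum.summable.sum_add_tsum_nat_add (k + 2)
  rw [hsum.tsum_eq, hUs] at htail
  set T := ∑' j, w (j + (k + 2)) with hT
  have htailf := hsf.sum_add_tsum_nat_add (k + 2)
  rw [hcs] at htailf
  set c' := ∑' j, f (j + (k + 2)) * w (j + (k + 2)) with hc'
  have hsT : Summable fun j => w (j + (k + 2)) := (summable_nat_add_iff (k + 2)).2 hsum.summable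
  have hsc' : Summable fun j => f (j + (k + 2)) * w (j + (k + 2)) :=
    (summable_nat_add_iff (f := fun i => f i * w i) (k + 2)).2 hsf
  have hx := hpos k
  have hy := hpos (k + 1)
  have hTk := hsum.summable.sum_add_tsum_nat_add (k + 1)
  rw [hsum.tsum_eq, ← hU] at hTk
  have hsT' : Summable fun j => w (j + (k + 1)) := (summable_nat_add_iff (k + 1)).2 hsum.summable
  have hMb : T * w k ≤ (T + w (k + 1)) * w (k + 1) := by
    have : T + w (k + 1) = ∑' j, w (j + (k + 1)) := by linarith
    rw [this, hT, ← tsum_mul_right, ← tsum_mul_right]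
    refine Summable.tsum_le_tsum (fun j => ?_) (hsT.mul_right _) (hsT'.mul_right _)
    have := poisson_weights_logConcave hlam hpos hrec (i := k) (k := j + (k + 1)) (by omega)
    rw [show j + (k + 2) = j + (k + 1) + 1 by ring]
    linarith
  have hMa : U * w (k + 1) ≤ (U + w (k + 1)) * w k := by
    rw [← hUs, hU, Finset.sum_mul]
    calc ∑ i ∈ Finset.range (k + 1), w i * w (k + 1)
        ≤ ∑ i ∈ Finset.range (k + 1), w (i + 1) * w k := Finset.sum_le_sum fun i hi =>
          poisson_weights_logConcave hlam hpos hrec (Nat.lt_succ_iff.1 (Finset.mem_range.1 hi))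
      _ = (∑ i ∈ Finset.range (k + 1), w (i + 1)) * w k := by rw [Finset.sum_mul]
      _ ≤ _ := by
        refine mul_le_mul_of_nonneg_right ?_ hx.le
        rw [Finset.sum_range_succ' _ (k + 1)]
        linarith [hpos 0]
  have hb := stein_increment_bound (c := c) (c' := c') (g := f (k + 1)) hx hy htail hMb hMa
    (Finset.sum_nonneg fun i _ => hfw0 i) (Finset.sum_le_sum fun i _ => hfw i)
    (tsum_nonneg fun j => hfw0 _) (Summable.tsum_le_tsum (fun j => hfw _) hsc' hsT)
    (hf0 _) (hf1 _)
  have hval : steinSol w f lam (k + 1) - steinSol w f lam k = (1 / lam) *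
      (((c + f (k + 1) * w (k + 1)) * T - c' * (U + w (k + 1))) / w (k + 1) -
        (c * (T + w (k + 1)) - (c' + f (k + 1) * w (k + 1)) * U) / w k) := by
    unfold steinSol
    rw [hUs, hcs, ← hU, ← hc, ← htailf]
    have hTe : T = 1 - U - w (k + 1) := by linarith
    rw [hTe]
    field_simp
    ring
  rw [hval, abs_mul, abs_of_pos (by positivity : 0 < 1 / lam)]
  exact mul_le_of_le_one_right (by positivity) hb

theorem abs_steinSol_add_sub_le (hlam : 0 < lam) (hpos : ∀ k, 0 < w k) (hsum : HasSum w 1)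
    (hrec : ∀ k : ℕ, ((k : ℝ) + 1) * w (k + 1) = lam * w k) (hf0 : ∀ k, 0 ≤ f k)
    (hf1 : ∀ k, f k ≤ 1) (k n : ℕ) :
    |steinSol w f lam (k + n) - steinSol w f lam k| ≤ 1 / lam * n := by
  induction n with
  | zero => simp
  | succ n ih =>
    have h := abs_steinSol_succ_sub_le hlam hpos hsum hrec hf0 hf1 (k + n)
    rw [← add_assoc]
    have h2 := abs_sub_le (steinSol w f lam (k + n + 1)) (steinSol w f lam (k + n))
      (steinSol w f lam k)
    push_cast
    linarith

end SteinEquation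

open scoped Classical in
/-- **Stein–Chen bound for locally dependent indicators**, over a finite weighted sample space. -/
theorem stein_chen {Ω ι : Type*} (s : Finset Ω) (m : Ω → ℝ) (hm : ∀ ω ∈ s, 0 ≤ m ω)
    (J : Finset ι) (Y : ι → Ω → ℕ) (hY : ∀ i ω, Y i ω = 0 ∨ Y i ω = 1) (N : ι → ι → Prop)
    (hN : ∀ i ∈ J, N i i) (P : ι → ℝ) (hP : ∀ i, P i = ∑ ω ∈ s, m ω * Y i ω)
    (hind : ∀ i ∈ J, ∀ g : ℕ → ℝ,
      ∑ ω ∈ s, m ω * (Y i ω * g (∑ j ∈ J with ¬ N i j, Y j ω)) =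
        P i * ∑ ω ∈ s, m ω * g (∑ j ∈ J with ¬ N i j, Y j ω))
    (hm1 : ∑ ω ∈ s, m ω = 1) {lam : ℝ} (hlam : lam = ∑ i ∈ J, P i) (hlam0 : 0 < lam)
    {w : ℕ → ℝ} (hpos : ∀ k, 0 < w k) (hsum : HasSum w 1)
    (hrec : ∀ k : ℕ, ((k : ℝ) + 1) * w (k + 1) = lam * w k)
    (f : ℕ → ℝ) (hf0 : ∀ k, 0 ≤ f k) (hf1 : ∀ k, f k ≤ 1) :
    |∑ ω ∈ s, m ω * f (∑ i ∈ J, Y i ω) - ∑' k, f k * w k| ≤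
      1 / lam * (∑ i ∈ J, (P i * ∑ j ∈ J with N i j, P j +
        ∑ j ∈ J with N i j ∧ j ≠ i, ∑ ω ∈ s, m ω * (Y i ω * Y j ω))) := by
  set h := steinSol w f lam with hh
  set W : Ω → ℕ := fun ω => ∑ i ∈ J, Y i ω with hW
  set V : ι → Ω → ℕ := fun i ω => ∑ j ∈ J with ¬ N i j, Y j ω with hV
  have hP0 : ∀ i, 0 ≤ P i := fun i => by
    rw [hP]; exact Finset.sum_nonneg fun ω hω => mul_nonneg (hm ω hω) (Nat.cast_nonneg _)
  have hWV : ∀ i ω, W ω = V i ω + ∑ j ∈ J with N i j, Y j ω := by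
    intro i ω
    rw [hW, hV, add_comm]
    exact (Finset.sum_filter_add_sum_filter_not J (N i) fun j => Y j ω).symm
  have hNs : ∀ i ∈ J, ∀ ω, ∑ j ∈ J with N i j, Y j ω =
      Y i ω + ∑ j ∈ J with N i j ∧ j ≠ i, Y j ω := by
    intro i hi ω
    have : (J.filter fun j => N i j) = insert i (J.filter fun j => N i j ∧ j ≠ i) := by
      ext j
      simp only [Finset.mem_filter, Finset.mem_insert]
      by_cases hji : j = i
      · subst hji; simp [hi, hN j hi]
      · simp [hji]
    rw [this, Finset.sum_insert (by simp)]
  -- The Stein equation at `W`, with the factors `lam` and `W` expanded as sums over `J`.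
  have hstart : ∑ ω ∈ s, m ω * f (W ω) - ∑' k, f k * w k =
      ∑ i ∈ J, (P i * ∑ ω ∈ s, m ω * h (W ω) - ∑ ω ∈ s, m ω * (Y i ω * h (W ω - 1))) := by
    have e1 : ∑ ω ∈ s, m ω * f (W ω) - ∑' k, f k * w k =
        ∑ ω ∈ s, m ω * (lam * h (W ω) - (W ω : ℝ) * h (W ω - 1)) := by
      have : ∑' k, f k * w k = ∑ ω ∈ s, m ω * ∑' k, f k * w k := by
        rw [← Finset.sum_mul, hm1, one_mul]
      rw [this, ← Finset.sum_sub_distrib]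
      refine Finset.sum_congr rfl fun ω _ => ?_
      rw [hh, steinSol_eq hlam0 hpos hrec]
      ring
    rw [e1, Finset.sum_sub_distrib, ← Finset.sum_mul, ← hlam, Finset.sum_comm,
      Finset.mul_sum, ← Finset.sum_sub_distrib]
    refine Finset.sum_congr rfl fun ω _ => ?_
    rw [← Finset.mul_sum, ← Finset.sum_mul]
    have : ((W ω : ℕ) : ℝ) = ∑ i ∈ J, (Y i ω : ℝ) := by rw [hW]; push_cast; rfl
    rw [this]
    ring
  rw [hstart, Finset.mul_sum]
  refine (Finset.abs_sum_le_sum_abs _ _).trans (Finset.sum_le_sum fun i hi => ?_)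
  -- `W` is replaced by `V i`, the count away from `i`, which is independent of `Y i`; the two main
  -- terms cancel.
  have hsplit : P i * ∑ ω ∈ s, m ω * h (W ω) - ∑ ω ∈ s, m ω * (Y i ω * h (W ω - 1)) =
      P i * ∑ ω ∈ s, m ω * (h (W ω) - h (V i ω)) +
        ∑ ω ∈ s, m ω * (Y i ω * (h (V i ω) - h (W ω - 1))) := by
    have := hind i hi h
    simp only [mul_sub, Finset.sum_sub_distrib]
    linarith
  rw [hsplit, mul_add]
  refine (abs_add_le _ _).trans (add_le_add ?_ ?_)
  · rw [abs_mul, abs_of_nonneg (hP0 i), mul_left_comm]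
    refine mul_le_mul_of_nonneg_left ?_ (hP0 i)
    refine (Finset.abs_sum_le_sum_abs _ _).trans ?_
    rw [Finset.sum_congr rfl fun j _ => hP j, Finset.sum_comm, Finset.mul_sum]
    refine Finset.sum_le_sum fun ω hω => ?_
    rw [abs_mul, abs_of_nonneg (hm ω hω), ← Finset.mul_sum, mul_left_comm]
    refine mul_le_mul_of_nonneg_left ?_ (hm ω hω)
    have := abs_steinSol_add_sub_le hlam0 hpos hsum hrec hf0 hf1 (V i ω)
      (∑ j ∈ J with N i j, Y j ω)
    rw [← hWV] at this
    push_cast at this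
    exact this
  · refine (Finset.abs_sum_le_sum_abs _ _).trans ?_
    rw [Finset.sum_comm, Finset.mul_sum]
    refine Finset.sum_le_sum fun ω hω => ?_
    rw [abs_mul, abs_of_nonneg (hm ω hω), ← Finset.mul_sum, mul_left_comm, ← Finset.mul_sum,
      abs_mul, Nat.abs_cast, mul_left_comm (1 / lam)]
    refine mul_le_mul_of_nonneg_left ?_ (hm ω hω)
    -- Only `Y i ω = 1` contributes. Then `W ω ≥ 1`, and `W ω - 1` exceeds `V i ω` by the count over
    -- the other neighbours of `i`.
    rcases hY i ω with h0 | h1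
    · simp [h0]
    · rw [h1]
      have := abs_steinSol_add_sub_le hlam0 hpos hsum hrec hf0 hf1 (V i ω)
        (∑ j ∈ J with N i j ∧ j ≠ i, Y j ω)
      have hWe : W ω - 1 = V i ω + ∑ j ∈ J with N i j ∧ j ≠ i, Y j ω := by
        rw [hWV i, hNs i hi, h1]; omega
      rw [hWe, abs_sub_comm]
      push_cast at this ⊢
      linarith

/-! ### Independent edges -/

section Bernoulli

variable {β : Type*}

/-- The probability that a `p`-random subset of `E` equals `ω`. -/
noncomputable def bw (p : ℝ) (E ω : Finset β) : ℝ := p ^ ω.card * (1 - p) ^ (E.card - ω.card)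

theorem bw_nonneg {p : ℝ} (hp0 : 0 ≤ p) (hp1 : p ≤ 1) (E ω : Finset β) : 0 ≤ bw p E ω :=
  mul_nonneg (pow_nonneg hp0 _) (pow_nonneg (sub_nonneg.2 hp1) _)

theorem sum_bw (p : ℝ) (E : Finset β) : ∑ ω ∈ E.powerset, bw p E ω = 1 := by
  unfold bw
  rw [Finset.sum_pow_mul_eq_add_pow]
  simp

variable [DecidableEq β]

/-- A random subset of `E` is the union of independent random subsets of `E ∩ A` and `E \ A`, and
the weights multiply accordingly. -/
theorem sum_bw_mul_eq (p : ℝ) (E A : Finset β) (f g : Finset β → ℝ) (hf : ∀ ω, f ω = f (ω ∩ A))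
    (hg : ∀ ω, g ω = g (ω \ A)) :
    ∑ ω ∈ E.powerset, bw p E ω * (f ω * g ω) =
      (∑ ω ∈ (E ∩ A).powerset, bw p (E ∩ A) ω * f ω) *
        ∑ ω ∈ (E \ A).powerset, bw p (E \ A) ω * g ω := by
  rw [Finset.sum_mul_sum, ← Finset.sum_product']
  refine Finset.sum_nbij' (fun ω => (ω ∩ A, ω \ A)) (fun x => x.1 ∪ x.2) ?_ ?_ ?_ ?_ ?_
  · intro ω hω
    rw [Finset.mem_powerset] at hω
    simp only [Finset.mem_product, Finset.mem_powerset]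
    exact ⟨Finset.inter_subset_inter_right hω, Finset.sdiff_subset_sdiff hω le_rfl⟩
  · rintro ⟨x, y⟩ h
    simp only [Finset.mem_product, Finset.mem_powerset] at h ⊢
    exact Finset.union_subset (h.1.trans Finset.inter_subset_left)
      (h.2.trans Finset.sdiff_subset)
  · intro ω _
    simp only
    rw [Finset.union_comm, Finset.sdiff_union_inter]
  · rintro ⟨x, y⟩ h
    simp only [Finset.mem_product, Finset.mem_powerset] at h
    ext i <;> simp only [Finset.mem_inter, Finset.mem_union, Finset.mem_sdiff]
    · have h1 := @h.1 i; have h2 := @h.2 i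
      simp only [Finset.mem_inter, Finset.mem_sdiff] at h1 h2
      tauto
    · have h1 := @h.1 i; have h2 := @h.2 i
      simp only [Finset.mem_inter, Finset.mem_sdiff] at h1 h2
      tauto
  · intro ω hω
    rw [Finset.mem_powerset] at hω
    simp only
    rw [hf ω, hg ω]
    have h1 : (ω ∩ A).card + (ω \ A).card = ω.card := Finset.card_inter_add_card_sdiff _ _
    have h2 : (E ∩ A).card + (E \ A).card = E.card := Finset.card_inter_add_card_sdiff _ _
    have h3 := Finset.card_le_card (Finset.inter_subset_inter_right hω : ω ∩ A ⊆ E ∩ A)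
    have h4 := Finset.card_le_card (Finset.sdiff_subset_sdiff hω le_rfl : ω \ A ⊆ E \ A)
    have h5 : E.card - ω.card = ((E ∩ A).card - (ω ∩ A).card) + ((E \ A).card - (ω \ A).card) := by
      omega
    unfold bw
    rw [h5, ← h1, pow_add, pow_add]
    ring

theorem sum_bw_indep (p : ℝ) (E A : Finset β) (f g : Finset β → ℝ) (hf : ∀ ω, f ω = f (ω ∩ A))
    (hg : ∀ ω, g ω = g (ω \ A)) :
    ∑ ω ∈ E.powerset, bw p E ω * (f ω * g ω) =
      (∑ ω ∈ E.powerset, bw p E ω * f ω) * ∑ ω ∈ E.powerset, bw p E ω * g ω := by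
  have h1 := sum_bw_mul_eq p E A f (fun _ => 1) hf (fun _ => rfl)
  have h2 := sum_bw_mul_eq p E A (fun _ => 1) g (fun _ => rfl) hg
  simp only [mul_one, one_mul, sum_bw] at h1 h2
  rw [h1, h2, sum_bw_mul_eq p E A f g hf hg]

open scoped Classical in
theorem sum_bw_cylinder (p : ℝ) {E T B : Finset β} (hT : T ⊆ E) (hB : B ⊆ E)
    (hTB : Disjoint T B) :
    ∑ ω ∈ E.powerset, bw p E ω * (if T ⊆ ω ∧ Disjoint B ω then 1 else 0) =
      p ^ T.card * (1 - p) ^ B.card := by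
  have h := sum_bw_mul_eq p E (T ∪ B) (fun ω => if T ⊆ ω ∧ Disjoint B ω then 1 else 0)
    (fun _ => 1) ?_ (fun _ => rfl)
  · simp only [mul_one, sum_bw] at h
    rw [h, Finset.inter_eq_right.2 (Finset.union_subset hT hB), Finset.sum_eq_single T]
    · rw [if_pos ⟨le_rfl, hTB.symm⟩, mul_one, bw, Finset.card_union_of_disjoint hTB,
        Nat.add_sub_cancel_left]
    · intro ω hω hne
      rw [if_neg, mul_zero]
      rintro ⟨h1, h2⟩
      refine hne (Finset.Subset.antisymm (fun x hx => ?_) h1)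
      rcases Finset.mem_union.1 (Finset.mem_powerset.1 hω hx) with h | h
      · exact h
      · exact absurd hx (Finset.disjoint_left.1 h2 h)
    · exact fun h => absurd (Finset.mem_powerset.2 Finset.subset_union_left) h
  · intro ω
    have : (T ⊆ ω ∧ Disjoint B ω) ↔ (T ⊆ ω ∩ (T ∪ B) ∧ Disjoint B (ω ∩ (T ∪ B))) := by
      simp only [Finset.disjoint_left, Finset.mem_inter, Finset.mem_union, Finset.subset_iff]
      constructor
      · rintro ⟨h1, h2⟩
        exact ⟨fun x hx => ⟨h1 hx, .inl hx⟩, fun x hx h => h2 hx h.1⟩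
      · rintro ⟨h1, h2⟩
        exact ⟨fun x hx => (h1 hx).1, fun x hx h => h2 hx ⟨h, .inr hx⟩⟩
    simp only [this]

end Bernoulli

/-- The edges of the hypercube. -/
noncomputable def cubeEdges (d : ℕ) : Finset (Sym2 (Fin d → Bool)) :=
  (cube d).edgeSet.toFinite.toFinset

theorem mem_cubeEdges {d : ℕ} {e : Sym2 (Fin d → Bool)} :
    e ∈ cubeEdges d ↔ e ∈ (cube d).edgeSet := Set.Finite.mem_toFinset _

instance discreteMeasurableSpace_simpleGraph (V : Type*) [Finite V] :
    DiscreteMeasurableSpace (SimpleGraph V) := by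
  refine ⟨fun s => ?_⟩
  have := Fintype.ofFinite V
  rw [← SimpleGraph.measurableEmbedding_edgeSet.measurableSet_image]
  exact (Set.toFinite _).measurableSet

/-- Reduces integrals against the law to finite weighted sums: edge sets not contained in the cube
have mass zero. -/
theorem integral_law (p : unitInterval) (d : ℕ) (F : SimpleGraph (Fin d → Bool) → ℝ) :
    ∫ G, F G ∂(law p d) = ∑ ω ∈ (cubeEdges d).powerset,
      bw p (cubeEdges d) ω * F (SimpleGraph.fromEdgeSet (ω : Set (Sym2 (Fin d → Bool)))) := by
  classical
  have : Fintype (Set (Sym2 (Fin d → Bool))) := Fintype.ofFinite _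
  rw [law, integral_map SimpleGraph.measurable_fromEdgeSet.aemeasurable
    (measurable_of_finite F).aestronglyMeasurable, integral_fintype (Integrable.of_finite)]
  symm
  refine Finset.sum_of_injOn (fun ω : Finset (Sym2 (Fin d → Bool)) => (ω : Set _))
    Finset.coe_injective.injOn (fun _ _ => Finset.mem_coe.2 (Finset.mem_univ _)) ?_ ?_
  · intro s _ hs
    have : ¬ s ⊆ (cube d).edgeSet := by
      intro hsub
      refine hs ⟨s.toFinite.toFinset, ?_, by simp⟩
      rw [Finset.mem_coe, Finset.mem_powerset]
      intro e he
      exact mem_cubeEdges.2 (hsub (by simpa using he))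
    simp [measureReal_def, setBernoulli_singleton_of_not_subset p this]
  · intro ω hω
    rw [Finset.mem_powerset] at hω
    have hsub : (ω : Set (Sym2 (Fin d → Bool))) ⊆ (cube d).edgeSet := fun e he =>
      mem_cubeEdges.1 (hω he)
    rw [setBernoulli_real_singleton p hsub (Set.toFinite _), smul_eq_mul, bw, Set.ncard_coe_finset,
      Set.ncard_sdiff hsub (Set.toFinite _), Set.ncard_coe_finset, cubeEdges,
      ← Set.ncard_eq_toFinset_card]

/-! ### Components as finite sets -/

/-- The finite set `S` is the vertex set of a connected component of `G`. -/
def IsComp {V : Type*} (G : SimpleGraph V) (S : Finset V) : Prop :=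
  S.Nonempty ∧ (∀ x ∈ S, ∀ y, G.Adj x y → y ∈ S) ∧ ∀ r ∈ S, ConnFrom G.Adj S r

section IsComp

variable {V : Type*} {G : SimpleGraph V} {S S' : Finset V}

/-- Being a component depends only on the edges that meet `S`; all independence statements rest on
this. -/
theorem isComp_congr {G' : SimpleGraph V} (h : ∀ x ∈ S, ∀ y, G.Adj x y ↔ G'.Adj x y) :
    IsComp G S ↔ IsComp G' S := by
  unfold IsComp
  refine and_congr Iff.rfl (and_congr ?_ ?_)
  · exact forall₂_congr fun x hx => forall_congr' fun y => by rw [h x hx y]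
  · exact forall₂_congr fun r _ =>
      ⟨fun hc => hc.mono_rel fun a ha b _ => (h a ha b).1,
        fun hc => hc.mono_rel fun a ha b _ => (h a ha b).2⟩

theorem IsComp.eq_of_mem (h : IsComp G S) (h' : IsComp G S') {x : V} (hx : x ∈ S)
    (hx' : x ∈ S') : S = S' := by
  have key : ∀ {S S' : Finset V}, IsComp G S → IsComp G S' → x ∈ S → x ∈ S' → S ⊆ S' := by
    intro S S' h h' hx hx' y hy
    have := h.2.2 x hx y hy
    induction this with
    | refl => exact hx'
    | tail _ hab ih => exact h'.2.1 _ (ih hab.1) _ hab.2.2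
  exact Finset.Subset.antisymm (key h h' hx hx') (key h' h hx' hx)

theorem isComp_supp [Fintype V] [DecidableEq V] (c : G.ConnectedComponent) [Fintype c.supp] :
    IsComp G c.supp.toFinset := by
  refine ⟨by simpa using c.nonempty_supp, ?_, ?_⟩
  · intro x hx y hxy
    rw [Set.mem_toFinset, SimpleGraph.ConnectedComponent.mem_supp_iff] at hx ⊢
    rw [← hx]
    exact (SimpleGraph.ConnectedComponent.sound hxy.reachable).symm
  · intro r hr x hx
    rw [Set.mem_toFinset, SimpleGraph.ConnectedComponent.mem_supp_iff] at hr hx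
    have hreach : G.Reachable r x := SimpleGraph.ConnectedComponent.exact (hr.trans hx.symm)
    rw [SimpleGraph.reachable_iff_reflTransGen] at hreach
    clear hx
    have : ∀ z, Relation.ReflTransGen G.Adj r z → z ∈ c.supp.toFinset ∧
        Relation.ReflTransGen (fun a b => a ∈ c.supp.toFinset ∧ b ∈ c.supp.toFinset ∧ G.Adj a b)
          r z := by
      intro z hz
      induction hz with
      | refl => exact ⟨by simpa using hr, .refl⟩
      | @tail u v _ huv ih =>
        have hv : v ∈ c.supp.toFinset := by
          have hu := ih.1
          rw [Set.mem_toFinset, SimpleGraph.ConnectedComponent.mem_supp_iff] at hu ⊢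
          rw [← hu]
          exact (SimpleGraph.ConnectedComponent.sound huv.reachable).symm
        exact ⟨hv, ih.2.tail ⟨ih.1, hv, huv⟩⟩
    exact (this x hreach).2

theorem IsComp.exists_supp_eq (h : IsComp G S) : ∃ c : G.ConnectedComponent, c.supp = S := by
  obtain ⟨x, hx⟩ := h.1
  refine ⟨G.connectedComponentMk x, Set.ext fun y => ?_⟩
  rw [SimpleGraph.ConnectedComponent.mem_supp_iff, SimpleGraph.ConnectedComponent.eq,
    SimpleGraph.reachable_comm, SimpleGraph.reachable_iff_reflTransGen, Finset.mem_coe]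
  constructor
  · intro hy
    induction hy with
    | refl => exact hx
    | tail _ hab ih => exact h.2.1 _ ih _ hab
  · intro hy
    exact Relation.ReflTransGen.mono (fun a b hab => hab.2.2) _ _ (h.2.2 x hx y hy)

open scoped Classical in
theorem numComp_eq_card [Fintype V] (t : ℕ) (G : SimpleGraph V) :
    numComp t G = ((Finset.univ.powersetCard t).filter fun S : Finset V => IsComp G S).card := by
  rw [numComp, ← Set.ncard_coe_finset]
  refine Set.ncard_congr (fun c _ => c.supp.toFinset) ?_ ?_ ?_
  · intro c hc
    rw [Finset.mem_coe, Finset.mem_filter, Finset.mem_powersetCard]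
    exact ⟨⟨Finset.subset_univ _, by
      rw [← Set.ncard_eq_toFinset_card']; exact hc⟩, isComp_supp c⟩
  · intro c c' _ _ h
    exact SimpleGraph.ConnectedComponent.supp_injective (Set.toFinset_inj.1 h)
  · intro S hS
    rw [Finset.mem_coe, Finset.mem_filter, Finset.mem_powersetCard] at hS
    obtain ⟨c, hc⟩ := hS.2.exists_supp_eq
    refine ⟨c, ?_, ?_⟩
    · change c.supp.ncard = t
      rw [hc, Set.ncard_coe_finset, hS.1.2]
    · ext x
      rw [Set.mem_toFinset, hc, Finset.mem_coe]

end IsComp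

theorem ConnFrom.of_mem {β : Type*} {R : β → β → Prop} (hR : ∀ a b, R a b → R b a) {S : Finset β} {r x : β}
    (h : ConnFrom R S r) (hx : x ∈ S) : ConnFrom R S x := by
  intro y hy
  refine Relation.ReflTransGen.trans ?_ (h y hy)
  have hsymm : Std.Symm (fun a b => a ∈ S ∧ b ∈ S ∧ R a b) :=
    ⟨fun a b hab => ⟨hab.2.1, hab.1, hR _ _ hab.2.2⟩⟩
  exact Relation.ReflTransGen.stdSymm.symm _ _ (h x hx)

/-! ### Geometry of the hypercube -/

section Cube

variable {d : ℕ}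

/-- Flip the coordinate `i` of `x`. -/
def flipAt (x : Fin d → Bool) (i : Fin d) : Fin d → Bool := Function.update x i (!x i)

theorem flipAt_self (x : Fin d → Bool) (i : Fin d) : flipAt x i i = !x i := by
  simp [flipAt]

theorem flipAt_of_ne (x : Fin d → Bool) {i j : Fin d} (h : j ≠ i) : flipAt x i j = x j := by
  simp [flipAt, h]

theorem flipAt_flipAt (x : Fin d → Bool) (i : Fin d) : flipAt (flipAt x i) i = x := by
  simp [flipAt]

theorem cube_adj_iff {x y : Fin d → Bool} : (cube d).Adj x y ↔ ∃ i, y = flipAt x i := by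
  constructor
  · rintro ⟨i, hi, huniq⟩
    refine ⟨i, funext fun j => ?_⟩
    by_cases hj : j = i
    · subst hj
      rw [flipAt_self]
      revert hi
      cases x j <;> cases y j <;> simp
    · rw [flipAt_of_ne x hj]
      by_contra hne
      exact hj (huniq j fun h => hne h.symm)
  · rintro ⟨i, rfl⟩
    refine ⟨i, by simp [flipAt_self], fun j hj => ?_⟩
    by_contra hne
    simp [flipAt_of_ne x hne] at hj

theorem cube_adj_flipAt (x : Fin d → Bool) (i : Fin d) : (cube d).Adj x (flipAt x i) :=
  cube_adj_iff.2 ⟨i, rfl⟩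

theorem flipAt_injective (x : Fin d → Bool) : Function.Injective (flipAt x) := by
  intro i j h
  by_contra hne
  have := congrFun h i
  rw [flipAt_self, flipAt_of_ne x hne] at this
  simp at this

/-- The coordinates in which `x` differs from `y`. -/
def diffSet (y x : Fin d → Bool) : Finset (Fin d) := Finset.univ.filter fun i => x i ≠ y i

theorem mem_diffSet {y x : Fin d → Bool} {i : Fin d} : i ∈ diffSet y x ↔ x i ≠ y i := by
  simp [diffSet]

theorem diffSet_self (y : Fin d → Bool) : diffSet y y = ∅ := by
  simp [diffSet]

theorem diffSet_injective (y : Fin d → Bool) : Function.Injective (diffSet y) := by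
  intro x x' h
  funext i
  have := Finset.ext_iff.1 h i
  rw [mem_diffSet, mem_diffSet] at this
  revert this
  cases x i <;> cases x' i <;> cases y i <;> simp

theorem diffSet_surjective (y : Fin d → Bool) : Function.Surjective (diffSet y) := by
  intro A
  refine ⟨fun i => if i ∈ A then !y i else y i, ?_⟩
  ext i
  rw [mem_diffSet]
  by_cases h : i ∈ A <;> simp [h]

theorem diffSet_flipAt (y x : Fin d → Bool) (i : Fin d) :
    diffSet y (flipAt x i) = symmDiff (diffSet y x) {i} := by
  ext j
  rw [Finset.mem_symmDiff, mem_diffSet, mem_diffSet, Finset.mem_singleton]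
  by_cases h : j = i
  · subst h
    rw [flipAt_self]
    cases x j <;> cases y j <;> simp
  · simp [flipAt_of_ne x h, h]

theorem flip_diffSet_iff {y x z : Fin d → Bool} :
    Flip (diffSet y x) (diffSet y z) ↔ (cube d).Adj x z := by
  rw [cube_adj_iff]
  constructor
  · rintro ⟨i, hi⟩
    refine ⟨i, diffSet_injective y ?_⟩
    rw [diffSet_flipAt, ← hi, symmDiff_symmDiff_cancel_left]
  · rintro ⟨i, rfl⟩
    exact ⟨i, by rw [diffSet_flipAt, symmDiff_symmDiff_cancel_left]⟩

theorem flip_edge_eq {x x' : Fin d → Bool} {i i' : Fin d}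
    (h : s(x, flipAt x i) = s(x', flipAt x' i')) : i = i' := by
  rcases Sym2.eq_iff.1 h with ⟨rfl, h2⟩ | ⟨rfl, h2⟩
  · exact flipAt_injective x h2
  · by_contra hne
    have := congrFun h2 i
    rw [flipAt_self, flipAt_of_ne _ hne] at this
    simp at this

open scoped Classical in
/-- The connected sets of `t` vertices of the hypercube. -/
noncomputable def connSets (d t : ℕ) : Finset (Finset (Fin d → Bool)) :=
  (Finset.univ.powersetCard t).filter fun S => ∀ r ∈ S, ConnFrom (cube d).Adj S r

theorem mem_connSets {t : ℕ} {S : Finset (Fin d → Bool)} :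
    S ∈ connSets d t ↔ S.card = t ∧ ∀ r ∈ S, ConnFrom (cube d).Adj S r := by
  simp [connSets, Finset.mem_powersetCard]

/-- Pairs of a vertex in `S` and a direction that stays in `S`. -/
def innerPairs (S : Finset (Fin d → Bool)) : Finset ((Fin d → Bool) × Fin d) :=
  (S ×ˢ Finset.univ).filter fun x => flipAt x.1 x.2 ∈ S

/-- Pairs of a vertex in `S` and a direction that leaves `S`. -/
def outerPairs (S : Finset (Fin d → Bool)) : Finset ((Fin d → Bool) × Fin d) :=
  (S ×ˢ Finset.univ).filter fun x => flipAt x.1 x.2 ∉ S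

/-- The edge given by a vertex and a direction. -/
def edgeOf (x : (Fin d → Bool) × Fin d) : Sym2 (Fin d → Bool) := s(x.1, flipAt x.1 x.2)

/-- The edges of the hypercube inside `S`. -/
def innerEdges (S : Finset (Fin d → Bool)) : Finset (Sym2 (Fin d → Bool)) :=
  (innerPairs S).image edgeOf

/-- The edges of the hypercube between `S` and its complement. -/
def bdry (S : Finset (Fin d → Bool)) : Finset (Sym2 (Fin d → Bool)) :=
  (outerPairs S).image edgeOf

theorem edgeOf_mem_cubeEdges (x : (Fin d → Bool) × Fin d) : edgeOf x ∈ cubeEdges d :=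
  mem_cubeEdges.2 ((cube d).mem_edgeSet.2 (cube_adj_flipAt _ _))

theorem innerEdges_subset (S : Finset (Fin d → Bool)) : innerEdges S ⊆ cubeEdges d := by
  intro e he
  obtain ⟨x, -, rfl⟩ := Finset.mem_image.1 he
  exact edgeOf_mem_cubeEdges x

theorem bdry_subset (S : Finset (Fin d → Bool)) : bdry S ⊆ cubeEdges d := by
  intro e he
  obtain ⟨x, -, rfl⟩ := Finset.mem_image.1 he
  exact edgeOf_mem_cubeEdges x

theorem mem_innerPairs {S : Finset (Fin d → Bool)} {x : (Fin d → Bool) × Fin d} :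
    x ∈ innerPairs S ↔ x.1 ∈ S ∧ flipAt x.1 x.2 ∈ S := by
  simp [innerPairs]

theorem mem_outerPairs {S : Finset (Fin d → Bool)} {x : (Fin d → Bool) × Fin d} :
    x ∈ outerPairs S ↔ x.1 ∈ S ∧ flipAt x.1 x.2 ∉ S := by
  simp [outerPairs]

theorem card_bdry (S : Finset (Fin d → Bool)) : (bdry S).card = (outerPairs S).card := by
  refine Finset.card_image_of_injOn ?_
  rintro ⟨x, i⟩ h ⟨x', i'⟩ h' he
  rw [Finset.mem_coe, mem_outerPairs] at h h'
  have hi : i = i' := flip_edge_eq he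
  subst hi
  rcases Sym2.eq_iff.1 he with ⟨h1, -⟩ | ⟨h1, -⟩
  · simp only at h1
    rw [h1]
  · simp only at h1
    exact absurd (h1 ▸ h.1) h'.2

theorem card_bdry_add_innerPairs (S : Finset (Fin d → Bool)) :
    (bdry S).card + (innerPairs S).card = S.card * d := by
  rw [card_bdry, innerPairs, outerPairs, add_comm, Finset.card_filter_add_card_filter_not,
    Finset.card_product, Finset.card_univ, Fintype.card_fin]

theorem card_innerPairs_le (S : Finset (Fin d → Bool)) :
    (innerPairs S).card ≤ S.card * S.card := by
  rw [← Finset.card_product]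
  refine Finset.card_le_card_of_injOn (fun x => (x.1, flipAt x.1 x.2)) ?_ ?_
  · intro x hx
    rw [Finset.mem_coe, mem_innerPairs] at hx
    exact Finset.mem_coe.2 (Finset.mem_product.2 hx)
  · rintro ⟨x, i⟩ - ⟨x', i'⟩ - h
    simp only [Prod.mk.injEq] at h
    obtain ⟨rfl, h2⟩ := h
    rw [flipAt_injective x h2]

/-- The deficit from `S.card * d` is bounded independently of `d`, so it costs only a constant
factor in probabilities. -/
theorem card_bdry_ge (S : Finset (Fin d → Bool)) : S.card * d ≤ (bdry S).card + S.card * S.card := by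
  have h1 := card_bdry_add_innerPairs S
  have h2 := card_innerPairs_le S
  omega

/-- The set `S` seen from the vertex `y`, as a family of sets of directions. -/
def family (y : Fin d → Bool) (S : Finset (Fin d → Bool)) : Finset (Finset (Fin d)) :=
  S.image (diffSet y)

theorem family_injective (y : Fin d → Bool) : Function.Injective (family y) :=
  Finset.image_injective (diffSet_injective y)

theorem card_family (y : Fin d → Bool) (S : Finset (Fin d → Bool)) :
    (family y S).card = S.card := Finset.card_image_of_injective _ (diffSet_injective y)

theorem diffSet_mem_family {y x : Fin d → Bool} {S : Finset (Fin d → Bool)} :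
    diffSet y x ∈ family y S ↔ x ∈ S := by
  simp [family, (diffSet_injective y).eq_iff]

theorem empty_mem_family {y : Fin d → Bool} {S : Finset (Fin d → Bool)} :
    ∅ ∈ family y S ↔ y ∈ S := by
  rw [← diffSet_self y, diffSet_mem_family]

theorem family_surjective (y : Fin d → Bool) (F : Finset (Finset (Fin d))) :
    ∃ S, family y S = F := by
  obtain ⟨g, hg⟩ := (diffSet_surjective y).hasRightInverse
  refine ⟨F.image g, ?_⟩
  rw [family, Finset.image_image, hg.comp_eq_id, Finset.image_id]

/-- `diffSet y` is an isomorphism from the cube to the sets of directions with `Flip` as adjacency,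
taking `y` to `∅`. -/
theorem connFrom_family_iff {y : Fin d → Bool} {S : Finset (Fin d → Bool)} :
    ConnFrom Flip (family y S) ∅ ↔ ConnFrom (cube d).Adj S y := by
  constructor
  · intro h
    obtain ⟨g, hg⟩ := (diffSet_surjective y).hasRightInverse
    have hleft : ∀ x, g (diffSet y x) = x := fun x => diffSet_injective y (hg _)
    have := h.image (R' := (cube d).Adj) g ?_
    · have hid : g ∘ diffSet y = id := funext hleft
      rw [family, Finset.image_image, hid, Finset.image_id] at this
      have h0 : g ∅ = y := by rw [← diffSet_self y, hleft]
      rwa [h0] at this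
    · intro A _ B _ hAB
      right
      rw [← flip_diffSet_iff (y := y), hg, hg]
      exact hAB
  · intro h
    have := h.image (R' := Flip) (diffSet y) fun a _ b _ hab => .inr (flip_diffSet_iff.2 hab)
    rwa [diffSet_self] at this

theorem card_support_family {t : ℕ} {y : Fin d → Bool} {S : Finset (Fin d → Bool)}
    (hS : S ∈ connSets d t) (hy : y ∈ S) : ((family y S).sup id).card + 1 ≤ t := by
  obtain ⟨hc, hconn⟩ := mem_connSets.1 hS
  have := (connFrom_family_iff.2 (hconn y hy)).card_sup (empty_mem_family.2 hy)
  rwa [card_family, hc] at this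

/-- Connected sets through `y` with as many directions as possible are the rooted trees. -/
theorem mem_rootedTrees_family_iff {n : ℕ} {y : Fin d → Bool} {S : Finset (Fin d → Bool)}
    {D : Finset (Fin d)} (hD : D.card = n) :
    family y S ∈ rootedTrees D ↔ S ∈ connSets d (n + 1) ∧ y ∈ S ∧ (family y S).sup id = D := by
  rw [mem_rootedTrees, empty_mem_family, card_family, connFrom_family_iff, mem_connSets, hD]
  constructor
  · rintro ⟨h1, h2, h3, h4⟩
    exact ⟨⟨h2, fun r hr => h4.of_mem (fun a b h => h.symm) hr⟩, h1, h3⟩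
  · rintro ⟨⟨h1, h2⟩, h3, h4⟩
    exact ⟨h3, h1, h4, h2 y h3⟩

open scoped Classical in
-- Choose the `n` directions, then a rooted tree on them.
theorem card_treeLike (n : ℕ) (y : Fin d → Bool) :
    ((connSets d (n + 1)).filter fun S => y ∈ S ∧ ((family y S).sup id).card = n).card =
      d.choose n * (n + 1) ^ (n - 1) := by
  have h1 : ((connSets d (n + 1)).filter fun S => y ∈ S ∧ ((family y S).sup id).card = n).card =
      ((Finset.univ.powersetCard n).sigma fun D : Finset (Fin d) => rootedTrees D).card := by
    refine Finset.card_bij (fun S _ => ⟨(family y S).sup id, family y S⟩) ?_ ?_ ?_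
    · intro S hS
      obtain ⟨hS1, hS2, hS3⟩ := Finset.mem_filter.1 hS
      rw [Finset.mem_sigma, Finset.mem_powersetCard]
      exact ⟨⟨Finset.subset_univ _, hS3⟩, (mem_rootedTrees_family_iff hS3).2 ⟨hS1, hS2, rfl⟩⟩
    · intro S _ S' _ h
      simp only [Sigma.mk.injEq, heq_eq_eq] at h
      exact family_injective y h.2
    · rintro ⟨D, F⟩ h
      rw [Finset.mem_sigma, Finset.mem_powersetCard] at h
      obtain ⟨⟨-, hD⟩, hF⟩ := h
      obtain ⟨S, rfl⟩ := family_surjective y F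
      simp only at hF hD
      obtain ⟨h1, h2, h3⟩ := (mem_rootedTrees_family_iff hD).1 hF
      refine ⟨S, Finset.mem_filter.2 ⟨h1, h2, h3 ▸ hD⟩, ?_⟩
      rw [h3]
  rw [h1, Finset.card_sigma, Finset.sum_congr rfl (g := fun _ => (n + 1) ^ (n - 1)),
    Finset.sum_const, Finset.card_powersetCard, Finset.card_univ, Fintype.card_fin, smul_eq_mul]
  intro D hD
  rw [card_rootedTrees, (Finset.mem_powersetCard.1 hD).2]

open scoped Classical in
-- The directions used lie in some `n`-set, and an `n`-set carries only `2 ^ 2 ^ n` families. With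
-- `n` below the maximum this makes the sets that are not tree-like negligible.
theorem card_connSets_support_le {n t : ℕ} (hn : n ≤ d) (y : Fin d → Bool) :
    ((connSets d t).filter fun S => y ∈ S ∧ ((family y S).sup id).card ≤ n).card ≤
      2 ^ 2 ^ n * d ^ n := by
  have hsub : ((connSets d t).filter fun S => y ∈ S ∧ ((family y S).sup id).card ≤ n).image
      (family y) ⊆ (Finset.univ.powersetCard n).biUnion
        fun D : Finset (Fin d) => D.powerset.powerset := by
    intro F hF
    obtain ⟨S, hS, rfl⟩ := Finset.mem_image.1 hF
    obtain ⟨hS1, hS2, hS3⟩ := Finset.mem_filter.1 hS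
    obtain ⟨D, hD, -, hDc⟩ := Finset.exists_subsuperset_card_eq (Finset.subset_univ _) hS3
      (by rwa [Finset.card_univ, Fintype.card_fin])
    rw [Finset.mem_biUnion]
    refine ⟨D, Finset.mem_powersetCard.2 ⟨Finset.subset_univ _, hDc⟩, ?_⟩
    rw [Finset.mem_powerset]
    intro A hA
    rw [Finset.mem_powerset]
    exact (Finset.le_sup (f := id) hA).trans hD
  have h1 := Finset.card_le_card hsub
  rw [Finset.card_image_of_injective _ (family_injective y)] at h1
  refine h1.trans (Finset.card_biUnion_le.trans ?_)
  rw [Finset.sum_congr rfl (g := fun _ => 2 ^ 2 ^ n), Finset.sum_const, Finset.card_powersetCard,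
    Finset.card_univ, Fintype.card_fin, smul_eq_mul, mul_comm]
  · exact Nat.mul_le_mul_left _ (Nat.choose_le_pow d n)
  · intro D hD
    rw [Finset.card_powerset, Finset.card_powerset, (Finset.mem_powersetCard.1 hD).2]

end Cube

/-! ### Component probabilities -/

section Prob

variable {d : ℕ}

theorem diffSet_flipAt_insert {y x : Fin d → Bool} {i : Fin d} (h : i ∉ diffSet y x) :
    diffSet y (flipAt x i) = insert i (diffSet y x) := by
  rw [diffSet_flipAt]
  ext j
  simp only [Finset.mem_symmDiff, Finset.mem_singleton, Finset.mem_insert]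
  grind

theorem mem_diffSet_flipAt {y x : Fin d → Bool} {i : Fin d} :
    i ∈ diffSet y (flipAt x i) ↔ i ∉ diffSet y x := by
  rw [diffSet_flipAt]
  simp only [Finset.mem_symmDiff, Finset.mem_singleton]
  grind

theorem edgeOf_flipAt (x : Fin d → Bool) (i : Fin d) : edgeOf (flipAt x i, i) = edgeOf (x, i) := by
  simp only [edgeOf, flipAt_flipAt]
  exact Sym2.eq_swap

/-! ### Tree-like sets: exactly one edge in each direction used. -/

section TreeLike

variable {n : ℕ} {y : Fin d → Bool} {S : Finset (Fin d → Bool)}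

theorem exists_inner_edge (hF : family y S ∈ rootedTrees ((family y S).sup id)) {i : Fin d}
    (hi : i ∈ (family y S).sup id) : ∃ x ∈ S, i ∉ diffSet y x ∧ flipAt x i ∈ S := by
  obtain ⟨A, hA, hiA, hA'⟩ := exists_edge_of_mem_rootedTrees hF hi
  obtain ⟨x, hx, rfl⟩ := Finset.mem_image.1 hA
  refine ⟨x, hx, hiA, ?_⟩
  rwa [← diffSet_flipAt_insert hiA, diffSet_mem_family] at hA'

theorem inner_edge_unique (hF : family y S ∈ rootedTrees ((family y S).sup id)) {i : Fin d}
    {x x' : Fin d → Bool} (hx : x ∈ S) (hi : i ∉ diffSet y x) (hf : flipAt x i ∈ S)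
    (hx' : x' ∈ S) (hi' : i ∉ diffSet y x') (hf' : flipAt x' i ∈ S) : x = x' := by
  have hD : i ∈ (family y S).sup id := by
    refine Finset.mem_sup.2 ⟨_, diffSet_mem_family.2 hf, ?_⟩
    exact mem_diffSet_flipAt.2 hi
  refine diffSet_injective y (edge_unique_of_mem_rootedTrees hF hD (diffSet_mem_family.2 hx) hi ?_
    (diffSet_mem_family.2 hx') hi' ?_)
  · rwa [← diffSet_flipAt_insert hi, diffSet_mem_family]
  · rwa [← diffSet_flipAt_insert hi', diffSet_mem_family]

/-- The inner pairs directed away from `y`. -/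
def outwardPairs (y : Fin d → Bool) (S : Finset (Fin d → Bool)) :
    Finset ((Fin d → Bool) × Fin d) :=
  (innerPairs S).filter fun x => x.2 ∉ diffSet y x.1

theorem mem_outwardPairs {x : (Fin d → Bool) × Fin d} :
    x ∈ outwardPairs y S ↔ (x.1 ∈ S ∧ flipAt x.1 x.2 ∈ S) ∧ x.2 ∉ diffSet y x.1 := by
  rw [outwardPairs, Finset.mem_filter, mem_innerPairs]

theorem card_outwardPairs (hF : family y S ∈ rootedTrees ((family y S).sup id)) :
    (outwardPairs y S).card = ((family y S).sup id).card := by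
  refine Finset.card_bij (fun x _ => x.2) ?_ ?_ ?_
  · rintro ⟨x, i⟩ hx
    rw [mem_outwardPairs] at hx
    exact Finset.mem_sup.2 ⟨_, diffSet_mem_family.2 hx.1.2, mem_diffSet_flipAt.2 hx.2⟩
  · rintro ⟨x, i⟩ hx ⟨x', i'⟩ hx' h
    rw [mem_outwardPairs] at hx hx'
    simp only at h
    subst h
    exact Prod.ext (inner_edge_unique hF hx.1.1 hx.2 hx.1.2 hx'.1.1 hx'.2 hx'.1.2) rfl
  · intro i hi
    obtain ⟨x, hx, hix, hf⟩ := exists_inner_edge hF hi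
    exact ⟨(x, i), mem_outwardPairs.2 ⟨⟨hx, hf⟩, hix⟩, rfl⟩

/-- Each inner edge gives two pairs, and traversing it backwards exchanges outward and inward. -/
theorem card_innerPairs_eq_two_mul :
    (innerPairs S).card = 2 * (outwardPairs y S).card := by
  rw [← Finset.card_filter_add_card_filter_not (s := innerPairs S)
    (fun x => x.2 ∉ diffSet y x.1), two_mul]
  congr 1
  refine Finset.card_bij (fun x _ => (flipAt x.1 x.2, x.2)) ?_ ?_ ?_
  · rintro ⟨x, i⟩ hx
    rw [Finset.mem_filter, mem_innerPairs, not_not] at hx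
    rw [mem_outwardPairs]
    simp only [flipAt_flipAt] at hx ⊢
    exact ⟨⟨hx.1.2, hx.1.1⟩, fun h => mem_diffSet_flipAt.1 h hx.2⟩
  · rintro ⟨x, i⟩ - ⟨x', i'⟩ - h
    simp only [Prod.mk.injEq] at h
    obtain ⟨h1, rfl⟩ := h
    rw [← flipAt_flipAt x i, h1, flipAt_flipAt]
  · rintro ⟨x, i⟩ hx
    rw [mem_outwardPairs] at hx
    refine ⟨(flipAt x i, i), ?_, by simp [flipAt_flipAt]⟩
    rw [Finset.mem_filter, mem_innerPairs, not_not]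
    simp only [flipAt_flipAt] at hx ⊢
    exact ⟨⟨hx.1.2, hx.1.1⟩, mem_diffSet_flipAt.2 hx.2⟩

theorem innerEdges_eq_image_outwardPairs (y : Fin d → Bool) :
    innerEdges S = (outwardPairs y S).image edgeOf := by
  refine Finset.Subset.antisymm ?_ (Finset.image_subset_image (Finset.filter_subset _ _))
  intro e he
  obtain ⟨⟨x, i⟩, hx, rfl⟩ := Finset.mem_image.1 he
  rw [mem_innerPairs] at hx
  rw [Finset.mem_image]
  by_cases hi : i ∈ diffSet y x
  · refine ⟨(flipAt x i, i), mem_outwardPairs.2 ⟨?_, fun h => mem_diffSet_flipAt.1 h hi⟩,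
      edgeOf_flipAt x i⟩
    simp only [flipAt_flipAt]
    exact ⟨hx.2, hx.1⟩
  · exact ⟨(x, i), mem_outwardPairs.2 ⟨hx, hi⟩, rfl⟩

theorem card_innerEdges (hF : family y S ∈ rootedTrees ((family y S).sup id)) :
    (innerEdges S).card = ((family y S).sup id).card := by
  rw [innerEdges_eq_image_outwardPairs y, Finset.card_image_of_injOn, card_outwardPairs hF]
  rintro ⟨x, i⟩ hx ⟨x', i'⟩ hx' h
  rw [Finset.mem_coe, mem_outwardPairs] at hx hx'
  have hi : i = i' := flip_edge_eq h
  subst hi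
  exact Prod.ext (inner_edge_unique hF hx.1.1 hx.2 hx.1.2 hx'.1.1 hx'.2 hx'.1.2) rfl

end TreeLike

/-! ### Component indicators and their probabilities. -/

/-- The subgraph of the hypercube with the edges in `ω`. -/
def subcube (ω : Finset (Sym2 (Fin d → Bool))) : SimpleGraph (Fin d → Bool) :=
  SimpleGraph.fromEdgeSet (ω : Set (Sym2 (Fin d → Bool))) ⊓ cube d

theorem subcube_adj {ω : Finset (Sym2 (Fin d → Bool))} {x y : Fin d → Bool} :
    (subcube ω).Adj x y ↔ s(x, y) ∈ ω ∧ (cube d).Adj x y := by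
  rw [subcube, SimpleGraph.inf_adj, SimpleGraph.fromEdgeSet_adj, Finset.mem_coe]
  exact ⟨fun h => ⟨h.1.1, h.2⟩, fun h => ⟨⟨h.1, h.2.ne⟩, h.2⟩⟩

/-- Intersecting with the cube lets the locality statements hold for every `ω`; on the sample space
it changes nothing. -/
theorem subcube_eq {ω : Finset (Sym2 (Fin d → Bool))} (h : ω ⊆ cubeEdges d) :
    subcube ω = SimpleGraph.fromEdgeSet (ω : Set (Sym2 (Fin d → Bool))) := by
  refine inf_eq_left.2 fun x y hxy => ?_
  rw [SimpleGraph.fromEdgeSet_adj, Finset.mem_coe] at hxy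
  exact (cube d).mem_edgeSet.1 (mem_cubeEdges.1 (h hxy.1))

open scoped Classical in
/-- The indicator that `S` is a component of the graph with the edges in `ω`. -/
noncomputable def compInd (S : Finset (Fin d → Bool)) (ω : Finset (Sym2 (Fin d → Bool))) : ℕ :=
  if IsComp (subcube ω) S then 1 else 0

theorem compInd_eq_zero_or_one (S : Finset (Fin d → Bool)) (ω : Finset (Sym2 (Fin d → Bool))) :
    compInd S ω = 0 ∨ compInd S ω = 1 := by
  unfold compInd
  split_ifs <;> simp

theorem IsComp.mem_connSets {S : Finset (Fin d → Bool)} {ω : Finset (Sym2 (Fin d → Bool))}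
    (h : IsComp (subcube ω) S) : S ∈ connSets d S.card :=
  RandomCube.mem_connSets.2 ⟨rfl, fun r hr =>
    (h.2.2 r hr).mono_rel fun _ _ _ _ hab => (subcube_adj.1 hab).2⟩

theorem numComp_subcube (t : ℕ) (ω : Finset (Sym2 (Fin d → Bool))) :
    numComp t (subcube ω) = ∑ S ∈ connSets d t, compInd S ω := by
  classical
  rw [numComp_eq_card, Finset.card_filter, connSets, Finset.sum_filter]
  refine Finset.sum_congr rfl fun S hS => ?_
  by_cases hc : IsComp (subcube ω) S
  · have := (mem_connSets.1 hc.mem_connSets).2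
    rw [if_pos this, compInd, if_pos hc]
  · rw [if_neg hc, compInd, if_neg hc, ite_self]

theorem integral_numComp (p : unitInterval) (t d : ℕ) (F : ℕ → ℝ) :
    ∫ G, F (numComp t G) ∂(law p d) = ∑ ω ∈ (cubeEdges d).powerset,
      bw p (cubeEdges d) ω * F (∑ S ∈ connSets d t, compInd S ω) := by
  rw [integral_law p d fun G => F (numComp t G)]
  refine Finset.sum_congr rfl fun ω hω => ?_
  rw [← subcube_eq (Finset.mem_powerset.1 hω), numComp_subcube]

/-- The probability that `S` is a component. -/
noncomputable def compProb (p : ℝ) (S : Finset (Fin d → Bool)) : ℝ :=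
  ∑ ω ∈ (cubeEdges d).powerset, bw p (cubeEdges d) ω * compInd S ω

theorem mean_eq_sum (p : unitInterval) (t d : ℕ) :
    mean p t d = ∑ S ∈ connSets d t, compProb p S := by
  rw [mean, integral_numComp p t d fun k => (k : ℝ)]
  simp only [compProb]
  rw [Finset.sum_comm]
  refine Finset.sum_congr rfl fun ω _ => ?_
  push_cast
  rw [Finset.mul_sum]

theorem disjoint_bdry_of_isComp {S : Finset (Fin d → Bool)} {ω : Finset (Sym2 (Fin d → Bool))}
    (h : IsComp (subcube ω) S) : Disjoint (bdry S) ω := by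
  rw [Finset.disjoint_left]
  intro e he heω
  obtain ⟨⟨x, i⟩, hx, rfl⟩ := Finset.mem_image.1 he
  rw [mem_outerPairs] at hx
  exact hx.2 (h.2.1 x hx.1 _ (subcube_adj.2 ⟨heω, cube_adj_flipAt x i⟩))

section Bounds

variable {p : ℝ} (hp0 : 0 ≤ p) (hp1 : p ≤ 1)
include hp0 hp1

theorem compProb_nonneg (S : Finset (Fin d → Bool)) : 0 ≤ compProb p S :=
  Finset.sum_nonneg fun _ _ => mul_nonneg (bw_nonneg hp0 hp1 _ _) (Nat.cast_nonneg _)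

/-- A component has no present boundary edge. -/
theorem compProb_le (S : Finset (Fin d → Bool)) : compProb p S ≤ (1 - p) ^ (bdry S).card := by
  classical
  have h := sum_bw_cylinder p (Finset.empty_subset (cubeEdges d)) (bdry_subset S)
    (Finset.disjoint_empty_left _)
  rw [Finset.card_empty, pow_zero, one_mul] at h
  rw [← h]
  refine Finset.sum_le_sum fun ω _ => mul_le_mul_of_nonneg_left ?_ (bw_nonneg hp0 hp1 _ _)
  unfold compInd
  by_cases hc : IsComp (subcube ω) S
  · simp [hc, disjoint_bdry_of_isComp hc]
  · rw [if_neg hc]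
    split_ifs <;> simp

end Bounds

/-- A tree-like set has just one edge in each of its directions. Connecting `y` to the far end of
that edge requires crossing the direction inside `S`, so the edge itself must be present. -/
theorem isComp_iff_of_treeLike {y : Fin d → Bool} {S : Finset (Fin d → Bool)}
    (hF : family y S ∈ rootedTrees ((family y S).sup id))
    (hconn : ∀ r ∈ S, ConnFrom (cube d).Adj S r) (hy : y ∈ S)
    (ω : Finset (Sym2 (Fin d → Bool))) :
    IsComp (subcube ω) S ↔ innerEdges S ⊆ ω ∧ Disjoint (bdry S) ω := by
  constructor
  · refine fun h => ⟨?_, disjoint_bdry_of_isComp h⟩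
    rw [innerEdges_eq_image_outwardPairs y]
    intro e he
    obtain ⟨⟨x, i⟩, hx, rfl⟩ := Finset.mem_image.1 he
    rw [mem_outwardPairs] at hx
    obtain ⟨⟨hxS, hfS⟩, hix⟩ := hx
    simp only at hxS hfS hix
    obtain ⟨a, b, ha, hb, hab, hia, hib⟩ := (h.2.2 y hy).exists_crossing
      (fun z => i ∉ diffSet y z) (by simp [diffSet_self]) hfS
      (not_not.2 (mem_diffSet_flipAt.2 hix))
    rw [not_not] at hib
    rw [subcube_adj] at hab
    obtain ⟨j, rfl⟩ := cube_adj_iff.1 hab.2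
    have hij : i = j := by
      by_contra hne
      rw [diffSet_flipAt, Finset.mem_symmDiff, Finset.mem_singleton] at hib
      tauto
    subst hij
    rw [inner_edge_unique hF hxS hix hfS ha hia hb]
    exact hab.1
  · rintro ⟨hin, hdis⟩
    refine ⟨⟨y, hy⟩, ?_, ?_⟩
    · intro x hx z hxz
      rw [subcube_adj] at hxz
      obtain ⟨i, rfl⟩ := cube_adj_iff.1 hxz.2
      by_contra hz
      exact Finset.disjoint_left.1 hdis
        (Finset.mem_image.2 ⟨(x, i), mem_outerPairs.2 ⟨hx, hz⟩, rfl⟩) hxz.1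
    · intro r hr
      refine (hconn r hr).mono_rel fun a ha b hb hab => subcube_adj.2 ⟨hin ?_, hab⟩
      obtain ⟨i, rfl⟩ := cube_adj_iff.1 hab
      exact Finset.mem_image.2 ⟨(a, i), mem_innerPairs.2 ⟨ha, hb⟩, rfl⟩

/-- Exactly `n` edges must be present and `(n + 1) * d - 2 * n` absent. The first conjunct says that
this subtraction is not truncated. -/
theorem compProb_of_treeLike (p : ℝ) {n : ℕ} {y : Fin d → Bool} {S : Finset (Fin d → Bool)}
    (hS : S ∈ connSets d (n + 1)) (hy : y ∈ S) (hn : ((family y S).sup id).card = n) :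
    2 * n ≤ (n + 1) * d ∧ compProb p S = p ^ n * (1 - p) ^ ((n + 1) * d - 2 * n) := by
  classical
  have hF : family y S ∈ rootedTrees ((family y S).sup id) :=
    (mem_rootedTrees_family_iff hn).2 ⟨hS, hy, rfl⟩
  obtain ⟨hc, hconn⟩ := mem_connSets.1 hS
  have h1 := card_bdry_add_innerPairs S
  rw [card_innerPairs_eq_two_mul (y := y), card_outwardPairs hF, hn, hc] at h1
  refine ⟨by omega, ?_⟩
  have hdisj : Disjoint (innerEdges S) (bdry S) := by
    rw [Finset.disjoint_left]
    intro e he he'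
    obtain ⟨⟨x, i⟩, hx, rfl⟩ := Finset.mem_image.1 he
    obtain ⟨⟨x', i'⟩, hx', h⟩ := Finset.mem_image.1 he'
    rw [mem_innerPairs] at hx
    rw [mem_outerPairs] at hx'
    rcases Sym2.eq_iff.1 h with ⟨-, h2⟩ | ⟨-, h2⟩
    · exact hx'.2 (h2 ▸ hx.2)
    · exact hx'.2 (h2 ▸ hx.1)
  have h2 := sum_bw_cylinder p (innerEdges_subset S) (bdry_subset S) hdisj
  rw [card_innerEdges hF, hn] at h2
  have h3 : (bdry S).card = (n + 1) * d - 2 * n := by omega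
  rw [← h3, ← h2, compProb]
  refine Finset.sum_congr rfl fun ω _ => ?_
  rw [compInd]
  simp only [isComp_iff_of_treeLike hF hconn hy ω]
  split_ifs <;> simp

/-! ### Dependence between components -/

open scoped Classical in
/-- The pairs of vertices that meet `S`. -/
noncomputable def touching (S : Finset (Fin d → Bool)) : Finset (Sym2 (Fin d → Bool)) :=
  Finset.univ.filter fun e => ∃ x ∈ S, x ∈ e

theorem mem_touching {S : Finset (Fin d → Bool)} {x y : Fin d → Bool} :
    s(x, y) ∈ touching S ↔ x ∈ S ∨ y ∈ S := by
  simp only [touching, Finset.mem_filter, Finset.mem_univ, true_and, Sym2.mem_iff]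
  constructor
  · rintro ⟨z, hz, rfl | rfl⟩ <;> tauto
  · rintro (h | h)
    · exact ⟨x, h, .inl rfl⟩
    · exact ⟨y, h, .inr rfl⟩

/-- Two vertex sets intersect or are joined by an edge of the hypercube. -/
def Near (S S' : Finset (Fin d → Bool)) : Prop :=
  ∃ x ∈ S, ∃ y ∈ S', x = y ∨ (cube d).Adj x y

open scoped Classical in
theorem compInd_inter_touching (S : Finset (Fin d → Bool)) (ω : Finset (Sym2 (Fin d → Bool))) :
    compInd S ω = compInd S (ω ∩ touching S) := by
  unfold compInd
  refine if_congr (isComp_congr fun x hx y => ?_) rfl rfl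
  rw [subcube_adj, subcube_adj, Finset.mem_inter, mem_touching]
  tauto

open scoped Classical in
-- No edge of the cube that meets `S'` can touch `S`, because adjacency counts as `Near`.
theorem compInd_sdiff_touching {S S' : Finset (Fin d → Bool)} (h : ¬ Near S S')
    (ω : Finset (Sym2 (Fin d → Bool))) : compInd S' ω = compInd S' (ω \ touching S) := by
  unfold compInd
  refine if_congr (isComp_congr fun x hx y => ?_) rfl rfl
  rw [subcube_adj, subcube_adj, Finset.mem_sdiff, mem_touching]
  constructor
  · rintro ⟨h1, h2⟩
    refine ⟨⟨h1, ?_⟩, h2⟩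
    rintro (h3 | h3)
    · exact h ⟨x, h3, x, hx, .inl rfl⟩
    · exact h ⟨y, h3, x, hx, .inr h2.symm⟩
  · exact fun h => ⟨h.1.1, h.2⟩

open scoped Classical in
theorem compInd_indep (p : ℝ) (t : ℕ) (S : Finset (Fin d → Bool)) (g : ℕ → ℝ) :
    ∑ ω ∈ (cubeEdges d).powerset, bw p (cubeEdges d) ω *
      (compInd S ω * g (∑ S' ∈ connSets d t with ¬ Near S S', compInd S' ω)) =
      compProb p S * ∑ ω ∈ (cubeEdges d).powerset, bw p (cubeEdges d) ω *
        g (∑ S' ∈ connSets d t with ¬ Near S S', compInd S' ω) := by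
  refine sum_bw_indep p (cubeEdges d) (touching S) (fun ω => (compInd S ω : ℝ))
    (fun ω => g (∑ S' ∈ connSets d t with ¬ Near S S', compInd S' ω)) ?_ ?_
  · intro ω
    rw [compInd_inter_touching]
  · intro ω
    rw [Finset.sum_congr rfl fun S' hS' =>
      compInd_sdiff_touching (Finset.mem_filter.1 hS').2 ω]

/-- The probability that `S` and `S'` are both components. -/
noncomputable def pairProb (p : ℝ) (S S' : Finset (Fin d → Bool)) : ℝ :=
  ∑ ω ∈ (cubeEdges d).powerset, bw p (cubeEdges d) ω * (compInd S ω * compInd S' ω)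

theorem pairProb_of_not_near (p : ℝ) {S S' : Finset (Fin d → Bool)} (h : ¬ Near S S') :
    pairProb p S S' = compProb p S * compProb p S' := by
  classical
  refine sum_bw_indep p (cubeEdges d) (touching S) (fun ω => (compInd S ω : ℝ))
    (fun ω => (compInd S' ω : ℝ)) ?_ ?_
  · intro ω
    rw [compInd_inter_touching]
  · intro ω
    rw [compInd_sdiff_touching h ω]

theorem pairProb_self (p : ℝ) (S : Finset (Fin d → Bool)) : pairProb p S S = compProb p S := by
  refine Finset.sum_congr rfl fun ω _ => ?_
  rcases compInd_eq_zero_or_one S ω with h | h <;> simp [h]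

theorem pairProb_nonneg {p : ℝ} (hp0 : 0 ≤ p) (hp1 : p ≤ 1) (S S' : Finset (Fin d → Bool)) :
    0 ≤ pairProb p S S' :=
  Finset.sum_nonneg fun _ _ => mul_nonneg (bw_nonneg hp0 hp1 _ _) (by positivity)

/-- Distinct components are disjoint, so intersecting sets give zero. For disjoint sets, the
boundary edges of `S'` that do not touch `S` must all be absent, independently of `S`; at most
`S.card * S'.card` boundary edges are lost in this way. -/
theorem pairProb_le {p : ℝ} (hp0 : 0 ≤ p) (hp1 : p < 1) {S S' : Finset (Fin d → Bool)}
    (hne : S ≠ S') : pairProb p S S' ≤ compProb p S *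
      ((1 - p) ^ (S'.card * d) / (1 - p) ^ (S'.card * S'.card + S.card * S'.card)) := by
  classical
  have hq : 0 < 1 - p := sub_pos.2 hp1
  have hq1 : 1 - p ≤ 1 := by linarith
  by_cases hdis : Disjoint S S'
  · set B := bdry S' \ touching S with hB
    have hBs : B ⊆ cubeEdges d := Finset.sdiff_subset.trans (bdry_subset S')
    have hcard : S'.card * d ≤ B.card + (S'.card * S'.card + S.card * S'.card) := by
      have h1 := card_bdry_ge S'
      have h2 : (bdry S').card ≤ B.card + S.card * S'.card := by
        have h3 : (bdry S' ∩ touching S).card ≤ S.card * S'.card := by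
          rw [← Finset.card_product]
          refine (Finset.card_le_card ?_).trans
            (Finset.card_image_le (s := S ×ˢ S') (f := fun x => s(x.2, x.1)))
          intro e he
          obtain ⟨he1, he2⟩ := Finset.mem_inter.1 he
          obtain ⟨⟨x, i⟩, hx, rfl⟩ := Finset.mem_image.1 he1
          rw [mem_outerPairs] at hx
          rw [edgeOf, mem_touching] at he2
          rcases he2 with h | h
          · exact absurd hx.1 (Finset.disjoint_left.1 hdis h)
          · exact Finset.mem_image.2 ⟨(flipAt x i, x), Finset.mem_product.2 ⟨h, hx.1⟩, rfl⟩
        have h4 : (bdry S' ∩ touching S).card + B.card = (bdry S').card :=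
          Finset.card_inter_add_card_sdiff _ _
        omega
      omega
    have hcyl := sum_bw_cylinder p (Finset.empty_subset (cubeEdges d)) hBs
      (Finset.disjoint_empty_left _)
    rw [Finset.card_empty, pow_zero, one_mul] at hcyl
    have hind := sum_bw_indep p (cubeEdges d) (touching S) (fun ω => (compInd S ω : ℝ))
      (fun ω => if ∅ ⊆ ω ∧ Disjoint B ω then 1 else 0)
      (fun ω => by rw [compInd_inter_touching]) ?_
    · have hle : pairProb p S S' ≤ compProb p S * (1 - p) ^ B.card := by
        rw [← hcyl]
        refine le_trans ?_ hind.le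
        refine Finset.sum_le_sum fun ω _ => mul_le_mul_of_nonneg_left ?_
          (bw_nonneg hp0 hp1.le _ _)
        refine mul_le_mul_of_nonneg_left ?_ (Nat.cast_nonneg _)
        unfold compInd
        by_cases hc : IsComp (subcube ω) S'
        · have := (disjoint_bdry_of_isComp hc).mono_left (Finset.sdiff_subset (t := touching S))
          rw [← hB] at this
          simp [hc, this]
        · rw [if_neg hc]
          split_ifs <;> simp
      refine hle.trans (mul_le_mul_of_nonneg_left ?_ (compProb_nonneg hp0 hp1.le S))
      rw [le_div_iff₀ (pow_pos hq _), ← pow_add]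
      exact pow_le_pow_of_le_one hq.le hq1 hcard
    · intro ω
      have : Disjoint B ω ↔ Disjoint B (ω \ touching S) := by
        simp only [Finset.disjoint_left, Finset.mem_sdiff, hB]
        constructor
        · exact fun h e he h' => h he h'.1
        · exact fun h e he h' => h he ⟨h', he.2⟩
      simp only [Finset.empty_subset, true_and, this]
  · rw [Finset.not_disjoint_iff] at hdis
    obtain ⟨x, hx, hx'⟩ := hdis
    have : pairProb p S S' = 0 := by
      refine Finset.sum_eq_zero fun ω _ => ?_
      have h0 : compInd S ω = 0 ∨ compInd S' ω = 0 := by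
        unfold compInd
        by_cases h1 : IsComp (subcube ω) S <;> by_cases h2 : IsComp (subcube ω) S'
        · exact absurd (h1.eq_of_mem h2 hx hx') hne
        all_goals simp [h1, h2]
      rcases h0 with h | h <;> simp [h]
    rw [this]
    exact mul_nonneg (compProb_nonneg hp0 hp1.le S) (by positivity)

open scoped Classical in
-- A near set contains a point of `S` or a neighbour of such a point, hence one of at most `2 * t *
-- d` vertices, and each vertex lies in O(d^(t-1)) connected sets.
theorem card_near_le {t : ℕ} (ht : 1 ≤ t) (hd : t ≤ d) {S : Finset (Fin d → Bool)}
    (hS : S ∈ connSets d t) :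
    ((connSets d t).filter fun S' => Near S S').card ≤ 2 * t * 2 ^ 2 ^ (t - 1) * d ^ t := by
  have hc := (mem_connSets.1 hS).1
  set Z : Finset (Fin d → Bool) := S ∪ (S ×ˢ Finset.univ).image fun x => flipAt x.1 x.2 with hZ
  have hZc : Z.card ≤ 2 * t * d := by
    refine (Finset.card_union_le _ _).trans ?_
    have := Finset.card_image_le (s := S ×ˢ (Finset.univ : Finset (Fin d)))
      (f := fun x => flipAt x.1 x.2)
    rw [Finset.card_product, Finset.card_univ, Fintype.card_fin, hc] at this
    have h1 : 1 ≤ d := ht.trans hd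
    rw [hc]
    nlinarith
  have hsub : ((connSets d t).filter fun S' => Near S S') ⊆ Z.biUnion fun y =>
      (connSets d t).filter fun S' => y ∈ S' ∧ ((family y S').sup id).card ≤ t - 1 := by
    intro S' hS'
    obtain ⟨hS'1, x, hx, y, hy, hxy⟩ := Finset.mem_filter.1 hS'
    rw [Finset.mem_biUnion]
    refine ⟨y, ?_, Finset.mem_filter.2 ⟨hS'1, hy, ?_⟩⟩
    · rcases hxy with rfl | hxy
      · exact Finset.mem_union_left _ hx
      · obtain ⟨i, rfl⟩ := cube_adj_iff.1 hxy
        exact Finset.mem_union_right _ (Finset.mem_image.2 ⟨(x, i), by simp [hx], rfl⟩)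
    · have := card_support_family hS'1 hy
      omega
  refine (Finset.card_le_card hsub).trans (Finset.card_biUnion_le.trans ?_)
  refine (Finset.sum_le_card_nsmul _ _ (2 ^ 2 ^ (t - 1) * d ^ (t - 1)) fun y _ =>
    card_connSets_support_le (by omega) y).trans ?_
  rw [smul_eq_mul]
  calc Z.card * (2 ^ 2 ^ (t - 1) * d ^ (t - 1))
      ≤ (2 * t * d) * (2 ^ 2 ^ (t - 1) * d ^ (t - 1)) := Nat.mul_le_mul_right _ hZc
    _ = 2 * t * 2 ^ 2 ^ (t - 1) * (d ^ (t - 1) * d) := by ring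
    _ = 2 * t * 2 ^ 2 ^ (t - 1) * d ^ t := by rw [← pow_succ, Nat.sub_add_cancel ht]

end Prob

/-! ### The mean number of components -/

/-- The factor `d` on the left avoids the exponent `n - 1` on the right. Each induction step adds at
most `n * d ^ (n + 1)`, and `n ^ 2 + n ≤ (n + 1) ^ 2`. -/
theorem descFactorial_lower_bound (d n : ℕ) :
    (d : ℝ) * ((d : ℝ) ^ n - d.descFactorial n) ≤ (n : ℝ) ^ 2 * (d : ℝ) ^ n := by
  induction n with
  | zero => simp
  | succ n ih =>
    have hle : (d.descFactorial n : ℝ) ≤ (d : ℝ) ^ n := by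
      exact_mod_cast Nat.descFactorial_le_pow d n
    have hsub : (d : ℝ) - n ≤ ((d - n : ℕ) : ℝ) := by
      rcases le_total n d with h | h
      · rw [Nat.cast_sub h]
      · rw [Nat.sub_eq_zero_of_le h, Nat.cast_zero, sub_nonpos]; exact_mod_cast h
    have hD : 0 ≤ (d.descFactorial n : ℝ) := Nat.cast_nonneg _
    have h1 : ((d : ℝ) - n) * d.descFactorial n ≤ ((d - n : ℕ) : ℝ) * d.descFactorial n :=
      mul_le_mul_of_nonneg_right hsub hD
    have hd : (0 : ℝ) ≤ d := Nat.cast_nonneg d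
    have hn : (0 : ℝ) ≤ n := Nat.cast_nonneg n
    have hp : (0 : ℝ) ≤ (d : ℝ) ^ n := pow_nonneg hd n
    rw [Nat.descFactorial_succ]
    push_cast
    calc (d : ℝ) * ((d : ℝ) ^ (n + 1) - ((d - n : ℕ) : ℝ) * d.descFactorial n)
        ≤ d * ((d : ℝ) ^ (n + 1) - ((d : ℝ) - n) * d.descFactorial n) := by gcongr
      _ = d * (d * ((d : ℝ) ^ n - d.descFactorial n)) + n * (d * d.descFactorial n) := by ring
      _ ≤ d * ((n : ℝ) ^ 2 * (d : ℝ) ^ n) + n * (d * (d : ℝ) ^ n) := by gcongr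
      _ = ((n : ℝ) ^ 2 + n) * (d : ℝ) ^ (n + 1) := by ring
      _ ≤ ((n : ℝ) + 1) ^ 2 * (d : ℝ) ^ (n + 1) := by
        gcongr
        nlinarith

theorem choose_sub_pow_bound {d n : ℕ} (hd : 1 ≤ d) :
    |(d.choose n : ℝ) - (d : ℝ) ^ n / n.factorial| ≤ (n : ℝ) ^ 2 * ((d : ℝ) ^ n / d) := by
  have hf : (1 : ℝ) ≤ n.factorial := by exact_mod_cast Nat.one_le_iff_ne_zero.2 n.factorial_ne_zero
  have hd' : (0 : ℝ) < d := by exact_mod_cast hd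
  have h1 := descFactorial_lower_bound d n
  have h2 : (d.descFactorial n : ℝ) ≤ (d : ℝ) ^ n := by
    exact_mod_cast Nat.descFactorial_le_pow d n
  have h3 : (d.choose n : ℝ) = d.descFactorial n / n.factorial := by
    rw [Nat.descFactorial_eq_factorial_mul_choose]
    push_cast
    field_simp
  rw [h3, ← sub_div, abs_div, abs_of_nonpos (sub_nonpos.2 h2), abs_of_pos (by positivity), neg_sub]
  refine (div_le_self (sub_nonneg.2 h2) hf).trans ?_
  rw [← mul_div_assoc, le_div_iff₀ hd']
  linarith

/-- The leading constant of the mean number of components with `n + 1` vertices. -/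
noncomputable def leadConst (p : ℝ) (n : ℕ) : ℝ :=
  ((n : ℝ) + 1) ^ (n - 1) / (((n : ℝ) + 1) * n.factorial) * (p / (1 - p) ^ 2) ^ n

section

variable {p : ℝ}

theorem compProb_le_of_mem (hp0 : 0 ≤ p) (hp1 : p < 1) {d t : ℕ} {S : Finset (Fin d → Bool)}
    (hS : S ∈ connSets d t) : compProb p S ≤ ((1 - p) ^ (t * t))⁻¹ * (1 - p) ^ (t * d) := by
  have hq : 0 < 1 - p := sub_pos.2 hp1
  have h := card_bdry_ge S
  rw [(mem_connSets.1 hS).1] at h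
  refine (compProb_le hp0 hp1.le S).trans ?_
  rw [inv_mul_eq_div, le_div_iff₀ (pow_pos hq _), ← pow_add]
  exact pow_le_pow_of_le_one hq.le (by linarith) h

open scoped Classical in
-- Tree-like sets are counted and weighed exactly, the only error being that of replacing `d.choose
-- n` by `d ^ n / n!`. The other sets are fewer by a factor of order `d`.
theorem sum_compProb_through (hp0 : 0 ≤ p) (hp1 : p < 1) (n : ℕ) :
    ∃ C : ℝ, ∀ d : ℕ, n + 2 ≤ d → ∀ y : Fin d → Bool,
      |∑ S ∈ connSets d (n + 1) with y ∈ S, compProb p S -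
        ((n : ℝ) + 1) ^ (n - 1) * (p / (1 - p) ^ 2) ^ n / n.factorial * (d : ℝ) ^ n *
          (1 - p) ^ ((n + 1) * d)| ≤ C * ((d : ℝ) ^ n / d * (1 - p) ^ ((n + 1) * d)) := by
  have hq : 0 < 1 - p := sub_pos.2 hp1
  set A : ℝ := ((n : ℝ) + 1) ^ (n - 1) * (p / (1 - p) ^ 2) ^ n with hA
  have hA0 : 0 ≤ A := by positivity
  set B : ℝ := ((1 - p) ^ ((n + 1) * (n + 1)))⁻¹ with hB
  have hB0 : 0 ≤ B := by positivity
  set K : ℝ := 2 ^ 2 ^ (n - 1) with hK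
  refine ⟨A * (n : ℝ) ^ 2 + K * B, fun d hd y => ?_⟩
  have hd1 : 1 ≤ d := by omega
  have hd' : (0 : ℝ) < d := by exact_mod_cast hd1
  set Q : ℝ := (1 - p) ^ ((n + 1) * d) with hQ
  have hQ0 : 0 ≤ Q := by positivity
  rw [← Finset.sum_filter_add_sum_filter_not ((connSets d (n + 1)).filter fun S => y ∈ S)
    (fun S => ((family y S).sup id).card = n), Finset.filter_filter, Finset.filter_filter]
  have hT : ∑ S ∈ connSets d (n + 1) with y ∈ S ∧ ((family y S).sup id).card = n, compProb p S =
      d.choose n * A * Q := by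
    rw [Finset.sum_congr rfl (g := fun _ => (p / (1 - p) ^ 2) ^ n * Q), Finset.sum_const,
      card_treeLike, nsmul_eq_mul, hA]
    · push_cast; ring
    · intro S hS
      obtain ⟨hS1, hS2, hS3⟩ := Finset.mem_filter.1 hS
      obtain ⟨h1, h2⟩ := compProb_of_treeLike p hS1 hS2 hS3
      rw [h2, hQ, pow_sub₀ _ hq.ne' h1, div_pow, ← pow_mul]
      field_simp
  have hNcard : (((connSets d (n + 1)).filter fun S =>
      y ∈ S ∧ ¬ ((family y S).sup id).card = n).card : ℝ) ≤ K * ((d : ℝ) ^ n / d) := by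
    -- For `n = 0` there are no other sets; for `n = m + 1` they use at most `m` directions.
    rcases n with _ | m
    · have : ((connSets d (0 + 1)).filter fun S =>
          y ∈ S ∧ ¬ ((family y S).sup id).card = 0) = ∅ := by
        refine Finset.filter_eq_empty_iff.2 fun S hS h => h.2 ?_
        have := card_support_family hS h.1
        omega
      rw [this]
      simp only [Finset.card_empty, Nat.cast_zero]
      positivity
    · have hsub : ((connSets d (m + 1 + 1)).filter fun S =>
          y ∈ S ∧ ¬ ((family y S).sup id).card = m + 1) ⊆
          (connSets d (m + 1 + 1)).filter fun S => y ∈ S ∧ ((family y S).sup id).card ≤ m := by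
        intro S hS
        obtain ⟨hS1, hS2, hS3⟩ := Finset.mem_filter.1 hS
        refine Finset.mem_filter.2 ⟨hS1, hS2, ?_⟩
        have := card_support_family hS1 hS2
        omega
      have h1 := (Finset.card_le_card hsub).trans
        (card_connSets_support_le (t := m + 1 + 1) (by omega : m ≤ d) y)
      have h2 : (d : ℝ) ^ (m + 1) / d = (d : ℝ) ^ m := by
        rw [pow_succ]; field_simp
      rw [h2, hK, Nat.add_sub_cancel]
      exact_mod_cast h1
  have hN0 : 0 ≤ ∑ S ∈ connSets d (n + 1) with y ∈ S ∧ ¬ ((family y S).sup id).card = n,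
      compProb p S := Finset.sum_nonneg fun S _ => compProb_nonneg hp0 hp1.le S
  have hN : ∑ S ∈ connSets d (n + 1) with y ∈ S ∧ ¬ ((family y S).sup id).card = n,
      compProb p S ≤ K * B * ((d : ℝ) ^ n / d * Q) := by
    refine (Finset.sum_le_card_nsmul _ _ (B * Q) fun S hS =>
      compProb_le_of_mem hp0 hp1 (Finset.mem_filter.1 hS).1).trans ?_
    rw [nsmul_eq_mul]
    calc _ ≤ K * ((d : ℝ) ^ n / d) * (B * Q) :=
          mul_le_mul_of_nonneg_right hNcard (mul_nonneg hB0 hQ0)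
      _ = _ := by ring
  rw [hT]
  have hch := choose_sub_pow_bound (d := d) (n := n) hd1
  have e1 : ∀ z : ℝ, (d.choose n : ℝ) * A * Q + z - A / n.factorial * (d : ℝ) ^ n * Q =
      ((d.choose n : ℝ) - (d : ℝ) ^ n / n.factorial) * (A * Q) + z := by
    intro z; ring
  rw [e1]
  refine (abs_add_le _ _).trans ?_
  rw [abs_mul, abs_of_nonneg (mul_nonneg hA0 hQ0), abs_of_nonneg hN0]
  calc _ ≤ (n : ℝ) ^ 2 * ((d : ℝ) ^ n / d) * (A * Q) + K * B * ((d : ℝ) ^ n / d * Q) := by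
        gcongr
    _ = _ := by ring

end

theorem sum_card_mul_eq {d t : ℕ} (p : ℝ) :
    (t : ℝ) * ∑ S ∈ connSets d t, compProb p S =
      ∑ y : Fin d → Bool, ∑ S ∈ connSets d t with y ∈ S, compProb p S := by
  classical
  simp only [Finset.sum_filter]
  rw [Finset.sum_comm, Finset.mul_sum]
  refine Finset.sum_congr rfl fun S hS => ?_
  rw [← Finset.sum_filter, Finset.sum_const, Finset.filter_mem_eq_inter, Finset.univ_inter,
    (mem_connSets.1 hS).1, nsmul_eq_mul]

/-- Summing over the `2 ^ d` roots `y` counts each set `n + 1` times. -/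
theorem mean_bound (p : unitInterval) (hp1 : (p : ℝ) < 1) (n : ℕ) :
    ∃ C : ℝ, ∀ d : ℕ, n + 2 ≤ d →
      |mean p (n + 1) d - leadConst p n * (d : ℝ) ^ n * (2 * (1 - (p : ℝ)) ^ (n + 1)) ^ d| ≤
        C * ((d : ℝ) ^ n / d * (2 * (1 - (p : ℝ)) ^ (n + 1)) ^ d) := by
  classical
  obtain ⟨C, hC⟩ := sum_compProb_through p.2.1 hp1 n
  refine ⟨C, fun d hd => ?_⟩
  have hsum := sum_card_mul_eq (d := d) (t := n + 1) (p : ℝ)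
  rw [← mean_eq_sum] at hsum
  set a : ℝ := ((n : ℝ) + 1) ^ (n - 1) * ((p : ℝ) / (1 - p) ^ 2) ^ n / n.factorial with ha
  set Q : ℝ := (1 - (p : ℝ)) ^ ((n + 1) * d) with hQ
  have hn : (0 : ℝ) < (n : ℝ) + 1 := by positivity
  have hQQ : (2 * (1 - (p : ℝ)) ^ (n + 1)) ^ d = 2 ^ d * Q := by
    rw [mul_pow, ← pow_mul]
  have hlead : leadConst p n = a / ((n : ℝ) + 1) := by
    rw [leadConst, ha]
    field_simp
  have hcardV : (Finset.univ : Finset (Fin d → Bool)).card = 2 ^ d := by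
    simp [Finset.card_univ]
  have hdiff : ((n : ℝ) + 1) * (mean p (n + 1) d - a / ((n : ℝ) + 1) * (d : ℝ) ^ n * (2 ^ d * Q)) =
      ∑ y : Fin d → Bool, (∑ S ∈ connSets d (n + 1) with y ∈ S, compProb p S -
        a * (d : ℝ) ^ n * Q) := by
    rw [Finset.sum_sub_distrib, ← hsum, Finset.sum_const, hcardV, nsmul_eq_mul]
    push_cast
    field_simp
  have habs : ((n : ℝ) + 1) *
      |mean p (n + 1) d - a / ((n : ℝ) + 1) * (d : ℝ) ^ n * (2 ^ d * Q)| ≤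
      2 ^ d * (C * ((d : ℝ) ^ n / d * Q)) := by
    rw [← abs_of_pos hn, ← abs_mul, abs_of_pos hn, hdiff]
    refine (Finset.abs_sum_le_sum_abs _ _).trans ?_
    refine (Finset.sum_le_card_nsmul _ _ _ fun y _ => hC d hd y).trans ?_
    rw [hcardV, nsmul_eq_mul]
    push_cast
    exact le_rfl
  rw [hQQ, hlead]
  have h1 : |mean p (n + 1) d - a / ((n : ℝ) + 1) * (d : ℝ) ^ n * (2 ^ d * Q)| ≤
      ((n : ℝ) + 1) * |mean p (n + 1) d - a / ((n : ℝ) + 1) * (d : ℝ) ^ n * (2 ^ d * Q)| :=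
    le_mul_of_one_le_left (abs_nonneg _) (by linarith [(Nat.cast_nonneg n : (0 : ℝ) ≤ n)])
  refine (h1.trans habs).trans (le_of_eq (by ring))

/-! ### Local dependence -/

open scoped Classical in
-- This sum is both the Stein–Chen error before division by the mean and a bound for the variance
-- minus the mean. For fixed `S` there are O(d^t) terms, each at most `compProb p S` times
-- O(q^(td)).
theorem dependence_bound {p : ℝ} (hp0 : 0 ≤ p) (hp1 : p < 1) {t : ℕ} (ht : 1 ≤ t) :
    ∃ C : ℝ, 0 ≤ C ∧ ∀ d : ℕ, t ≤ d →
      ∑ S ∈ connSets d t, (compProb p S * ∑ S' ∈ connSets d t with Near S S', compProb p S' +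
        ∑ S' ∈ connSets d t with Near S S' ∧ S' ≠ S, pairProb p S S') ≤
      C * ((d : ℝ) ^ t * (1 - p) ^ (t * d)) * ∑ S ∈ connSets d t, compProb p S := by
  have hq : 0 < 1 - p := sub_pos.2 hp1
  set K : ℝ := 2 * t * 2 ^ 2 ^ (t - 1) with hK
  have hK0 : 0 ≤ K := by positivity
  set B₁ : ℝ := ((1 - p) ^ (t * t))⁻¹ with hB₁
  set B₂ : ℝ := ((1 - p) ^ (t * t + t * t))⁻¹ with hB₂
  have hB₁0 : 0 ≤ B₁ := by positivity
  have hB₂0 : 0 ≤ B₂ := by positivity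
  refine ⟨K * B₁ + K * B₂, by positivity, fun d hd => ?_⟩
  set Q : ℝ := (1 - p) ^ (t * d) with hQ
  have hQ0 : 0 ≤ Q := by positivity
  rw [Finset.mul_sum]
  refine Finset.sum_le_sum fun S hS => ?_
  have hP0 := compProb_nonneg hp0 hp1.le S
  have hcard : (((connSets d t).filter fun S' => Near S S').card : ℝ) ≤ K * (d : ℝ) ^ t := by
    have := card_near_le ht hd hS
    rw [hK]
    exact_mod_cast this
  have h1 : ∑ S' ∈ connSets d t with Near S S', compProb p S' ≤ K * (d : ℝ) ^ t * (B₁ * Q) := by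
    refine (Finset.sum_le_card_nsmul _ _ (B₁ * Q) fun S' hS' =>
      compProb_le_of_mem hp0 hp1 (Finset.mem_filter.1 hS').1).trans ?_
    rw [nsmul_eq_mul]
    exact mul_le_mul_of_nonneg_right hcard (by positivity)
  have h2 : ∑ S' ∈ connSets d t with Near S S' ∧ S' ≠ S, pairProb p S S' ≤
      K * (d : ℝ) ^ t * (compProb p S * (B₂ * Q)) := by
    refine (Finset.sum_le_card_nsmul _ _ (compProb p S * (B₂ * Q)) fun S' hS' => ?_).trans ?_
    · obtain ⟨hS'1, -, hne⟩ := Finset.mem_filter.1 hS'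
      have := pairProb_le hp0 hp1 hne.symm
      rw [(mem_connSets.1 hS'1).1, (mem_connSets.1 hS).1] at this
      rwa [hB₂, inv_mul_eq_div]
    · rw [nsmul_eq_mul]
      refine mul_le_mul_of_nonneg_right (le_trans ?_ hcard) (by positivity)
      exact_mod_cast Finset.card_le_card fun S' hS' => by
        obtain ⟨h, h', -⟩ := Finset.mem_filter.1 hS'
        exact Finset.mem_filter.2 ⟨h, h'⟩
  calc _ ≤ compProb p S * (K * (d : ℝ) ^ t * (B₁ * Q)) +
        K * (d : ℝ) ^ t * (compProb p S * (B₂ * Q)) := by gcongr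
    _ = _ := by ring

theorem near_self {d : ℕ} {S : Finset (Fin d → Bool)} (h : S.Nonempty) : Near S S := by
  obtain ⟨x, hx⟩ := h
  exact ⟨x, hx, x, hx, .inl rfl⟩

theorem nonempty_of_mem_connSets {d t : ℕ} (ht : 1 ≤ t) {S : Finset (Fin d → Bool)}
    (hS : S ∈ connSets d t) : S.Nonempty := by
  rw [← Finset.card_pos, (mem_connSets.1 hS).1]
  exact ht

open scoped Classical in
-- Covariances of sets that are not near vanish and the diagonal pair probabilities add up to the
-- mean. What remains is a difference of two nonnegative sums, so their total bounds it.
theorem abs_var_sub_mean_le (p : unitInterval) {t : ℕ} (ht : 1 ≤ t) (d : ℕ) :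
    |var p t d - mean p t d| ≤
      ∑ S ∈ connSets d t, (compProb p S * ∑ S' ∈ connSets d t with Near S S', compProb p S' +
        ∑ S' ∈ connSets d t with Near S S' ∧ S' ≠ S, pairProb p S S') := by
  have hvar : var p t d = ∑ S ∈ connSets d t, ∑ S' ∈ connSets d t,
      (pairProb p S S' - compProb p S * compProb p S') := by
    rw [var, variance_eq_sub MemLp.of_discrete]
    have h1 : ∫ G, (numComp t G : ℝ) ∂(law p d) = ∑ S ∈ connSets d t, compProb p S :=
      mean_eq_sum p t d
    have h2 : ∫ G, ((numComp t G : ℝ)) ^ 2 ∂(law p d) =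
        ∑ S ∈ connSets d t, ∑ S' ∈ connSets d t, pairProb p S S' := by
      rw [integral_numComp p t d fun k => (k : ℝ) ^ 2]
      simp only [pairProb]
      rw [Finset.sum_congr rfl fun S _ => Finset.sum_comm, Finset.sum_comm]
      refine Finset.sum_congr rfl fun ω _ => ?_
      push_cast
      rw [sq, Finset.sum_mul_sum, Finset.mul_sum]
      exact Finset.sum_congr rfl fun S _ => by rw [Finset.mul_sum]
    simp only [Pi.pow_apply]
    rw [h1, h2, sq, Finset.sum_mul_sum]
    simp only [Finset.sum_sub_distrib]
  rw [hvar, mean_eq_sum, ← Finset.sum_sub_distrib]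
  refine (Finset.abs_sum_le_sum_abs _ _).trans (Finset.sum_le_sum fun S hS => ?_)
  have hsplit : ∑ S' ∈ connSets d t, (pairProb p S S' - compProb p S * compProb p S') =
      ∑ S' ∈ connSets d t with Near S S', pairProb p S S' -
        compProb p S * ∑ S' ∈ connSets d t with Near S S', compProb p S' := by
    rw [← Finset.sum_filter_add_sum_filter_not (connSets d t) (Near S),
      Finset.sum_eq_zero (s := (connSets d t).filter fun S' => ¬ Near S S'), add_zero,
      Finset.sum_sub_distrib, Finset.mul_sum]
    intro S' hS'
    rw [pairProb_of_not_near p (Finset.mem_filter.1 hS').2, sub_self]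
  have hself : ((connSets d t).filter fun S' => Near S S') =
      insert S ((connSets d t).filter fun S' => Near S S' ∧ S' ≠ S) := by
    ext S'
    simp only [Finset.mem_filter, Finset.mem_insert]
    by_cases h : S' = S
    · subst h
      simp [hS, near_self (nonempty_of_mem_connSets ht hS)]
    · simp [h]
  have hpair : ∑ S' ∈ connSets d t with Near S S', pairProb p S S' =
      compProb p S + ∑ S' ∈ connSets d t with Near S S' ∧ S' ≠ S, pairProb p S S' := by
    rw [hself, Finset.sum_insert (by simp), pairProb_self]
  have hA : 0 ≤ ∑ S' ∈ connSets d t with Near S S' ∧ S' ≠ S, pairProb p S S' :=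
    Finset.sum_nonneg fun S' _ => pairProb_nonneg p.2.1 p.2.2 S S'
  have hB : 0 ≤ compProb p S * ∑ S' ∈ connSets d t with Near S S', compProb p S' :=
    mul_nonneg (compProb_nonneg p.2.1 p.2.2 S)
      (Finset.sum_nonneg fun S' _ => compProb_nonneg p.2.1 p.2.2 S')
  rw [hsplit, hpair, abs_le]
  constructor <;> linarith

/-! ### Poisson approximation -/

theorem integral_nat_eq_tsum (μ : Measure ℕ) [IsProbabilityMeasure μ] {f : ℕ → ℝ}
    (hf : Integrable f μ) : ∫ k, f k ∂μ = ∑' k, f k * μ.real {k} := by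
  rw [integral_countable hf]
  simp only [smul_eq_mul, mul_comm]

theorem integrable_of_mem_unit (μ : Measure ℕ) [IsProbabilityMeasure μ] {f : ℕ → ℝ}
    (h0 : ∀ k, 0 ≤ f k) (h1 : ∀ k, f k ≤ 1) : Integrable f μ :=
  Integrable.of_bound (measurable_of_countable f).aestronglyMeasurable 1
    (Eventually.of_forall fun k => by
      rw [Real.norm_of_nonneg (h0 k)]; exact h1 k)

theorem hasSum_real_singleton (μ : Measure ℕ) [IsProbabilityMeasure μ] :
    HasSum (fun k => μ.real {k}) 1 := by
  have h1 : ∑' k, μ {k} = 1 := by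
    rw [← measure_iUnion (fun i j hij => Set.disjoint_singleton.2 hij)
      (fun k => measurableSet_singleton k), Set.iUnion_of_singleton, measure_univ]
  have h2 := ENNReal.hasSum_toReal (f := fun k => μ {k}) (by rw [h1]; exact ENNReal.one_ne_top)
  rwa [← ENNReal.tsum_toReal_eq (fun k => measure_ne_top μ _), h1, ENNReal.toReal_one] at h2

/-- Stated for all test functions with values in [0,1], so as to serve both the total variation
bound and the tail estimate. -/
theorem abs_integral_sub_poisson_le (p : unitInterval) {t : ℕ} (ht : 1 ≤ t)
    (hp1 : (p : ℝ) < 1) : ∃ C : ℝ, 0 ≤ C ∧ ∀ d : ℕ, t ≤ d → 0 < mean p t d →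
      ∀ f : ℕ → ℝ, (∀ k, 0 ≤ f k) → (∀ k, f k ≤ 1) →
      |∫ k, f k ∂((law p d).map (numComp t)) - ∫ k, f k ∂(poissonMeasure (mean p t d).toNNReal)| ≤
        C * ((d : ℝ) ^ t * (1 - (p : ℝ)) ^ (t * d)) := by
  classical
  obtain ⟨C, hC0, hC⟩ := dependence_bound p.2.1 hp1 ht
  refine ⟨C, hC0, fun d hd hm f hf0 hf1 => ?_⟩
  set lam := mean p t d with hlam
  set w : ℕ → ℝ := fun k => (poissonMeasure lam.toNNReal).real {k} with hw
  have hwk : ∀ k, w k = Real.exp (-lam) * lam ^ k / k.factorial := fun k => by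
    rw [hw]
    simp only
    rw [poissonMeasure_real_singleton, Real.coe_toNNReal _ hm.le]
  have hpos : ∀ k, 0 < w k := fun k => by rw [hwk]; positivity
  have hsum : HasSum w 1 := by
    have := hasSum_one_poissonMeasure lam.toNNReal
    rw [Real.coe_toNNReal _ hm.le] at this
    simpa only [← hwk] using this
  have hrec : ∀ k : ℕ, ((k : ℝ) + 1) * w (k + 1) = lam * w k := fun k => by
    rw [hwk, hwk, Nat.factorial_succ]
    push_cast
    field_simp
    ring
  rw [integral_map (measurable_of_finite _).aemeasurable
      (measurable_of_countable f).aestronglyMeasurable, integral_numComp,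
    integral_nat_eq_tsum _ (integrable_of_mem_unit _ hf0 hf1)]
  have hst := stein_chen (cubeEdges d).powerset (bw p (cubeEdges d))
    (fun ω _ => bw_nonneg p.2.1 p.2.2 _ ω) (connSets d t) compInd compInd_eq_zero_or_one Near
    (fun S hS => near_self (nonempty_of_mem_connSets ht hS)) (compProb p) (fun _ => rfl)
    (fun S _ g => compInd_indep p t S g) (sum_bw _ _) (hlam.trans (mean_eq_sum p t d)) hm hpos hsum
    hrec f hf0 hf1
  refine hst.trans ?_
  have h2 := hC d hd
  rw [← mean_eq_sum, ← hlam] at h2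
  rw [one_div, inv_mul_le_iff₀ hm, mul_comm lam]
  refine le_trans (le_of_eq ?_) h2
  simp only [pairProb]
  congr!

/-- Test against the indicator of the points where `μ` has at least the mass of `ν`. Both masses sum
to 1, so the positive part is half of the total. -/
theorem tvDist_le {μ ν : Measure ℕ} [IsProbabilityMeasure μ] [IsProbabilityMeasure ν] {ε : ℝ}
    (h : ∀ f : ℕ → ℝ, (∀ k, 0 ≤ f k) → (∀ k, f k ≤ 1) → |∫ k, f k ∂μ - ∫ k, f k ∂ν| ≤ ε) :
    tvDist μ ν ≤ ε := by
  classical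
  set a : ℕ → ℝ := fun k => μ.real {k} with ha
  set b : ℕ → ℝ := fun k => ν.real {k} with hb
  have hsa : HasSum a 1 := hasSum_real_singleton μ
  have hsb : HasSum b 1 := hasSum_real_singleton ν
  set f : ℕ → ℝ := fun k => if b k ≤ a k then 1 else 0 with hf
  have hf0 : ∀ k, 0 ≤ f k := fun k => by rw [hf]; simp only; split_ifs <;> norm_num
  have hf1 : ∀ k, f k ≤ 1 := fun k => by rw [hf]; simp only; split_ifs <;> norm_num
  have hfa : Summable fun k => f k * a k := Summable.of_nonneg_of_le
    (fun k => mul_nonneg (hf0 k) measureReal_nonneg)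
    (fun k => mul_le_of_le_one_left measureReal_nonneg (hf1 k)) hsa.summable
  have hfb : Summable fun k => f k * b k := Summable.of_nonneg_of_le
    (fun k => mul_nonneg (hf0 k) measureReal_nonneg)
    (fun k => mul_le_of_le_one_left measureReal_nonneg (hf1 k)) hsb.summable
  have key := h f hf0 hf1
  rw [integral_nat_eq_tsum μ (integrable_of_mem_unit _ hf0 hf1),
    integral_nat_eq_tsum ν (integrable_of_mem_unit _ hf0 hf1)] at key
  have habs : ∀ k, |a k - b k| = 2 * (f k * a k - f k * b k) - (a k - b k) := by
    intro k
    rw [hf]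
    simp only
    split_ifs with hk
    · rw [abs_of_nonneg (sub_nonneg.2 hk)]; ring
    · rw [abs_of_nonpos (by linarith)]; ring
  have htsum : ∑' k, |a k - b k| = 2 * (∑' k, f k * a k - ∑' k, f k * b k) := by
    simp only [habs]
    have := (((hfa.hasSum.sub hfb.hasSum).mul_left 2).sub (hsa.sub hsb)).tsum_eq
    rw [this]
    ring
  rw [tvDist, htsum]
  linarith [le_abs_self (∑' k, f k * a k - ∑' k, f k * b k)]

/-! ### Tails and characteristic functions of Poisson distributions -/

theorem hasSum_exp_mul_poisson {lam : ℝ} (hlam : 0 < lam) (θ : ℝ) :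
    HasSum (fun k : ℕ => Real.exp (θ * k) * (poissonMeasure lam.toNNReal).real {k})
      (Real.exp (lam * (Real.exp θ - 1))) := by
  have h := (NormedSpace.expSeries_div_hasSum_exp (lam * Real.exp θ)).mul_left (Real.exp (-lam))
  rw [← Real.exp_eq_exp_ℝ, ← Real.exp_add] at h
  have hk : ∀ k : ℕ, Real.exp (θ * k) * (poissonMeasure lam.toNNReal).real {k} =
      Real.exp (-lam) * ((lam * Real.exp θ) ^ k / k.factorial) := fun k => by
    rw [poissonMeasure_real_singleton, Real.coe_toNNReal _ hlam.le, mul_pow, ← Real.exp_nat_mul,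
      mul_comm θ]
    ring
  rw [show lam * (Real.exp θ - 1) = -lam + lam * Real.exp θ by ring]
  simp only [hk]
  exact h

/-- Exponential Markov inequality for both tails, using that exp(±θ) - 1 ∓ θ ≤ θ² for 0 ≤ θ ≤ 1. -/
theorem poisson_chernoff {lam θ x : ℝ} (hlam : 0 < lam) (hθ0 : 0 ≤ θ) (hθ1 : θ ≤ 1) :
    ∫ k, ({k : ℕ | x ≤ |(k : ℝ) - lam|} : Set ℕ).indicator (fun _ => (1 : ℝ)) k
      ∂(poissonMeasure lam.toNNReal) ≤ 2 * Real.exp (lam * θ ^ 2 - θ * x) := by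
  set f : ℕ → ℝ := ({k : ℕ | x ≤ |(k : ℝ) - lam|} : Set ℕ).indicator fun _ => (1 : ℝ) with hf
  set w : ℕ → ℝ := fun k => (poissonMeasure lam.toNNReal).real {k} with hw
  have hw0 : ∀ k, 0 ≤ w k := fun k => measureReal_nonneg
  have hf0 : ∀ k, 0 ≤ f k := fun k => Set.indicator_nonneg (fun _ _ => zero_le_one) k
  have hf1 : ∀ k, f k ≤ 1 := fun k => Set.indicator_le_self' (fun _ _ => zero_le_one) k
  rw [integral_nat_eq_tsum _ (integrable_of_mem_unit _ hf0 hf1)]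
  have h1 := (hasSum_exp_mul_poisson hlam θ).mul_left (Real.exp (-θ * (lam + x)))
  have h2 := (hasSum_exp_mul_poisson hlam (-θ)).mul_left (Real.exp (θ * (lam - x)))
  have hle : ∀ k, f k * w k ≤ Real.exp (-θ * (lam + x)) * (Real.exp (θ * k) * w k) +
      Real.exp (θ * (lam - x)) * (Real.exp (-θ * k) * w k) := by
    intro k
    rw [← mul_assoc, ← mul_assoc, ← add_mul, ← Real.exp_add, ← Real.exp_add]
    refine mul_le_mul_of_nonneg_right ?_ (hw0 k)
    by_cases hk : k ∈ ({k : ℕ | x ≤ |(k : ℝ) - lam|} : Set ℕ)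
    · rw [hf, Set.indicator_of_mem hk]
      rcases le_abs.1 (show x ≤ |(k : ℝ) - lam| from hk) with h | h
      · have : 1 ≤ Real.exp (-θ * (lam + x) + θ * k) := Real.one_le_exp (by nlinarith)
        linarith [Real.exp_pos (θ * (lam - x) + -θ * k)]
      · have : 1 ≤ Real.exp (θ * (lam - x) + -θ * k) := Real.one_le_exp (by nlinarith)
        linarith [Real.exp_pos (-θ * (lam + x) + θ * k)]
    · rw [hf, Set.indicator_of_notMem hk]
      positivity
  have hs := h1.add h2
  have hsf : Summable fun k => f k * w k :=
    Summable.of_nonneg_of_le (fun k => mul_nonneg (hf0 k) (hw0 k)) hle hs.summable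
  refine (Summable.tsum_le_tsum hle hsf hs.summable).trans ?_
  rw [hs.tsum_eq, ← Real.exp_add, ← Real.exp_add, two_mul]
  have e1 := (abs_le.1 (Real.abs_exp_sub_one_sub_id_le (x := θ) (by rwa [abs_of_nonneg hθ0]))).2
  have e2 := (abs_le.1 (Real.abs_exp_sub_one_sub_id_le (x := -θ)
    (by rwa [abs_neg, abs_of_nonneg hθ0]))).2
  refine add_le_add (Real.exp_le_exp.2 ?_) (Real.exp_le_exp.2 ?_) <;> nlinarith

theorem norm_integral_sub_le_tvDist {μ ν : Measure ℕ} [IsProbabilityMeasure μ]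
    [IsProbabilityMeasure ν] {g : ℕ → ℂ} (hg : ∀ k, ‖g k‖ ≤ 1) :
    ‖∫ k, g k ∂μ - ∫ k, g k ∂ν‖ ≤ 2 * tvDist μ ν := by
  have hint : ∀ (ρ : Measure ℕ) [IsProbabilityMeasure ρ], Integrable g ρ := fun ρ _ =>
    Integrable.of_bound (measurable_of_countable g).aestronglyMeasurable 1
      (Eventually.of_forall hg)
  have hsum : ∀ (ρ : Measure ℕ) [IsProbabilityMeasure ρ],
      Summable fun k => ρ.real {k} • g k := fun ρ _ =>
    Summable.of_norm_bounded (hasSum_real_singleton ρ).summable fun k => by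
      rw [norm_smul, Real.norm_of_nonneg measureReal_nonneg]
      exact mul_le_of_le_one_right measureReal_nonneg (hg k)
  have habs : Summable fun k => |μ.real {k} - ν.real {k}| :=
    ((hasSum_real_singleton μ).summable.sub (hasSum_real_singleton ν).summable).abs
  rw [integral_countable (hint μ), integral_countable (hint ν), ← (hsum μ).tsum_sub (hsum ν),
    tvDist, ← mul_assoc, mul_one_div_cancel two_ne_zero, one_mul]
  refine tsum_of_norm_bounded habs.hasSum fun k => ?_
  rw [← sub_smul, norm_smul, Real.norm_eq_abs]
  exact mul_le_of_le_one_right (abs_nonneg _) (hg k)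

/-- The characteristic functions of centred and rescaled Poisson variables converge to that of the
standard normal distribution. -/
theorem tendsto_poisson_exponent {m v : ℕ → ℝ} (hv : Tendsto v atTop atTop)
    (hmv : Tendsto (fun d => m d / v d) atTop (𝓝 1)) (s : ℝ) :
    Tendsto (fun d => (m d : ℂ) * (Complex.exp ((s / √(v d) : ℝ) * Complex.I) - 1 -
      (s / √(v d) : ℝ) * Complex.I)) atTop (𝓝 (-(s : ℂ) ^ 2 / 2)) := by
  have hu : Tendsto (fun d => s / √(v d)) atTop (𝓝 0) :=
    tendsto_const_nhds.div_atTop (Real.tendsto_sqrt_atTop.comp hv)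
  have hmu : Tendsto (fun d => m d * (s / √(v d)) ^ 2) atTop (𝓝 (s ^ 2)) := by
    have h := hmv.const_mul (s ^ 2)
    rw [mul_one] at h
    refine h.congr' ?_
    filter_upwards [hv.eventually_gt_atTop 0] with d hd
    rw [div_pow, Real.sq_sqrt hd.le]
    ring
  have hmain : Tendsto (fun d => -(((m d * (s / √(v d)) ^ 2 : ℝ) : ℂ)) / 2) atTop
      (𝓝 (-(s : ℂ) ^ 2 / 2)) := by
    have := (Complex.continuous_ofReal.tendsto _).comp hmu
    have h2 := this.neg.div_const (2 : ℂ)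
    push_cast at h2
    convert h2 using 1
    funext d
    simp
  have hz : Tendsto (fun d => |m d * (s / √(v d)) ^ 2| * |s / √(v d)|) atTop (𝓝 0) := by
    have := hmu.abs.mul hu.abs
    simpa using this
  -- Second-order Taylor expansion: with `u = s / √(v d)` the remainder is at most m|u|³ = (m
  -- u²)|u|, a bounded factor times one tending to 0.
  have herr : Tendsto (fun d => (m d : ℂ) * (Complex.exp ((s / √(v d) : ℝ) * Complex.I) - 1 -
      (s / √(v d) : ℝ) * Complex.I) - -(((m d * (s / √(v d)) ^ 2 : ℝ) : ℂ)) / 2) atTop (𝓝 0) := by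
    refine squeeze_zero_norm' ?_ hz
    have hsmall : ∀ᶠ d in atTop, |s / √(v d)| ≤ 1 := by
      have h0 := hu.abs
      rw [abs_zero] at h0
      exact (h0.eventually_lt_const zero_lt_one).mono fun d hd => hd.le
    filter_upwards [hsmall] with d hd
    set u : ℝ := s / √(v d) with hudef
    have hnorm : ‖(u : ℂ) * Complex.I‖ = |u| := by simp
    have hb := Complex.exp_bound (x := (u : ℂ) * Complex.I) (by rw [hnorm]; exact hd)
      (n := 3) (by norm_num)
    rw [hnorm] at hb
    simp only [Finset.sum_range_succ, Finset.range_zero, Finset.sum_empty, zero_add, pow_zero,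
      Nat.factorial, pow_one] at hb
    have hident : (m d : ℂ) * (Complex.exp ((u : ℂ) * Complex.I) - 1 - (u : ℂ) * Complex.I) -
        -(((m d * u ^ 2 : ℝ) : ℂ)) / 2 = (m d : ℂ) * (Complex.exp ((u : ℂ) * Complex.I) -
          (1 / ((1 : ℕ) : ℂ) + (u : ℂ) * Complex.I / (((0 + 1) * 1 : ℕ) : ℂ) +
            ((u : ℂ) * Complex.I) ^ 2 / (((1 + 1) * ((0 + 1) * 1) : ℕ) : ℂ))) := by
      have hI := Complex.I_sq
      push_cast
      linear_combination (m d * u ^ 2 / 2 : ℂ) * hI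
    rw [hident, norm_mul, Complex.norm_real, Real.norm_eq_abs]
    calc _ ≤ |m d| * (|u| ^ 3 * 1) := by
          refine mul_le_mul_of_nonneg_left (hb.trans ?_) (abs_nonneg _)
          refine mul_le_mul_of_nonneg_left ?_ (by positivity)
          norm_num
      _ = |m d * u ^ 2| * |u| := by
          rw [abs_mul, abs_pow]; ring
  have := herr.add hmain
  simpa using this

theorem integral_exp_poisson (r : NNReal) (a b : ℝ) :
    ∫ k : ℕ, Complex.exp (((a * ((k : ℝ) - b) : ℝ) : ℂ) * Complex.I) ∂(poissonMeasure r) =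
      Complex.exp ((r : ℂ) * (Complex.exp ((a : ℂ) * Complex.I) - 1) -
        (a : ℂ) * (b : ℂ) * Complex.I) := by
  have h := charFun_map_cast_poissonMeasure r a
  rw [charFun_apply_real, integral_map Measurable.of_discrete.aemeasurable
    (by fun_prop)] at h
  rw [sub_eq_add_neg, Complex.exp_add, ← h, ← integral_mul_const]
  refine integral_congr_ae (Eventually.of_forall fun k => ?_)
  simp only
  rw [← Complex.exp_add]
  congr 1
  push_cast
  ring

/-! ### Asymptotics -/

section Asymp

variable {p : unitInterval}

theorem leadConst_pos {p : ℝ} (hp0 : 0 < p) (hp1 : p < 1) (n : ℕ) : 0 < leadConst p n := by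
  have : 0 < 1 - p := sub_pos.2 hp1
  unfold leadConst
  positivity

/-- This is where the bound `t ≤ m_p` enters. -/
theorem one_le_two_mul_pow (hp0 : 0 < (p : ℝ)) (hp1 : (p : ℝ) < 1) {t : ℕ}
    (ht : t ≤ maxSize p) : 1 ≤ 2 * (1 - (p : ℝ)) ^ t := by
  have hq : 0 < 1 - (p : ℝ) := sub_pos.2 hp1
  have hq1 : 1 < 1 / (1 - (p : ℝ)) := by
    rw [lt_div_iff₀ hq]; linarith
  have hlog : 0 < Real.logb 2 (1 / (1 - (p : ℝ))) := Real.logb_pos one_lt_two hq1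
  have h1 : (t : ℝ) ≤ 1 / Real.logb 2 (1 / (1 - (p : ℝ))) := by
    refine le_trans ?_ (Nat.floor_le (by positivity))
    exact_mod_cast ht
  rw [le_div_iff₀ hlog, ← Real.logb_pow, Real.logb_le_iff_le_rpow one_lt_two (by positivity),
    Real.rpow_one, one_div, inv_pow, inv_le_comm₀ (by positivity) two_pos] at h1
  linarith

theorem exists_mean_ge (hp0 : 0 < (p : ℝ)) (hp1 : (p : ℝ) < 1 / 2) (n : ℕ)
    (hr : 1 ≤ 2 * (1 - (p : ℝ)) ^ (n + 1)) :
    ∃ c : ℝ, 0 < c ∧ ∀ᶠ d : ℕ in atTop, c * d ≤ mean p (n + 1) d := by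
  have hp1' : (p : ℝ) < 1 := by linarith
  obtain ⟨C, hC⟩ := mean_bound p hp1' n
  set r : ℝ := 2 * (1 - (p : ℝ)) ^ (n + 1) with hrdef
  set L := leadConst p n with hL
  have hL0 : 0 < L := leadConst_pos hp0 hp1' n
  -- For `n ≥ 1` the linear growth comes from `d ^ n`, as `r ≥ 1`. For `n = 0` it comes from `r >
  -- 1`, that is `p < 1 / 2`, by Bernoulli's inequality.
  obtain ⟨c, hc0, hc⟩ : ∃ c : ℝ, 0 < c ∧ ∀ d : ℕ, 1 ≤ d → c * d ≤ (d : ℝ) ^ n * r ^ d := by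
    rcases n with _ | m
    · have hr1 : 1 < r := by rw [hrdef, zero_add, pow_one]; linarith
      refine ⟨r - 1, by linarith, fun d _ => ?_⟩
      have := one_add_mul_le_pow (a := r - 1) (by linarith) d
      rw [pow_zero, one_mul]
      rw [add_sub_cancel] at this
      linarith
    · refine ⟨1, one_pos, fun d hd => ?_⟩
      have hd' : (1 : ℝ) ≤ d := by exact_mod_cast hd
      have h1 : (1 : ℝ) ≤ (d : ℝ) ^ m := one_le_pow₀ hd'
      have h2 : 1 ≤ r ^ d := one_le_pow₀ hr
      calc 1 * (d : ℝ) = 1 * d * 1 := by ring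
        _ ≤ (d : ℝ) ^ m * d * r ^ d := by gcongr
        _ = _ := by rw [pow_succ]
  refine ⟨L / 2 * c, by positivity, ?_⟩
  -- From here on the relative error takes away at most half of the leading term.
  have hlarge : ∀ᶠ d : ℕ in atTop, 2 * C / L ≤ d :=
    tendsto_natCast_atTop_atTop.eventually_ge_atTop _
  filter_upwards [hlarge, eventually_ge_atTop (n + 2)] with d h1 h2
  have hd1 : 1 ≤ d := by omega
  have hd' : (0 : ℝ) < d := by exact_mod_cast hd1
  have h3 := (abs_le.1 (hC d h2)).1
  have hX : 0 ≤ (d : ℝ) ^ n * r ^ d := by positivity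
  have h4 : C * ((d : ℝ) ^ n / d * r ^ d) ≤ L / 2 * ((d : ℝ) ^ n * r ^ d) := by
    have h5 : C / d ≤ L / 2 := by
      rw [div_le_iff₀ hL0] at h1
      rw [div_le_iff₀ hd']
      linarith
    calc C * ((d : ℝ) ^ n / d * r ^ d) = C / d * ((d : ℝ) ^ n * r ^ d) := by ring
      _ ≤ _ := by gcongr
  have h6 := mul_le_mul_of_nonneg_left (hc d hd1) (by positivity : 0 ≤ L / 2)
  linarith

theorem exists_exp_bound (hp0 : 0 < (p : ℝ)) (hp1 : (p : ℝ) < 1) {t : ℕ} (ht : 1 ≤ t) (C : ℝ) :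
    ∃ c : ℝ, 0 < c ∧ ∀ᶠ d : ℕ in atTop,
      C * ((d : ℝ) ^ t * (1 - (p : ℝ)) ^ (t * d)) ≤ Real.exp (-(c * d)) := by
  have hq : 0 < 1 - (p : ℝ) := sub_pos.2 hp1
  set a : ℝ := (1 - (p : ℝ)) ^ t with ha
  have ha0 : 0 < a := by positivity
  have ha1 : a < 1 := pow_lt_one₀ hq.le (by linarith) (by omega)
  have hlog : Real.log a < 0 := Real.log_neg ha0 ha1
  -- Half of the decay rate of `a ^ d`; the other half absorbs the polynomial factor.
  refine ⟨-Real.log a / 2, by linarith, ?_⟩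
  set b : ℝ := Real.exp (Real.log a / 2) with hb
  have hb0 : 0 < b := Real.exp_pos _
  have hb1 : b < 1 := by
    rw [hb, ← Real.exp_zero]
    exact Real.exp_lt_exp.2 (by linarith)
  have hbb : b * b = a := by
    rw [hb, ← Real.exp_add, add_halves, Real.exp_log ha0]
  have hlim := (tendsto_pow_const_mul_const_pow_of_lt_one t hb0.le hb1).const_mul C
  rw [mul_zero] at hlim
  filter_upwards [hlim.eventually_lt_const one_pos] with d hd
  have he : Real.exp (-(-Real.log a / 2 * d)) = b ^ d := by
    rw [hb, ← Real.exp_nat_mul]; congr 1; ring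
  rw [he, pow_mul, ← ha, ← hbb, mul_pow]
  calc C * ((d : ℝ) ^ t * (b ^ d * b ^ d)) = (C * ((d : ℝ) ^ t * b ^ d)) * b ^ d := by ring
    _ ≤ 1 * b ^ d := by gcongr
    _ = b ^ d := one_mul _

theorem tendsto_error_zero (hp0 : 0 < (p : ℝ)) (hp1 : (p : ℝ) < 1) {t : ℕ} (ht : 1 ≤ t) :
    Tendsto (fun d : ℕ => (d : ℝ) ^ t * (1 - (p : ℝ)) ^ (t * d)) atTop (𝓝 0) := by
  have hq : 0 < 1 - (p : ℝ) := sub_pos.2 hp1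
  simp only [pow_mul]
  exact tendsto_pow_const_mul_const_pow_of_lt_one t (by positivity)
    (pow_lt_one₀ hq.le (by linarith) (by omega))

instance (p : unitInterval) (t d : ℕ) : IsProbabilityMeasure ((law p d).map (numComp t)) :=
  Measure.isProbabilityMeasure_map (measurable_of_finite _).aemeasurable

theorem wvhp_sqrt (hp0 : 0 < (p : ℝ)) (hp1 : (p : ℝ) < 1) {t : ℕ} (ht : 1 ≤ t) {c : ℝ}
    (hc : 0 < c) (hmean : ∀ᶠ d : ℕ in atTop, c * d ≤ mean p t d) {ε : ℝ} (hε : 0 < ε) :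
    Wvhp p fun d G => |(numComp t G : ℝ) - mean p t d| < ε * √(d * mean p t d) := by
  obtain ⟨C, -, hC⟩ := abs_integral_sub_poisson_le p ht hp1
  obtain ⟨c₁, hc₁, hexp⟩ := exists_exp_bound hp0 hp1 ht C
  -- The Chernoff parameter will be `θ = δ * √(d / m)`, so that `m * θ ^ 2 = δ ^ 2 * d` and `θ * x =
  -- δ * ε * d`. Then `δ ≤ ε / 2` keeps the exponent below `-(δ * ε / 2) * d`, and `δ ≤ √c` with `c
  -- * d ≤ m` gives `θ ≤ 1`.
  set δ : ℝ := min (ε / 2) √c with hδ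
  have hδ0 : 0 < δ := lt_min (by positivity) (Real.sqrt_pos.2 hc)
  have hδε : δ ≤ ε / 2 := min_le_left _ _
  have hδc : δ ^ 2 ≤ c := by
    calc δ ^ 2 ≤ √c ^ 2 := by gcongr; exact min_le_right _ _
      _ = c := Real.sq_sqrt hc.le
  set c₂ : ℝ := δ * ε / 2 with hc₂
  have hc₂0 : 0 < c₂ := by positivity
  set c₃ : ℝ := min c₁ c₂ / 2 with hc₃
  have hc₃0 : 0 < c₃ := by have := lt_min hc₁ hc₂0; positivity
  refine ⟨c₃, hc₃0, ?_⟩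
  -- Makes `exp (c₃ * d) ≥ 3`, which absorbs the two Poisson tails and the approximation error, each
  -- at most `exp (-(2 * c₃ * d))`.
  have hlarge : ∀ᶠ d : ℕ in atTop, Real.log 3 / c₃ ≤ d :=
    tendsto_natCast_atTop_atTop.eventually_ge_atTop _
  filter_upwards [hmean, hexp, hlarge, eventually_ge_atTop t] with d hm he hl htd
  have hd : (0 : ℝ) < d := by exact_mod_cast ht.trans htd
  set m := mean p t d with hmdef
  have hm0 : 0 < m := lt_of_lt_of_le (by positivity) hm
  set x : ℝ := ε * √(d * m) with hx
  set f : ℕ → ℝ := ({k : ℕ | x ≤ |(k : ℝ) - m|} : Set ℕ).indicator fun _ => (1 : ℝ) with hf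
  have hf0 : ∀ k, 0 ≤ f k := fun k => Set.indicator_nonneg (fun _ _ => zero_le_one) k
  have hf1 : ∀ k, f k ≤ 1 := fun k => Set.indicator_le_self' (fun _ _ => zero_le_one) k
  set θ : ℝ := δ * √(d / m) with hθ
  have hθ0 : 0 ≤ θ := by positivity
  have hθsq : m * θ ^ 2 = δ ^ 2 * d := by
    rw [hθ, mul_pow, Real.sq_sqrt (by positivity)]
    field_simp
  have hθ1 : θ ≤ 1 := by
    rw [← abs_of_nonneg hθ0, ← sq_le_one_iff_abs_le_one]
    have h1 : m * θ ^ 2 ≤ m * 1 := by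
      rw [hθsq, mul_one]
      exact (mul_le_mul_of_nonneg_right hδc hd.le).trans hm
    exact le_of_mul_le_mul_left h1 hm0
  have hθx : θ * x = δ * ε * d := by
    have : √(d / m) * √(d * m) = d := by
      rw [← Real.sqrt_mul (by positivity), show (d : ℝ) / m * (d * m) = d * d by field_simp,
        Real.sqrt_mul_self hd.le]
    rw [hθ, hx]
    linear_combination δ * ε * this
  have hpo := poisson_chernoff (x := x) hm0 hθ0 hθ1
  have hexpo : m * θ ^ 2 - θ * x ≤ -(c₂ * d) := by
    rw [hθsq, hθx, hc₂]
    nlinarith [mul_le_mul_of_nonneg_left hδε (mul_nonneg hδ0.le hd.le)]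
  have hint := (abs_le.1 (hC d htd hm0 f hf0 hf1)).2
  have htail : ∫ k, f k ∂((law p d).map (numComp t)) ≤ Real.exp (-(c₃ * d)) := by
    have h1 : Real.exp (m * θ ^ 2 - θ * x) ≤ Real.exp (-(2 * c₃ * d)) := by
      refine Real.exp_le_exp.2 (hexpo.trans ?_)
      have : 2 * c₃ ≤ c₂ := by rw [hc₃]; linarith [min_le_right c₁ c₂]
      nlinarith
    have h2 : Real.exp (-(c₁ * d)) ≤ Real.exp (-(2 * c₃ * d)) := by
      refine Real.exp_le_exp.2 ?_
      have : 2 * c₃ ≤ c₁ := by rw [hc₃]; linarith [min_le_left c₁ c₂]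
      nlinarith
    have h3 : 3 * Real.exp (-(2 * c₃ * d)) ≤ Real.exp (-(c₃ * d)) := by
      have h4 : (3 : ℝ) ≤ Real.exp (c₃ * d) := by
        rw [← Real.log_le_iff_le_exp (by norm_num)]
        rw [div_le_iff₀ hc₃0] at hl
        linarith
      have h5 : Real.exp (-(c₃ * d)) = Real.exp (c₃ * d) * Real.exp (-(2 * c₃ * d)) := by
        rw [← Real.exp_add]; congr 1; ring
      rw [h5]
      gcongr
    linarith
  have hset : ∫ k, f k ∂((law p d).map (numComp t)) =
      (law p d).real {G | |(numComp t G : ℝ) - m| < x}ᶜ := by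
    have h1 := integral_indicator_one (μ := (law p d).map (numComp t))
      (s := {k : ℕ | x ≤ |(k : ℝ) - m|}) MeasurableSet.of_discrete
    have h2 : f = ({k : ℕ | x ≤ |(k : ℝ) - m|} : Set ℕ).indicator 1 := rfl
    rw [h2, h1, map_measureReal_apply (measurable_of_finite _) MeasurableSet.of_discrete]
    congr 1
    ext G
    simp
  rw [hset, probReal_compl_eq_one_sub MeasurableSet.of_discrete] at htail
  linarith

theorem Wvhp.mono {E E' : ∀ d : ℕ, SimpleGraph (Fin d → Bool) → Prop} (h : Wvhp p E)
    (hE : ∀ᶠ d : ℕ in atTop, ∀ G, E d G → E' d G) : Wvhp p E' := by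
  obtain ⟨c, hc, hev⟩ := h
  refine ⟨c, hc, ?_⟩
  filter_upwards [hev, hE] with d hd hEd
  exact hd.trans (measureReal_mono fun G hG => hEd G hG)

/-- Since `c * d ≤ mean p t d`, the scale `√c * √(d * mean)` is at most the mean. -/
theorem wvhp_mul (hp0 : 0 < (p : ℝ)) (hp1 : (p : ℝ) < 1) {t : ℕ} (ht : 1 ≤ t) {c : ℝ}
    (hc : 0 < c) (hmean : ∀ᶠ d : ℕ in atTop, c * d ≤ mean p t d) {ε : ℝ} (hε : 0 < ε) :
    Wvhp p fun d G => |(numComp t G : ℝ) - mean p t d| < ε * mean p t d := by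
  refine (wvhp_sqrt hp0 hp1 ht hc hmean (ε := ε * √c) (by positivity)).mono ?_
  filter_upwards [hmean] with d hd G hG
  refine lt_of_lt_of_le hG ?_
  have hm0 : 0 ≤ mean p t d := le_trans (by positivity) hd
  rw [mul_assoc]
  refine mul_le_mul_of_nonneg_left ?_ hε.le
  rw [← Real.sqrt_mul hc.le]
  refine Real.sqrt_le_iff.2 ⟨hm0, ?_⟩
  nlinarith

theorem eventually_tvDist_le (hp1 : (p : ℝ) < 1) {t : ℕ} (ht : 1 ≤ t)
    {c : ℝ} (hc : 0 < c) (hmean : ∀ᶠ d : ℕ in atTop, c * d ≤ mean p t d) :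
    ∃ C : ℝ, ∀ᶠ d : ℕ in atTop,
      tvDist ((law p d).map (numComp t)) (poissonMeasure (mean p t d).toNNReal) ≤
        C * ((d : ℝ) ^ t * (1 - (p : ℝ)) ^ (t * d)) := by
  obtain ⟨C, -, hC⟩ := abs_integral_sub_poisson_le p ht hp1
  refine ⟨C, ?_⟩
  filter_upwards [hmean, eventually_ge_atTop t] with d hm htd
  have hd : (0 : ℝ) < d := by exact_mod_cast ht.trans htd
  exact tvDist_le (hC d htd (lt_of_lt_of_le (by positivity) hm))

theorem tvDist_nonneg (μ ν : Measure ℕ) : 0 ≤ tvDist μ ν :=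
  mul_nonneg (by norm_num) (tsum_nonneg fun _ => abs_nonneg _)

theorem eventually_abs_var_sub_mean_le (hp1 : (p : ℝ) < 1) {t : ℕ} (ht : 1 ≤ t) :
    ∃ C : ℝ, ∀ᶠ d : ℕ in atTop, |var p t d - mean p t d| ≤
      C * ((d : ℝ) ^ t * (1 - (p : ℝ)) ^ (t * d)) * mean p t d := by
  obtain ⟨C, -, hC⟩ := dependence_bound p.2.1 hp1 ht
  refine ⟨C, ?_⟩
  filter_upwards [eventually_ge_atTop t] with d htd
  have := (abs_var_sub_mean_le p ht d).trans (hC d htd)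
  rwa [← mean_eq_sum] at this

/-- By Lévy's continuity theorem it suffices to compare characteristic functions. Replacing X_t by a
Poisson variable of the same mean costs at most twice the total variation distance; the scaling by
the variance instead of the mean is harmless as their ratio tends to 1. -/
theorem tendstoInDistribution_normalized (hp0 : 0 < (p : ℝ)) (hp1 : (p : ℝ) < 1) {t : ℕ}
    (ht : 1 ≤ t) {c : ℝ} (hc : 0 < c) (hmean : ∀ᶠ d : ℕ in atTop, c * d ≤ mean p t d) :
    TendstoInDistribution
      (fun (d : ℕ) (G : SimpleGraph (Fin d → Bool)) =>
        ((numComp t G : ℝ) - mean p t d) / √(var p t d))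
      atTop (id : ℝ → ℝ) (law p) (gaussianReal 0 1) where
  forall_aemeasurable d := (measurable_of_finite _).aemeasurable
  aemeasurable_limit := measurable_id.aemeasurable
  tendsto := by
    have hmtop : Tendsto (mean p t) atTop atTop :=
      tendsto_atTop_mono' _ hmean (tendsto_natCast_atTop_atTop.const_mul_atTop hc)
    have herr := tendsto_error_zero hp0 hp1 ht
    obtain ⟨C, hC⟩ := eventually_abs_var_sub_mean_le hp1 ht
    obtain ⟨C', hC'⟩ := eventually_tvDist_le hp1 ht hc hmean
    have hvm : Tendsto (fun d => var p t d / mean p t d) atTop (𝓝 1) := by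
      have h0 : Tendsto (fun d => var p t d / mean p t d - 1) atTop (𝓝 0) := by
        have h1 := herr.const_mul C
        rw [mul_zero] at h1
        refine squeeze_zero_norm' ?_ h1
        filter_upwards [hC, hmtop.eventually_gt_atTop 0] with d hd hm
        rw [Real.norm_eq_abs, div_sub_one hm.ne', abs_div, abs_of_pos hm, div_le_iff₀ hm]
        exact hd
      simpa using h0.add_const 1
    have hmv : Tendsto (fun d => mean p t d / var p t d) atTop (𝓝 1) := by
      have := hvm.inv₀ one_ne_zero
      rw [inv_one] at this
      exact this.congr fun d => inv_div _ _
    have hvtop : Tendsto (var p t) atTop atTop := by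
      have := hvm.pos_mul_atTop one_pos hmtop
      refine this.congr' ?_
      filter_upwards [hmtop.eventually_gt_atTop 0] with d hm
      field_simp
    refine ProbabilityMeasure.tendsto_iff_tendsto_charFun.2 fun s => ?_
    have hlim : charFun ((gaussianReal 0 1).map (id : ℝ → ℝ)) s =
        Complex.exp (-(s : ℂ) ^ 2 / 2) := by
      rw [Measure.map_id, charFun_gaussianReal]
      congr 1
      push_cast
      simp
      ring
    simp only [ProbabilityMeasure.coe_mk]
    rw [hlim]
    have hpoi := (Complex.continuous_exp.tendsto _).comp (tendsto_poisson_exponent hvtop hmv s)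
    have hdiff : Tendsto (fun d => charFun ((law p d).map
        (fun G => ((numComp t G : ℝ) - mean p t d) / √(var p t d))) s -
        Complex.exp ((mean p t d : ℂ) * (Complex.exp ((s / √(var p t d) : ℝ) * Complex.I) - 1 -
          (s / √(var p t d) : ℝ) * Complex.I))) atTop (𝓝 0) := by
      have h1 := (herr.const_mul C').const_mul 2
      rw [mul_zero, mul_zero] at h1
      refine squeeze_zero_norm' ?_ h1
      filter_upwards [hC', hmtop.eventually_gt_atTop 0] with d hd hm
      set g : ℕ → ℂ := fun k =>
        Complex.exp (((s / √(var p t d) * ((k : ℝ) - mean p t d) : ℝ) : ℂ) * Complex.I) with hg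
      have hg1 : ∀ k, ‖g k‖ ≤ 1 := fun k => (Complex.norm_exp_ofReal_mul_I _).le
      have e1 : charFun ((law p d).map
          (fun G => ((numComp t G : ℝ) - mean p t d) / √(var p t d))) s =
          ∫ k, g k ∂((law p d).map (numComp t)) := by
        rw [charFun_apply_real, integral_map (measurable_of_finite _).aemeasurable (by fun_prop),
          integral_map (measurable_of_finite _).aemeasurable
            (measurable_of_countable g).aestronglyMeasurable]
        refine integral_congr_ae (Eventually.of_forall fun G => ?_)
        simp only [hg]
        congr 1
        push_cast
        ring
      have e2 : Complex.exp ((mean p t d : ℂ) *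
          (Complex.exp ((s / √(var p t d) : ℝ) * Complex.I) - 1 -
            (s / √(var p t d) : ℝ) * Complex.I)) =
          ∫ k, g k ∂(poissonMeasure (mean p t d).toNNReal) := by
        rw [hg, integral_exp_poisson, Real.coe_toNNReal _ hm.le]
        congr 1
        ring
      rw [e1, e2]
      exact (norm_integral_sub_le_tvDist hg1).trans (mul_le_mul_of_nonneg_left hd two_pos.le)
    have := hdiff.add hpoi
    simpa using this

theorem lead_eq (p q : ℝ) (hq : q = 1 - p) (n d : ℕ) :
    (((n + 1 : ℕ) : ℝ) ^ (((n + 1 : ℕ) : ℤ) - 2) / ((n + 1).factorial : ℝ) *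
      (p / q ^ 2) ^ (n + 1 - 1) * (d : ℝ) ^ (n + 1 - 1) * (2 * q ^ (n + 1)) ^ d) =
      leadConst p n * (d : ℝ) ^ n * (2 * (1 - p) ^ (n + 1)) ^ d := by
  -- For `n = 0` the integer exponent is -1 and the natural one is 0, but the base is 1.
  have hz : ((n + 1 : ℕ) : ℝ) ^ (((n + 1 : ℕ) : ℤ) - 2) = ((n : ℝ) + 1) ^ (n - 1) := by
    rcases n with _ | m
    · simp
    · have : (((m + 1 + 1 : ℕ) : ℤ) - 2) = (m : ℤ) := by push_cast; ring
      rw [this, zpow_natCast, Nat.add_sub_cancel]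
      push_cast
      rfl
  rw [hz, hq, Nat.add_sub_cancel, leadConst, Nat.factorial_succ]
  push_cast
  rfl

end Asymp

end RandomCube

/-! ### The theorem, assembled with `t = n + 1`. -/

theorem theorem4 (p : unitInterval) (hp0 : 0 < (p : ℝ)) (hp1 : (p : ℝ) < 1 / 2)
    (q : ℝ) (hq : q = 1 - (p : ℝ)) (t : ℕ) (ht1 : 1 ≤ t) (ht2 : t ≤ RandomCube.maxSize p) :
    -- (a) mean: `μ_t = (1 + O(1/d)) (t^(t-2) / t!) (p/q²)^(t-1) d^(t-1) (2 q^t)^d`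
    ((fun d : ℕ => RandomCube.mean p t d -
          (t : ℝ) ^ ((t : ℤ) - 2) / (t.factorial : ℝ) * ((p : ℝ) / q ^ 2) ^ (t - 1) *
            (d : ℝ) ^ (t - 1) * (2 * q ^ t) ^ d)
        =O[atTop] fun d : ℕ => 1 / (d : ℝ) *
          ((t : ℝ) ^ ((t : ℤ) - 2) / (t.factorial : ℝ) * ((p : ℝ) / q ^ 2) ^ (t - 1) *
            (d : ℝ) ^ (t - 1) * (2 * q ^ t) ^ d)) ∧
    -- (a) variance: `Var(X_t) = (1 + O(d^t q^(td))) μ_t`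
    ((fun d : ℕ => RandomCube.var p t d - RandomCube.mean p t d)
        =O[atTop] fun d : ℕ => ((d : ℝ) ^ t * q ^ (t * d)) * RandomCube.mean p t d) ∧
    -- (b) concentration
    (∀ ε : ℝ, 0 < ε → RandomCube.Wvhp p fun d G =>
      |(RandomCube.numComp t G : ℝ) - RandomCube.mean p t d| <
        ε * Real.sqrt (d * RandomCube.mean p t d)) ∧
    (∀ ε : ℝ, 0 < ε → RandomCube.Wvhp p fun d G =>
      |(RandomCube.numComp t G : ℝ) - RandomCube.mean p t d| < ε * RandomCube.mean p t d) ∧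
    -- (c) Poisson approximation
    ((fun d : ℕ => RandomCube.tvDist ((RandomCube.law p d).map (RandomCube.numComp t))
          (poissonMeasure (RandomCube.mean p t d).toNNReal))
        =O[atTop] fun d : ℕ => (d : ℝ) ^ t * q ^ (t * d)) ∧
    -- (c) asymptotic normality
    TendstoInDistribution
      (fun (d : ℕ) (G : SimpleGraph (Fin d → Bool)) =>
        ((RandomCube.numComp t G : ℝ) - RandomCube.mean p t d) / Real.sqrt (RandomCube.var p t d))
      atTop (id : ℝ → ℝ) (RandomCube.law p) (gaussianReal 0 1) := by
  have hp1' : (p : ℝ) < 1 := by linarith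
  have hq0 : 0 < q := by rw [hq]; linarith
  obtain ⟨n, rfl⟩ : ∃ n, t = n + 1 := ⟨t - 1, by omega⟩
  obtain ⟨c, hc, hmean⟩ := RandomCube.exists_mean_ge hp0 hp1 n
    (RandomCube.one_le_two_mul_pow hp0 hp1' ht2)
  refine ⟨?_, ?_, fun ε hε => RandomCube.wvhp_sqrt hp0 hp1' ht1 hc hmean hε,
    fun ε hε => RandomCube.wvhp_mul hp0 hp1' ht1 hc hmean hε, ?_,
    RandomCube.tendstoInDistribution_normalized hp0 hp1' ht1 hc hmean⟩
  · obtain ⟨C, hC⟩ := RandomCube.mean_bound p hp1' n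
    have hL := RandomCube.leadConst_pos hp0 hp1' n
    refine IsBigO.of_bound (C / RandomCube.leadConst p n) ?_
    filter_upwards [eventually_ge_atTop (n + 2)] with d hd
    rw [RandomCube.lead_eq p q hq n d, Real.norm_eq_abs]
    refine (hC d hd).trans (le_of_eq ?_)
    have hq' : 0 < 1 - (p : ℝ) := sub_pos.2 hp1'
    rw [Real.norm_of_nonneg (by positivity)]
    field_simp
  · obtain ⟨C, hC⟩ := RandomCube.eventually_abs_var_sub_mean_le hp1' ht1
    refine IsBigO.of_bound C ?_
    filter_upwards [hC, hmean] with d hd hm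
    have hm0 : 0 ≤ RandomCube.mean p (n + 1) d := le_trans (by positivity) hm
    rw [Real.norm_eq_abs, Real.norm_of_nonneg (by positivity), hq, ← mul_assoc]
    exact hd
  · obtain ⟨C, hC⟩ := RandomCube.eventually_tvDist_le hp1' ht1 hc hmean
    refine IsBigO.of_bound C ?_
    filter_upwards [hC] with d hd
    rw [Real.norm_of_nonneg (RandomCube.tvDist_nonneg _ _), Real.norm_of_nonneg (by positivity), hq]
    exact hd
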